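/- Manifolds are smooth, Hausdorff, second countable and finite-dimensional. Definitions. An almost para-complex structure on a manifold $X$ is a smooth section $J$ of $\mathrm{End}\,TX$ with $J\neq \mathrm{Id}$, $J^2=\mathrm{Id}$, whose eigendistributions $T^{\pm}X=\ker(\mathrm{Id}\mp J)$ have the same rank; it is a para-complex structure if $T^+X$ and $T^-X$ are both integrable, i.e. around every point each of them is given by a constant linear subspace in suitable local coordinates. A complex structure is a smooth section $J$ of $\mathrm{End}\,TX$ with $J^2=-\mathrm{Id}$ that is integrable, i.e. $X$ has local holomorphic coordinates for $J$ around every point. A para-Kähler manifold $(M,J,g)$ is a manifold with a para-complex structure $J$ and a pseudo-Riemannian metric $g$ for which $J$ is skew-symmetric, such that the fundamental two-form $\omega=g(J\cdot,\cdot)$ is closed. A special para-Kähler manifold $(M,J,g,\nabla)$ is a para-Kähler manifold with a flat torsion-free connection $\nabla$ such that $\nabla\omega=0$ and $(\nabla_XJ)Y=(\nabla_YJ)X$ for all vector fields $X,Y$. A para-hyper-Kähler manifold is a manifold with a pseudo-Riemannian metric and three pairwise anticommuting fields of endomorphisms $J_1,J_2,J_3=J_1J_2$, two of which are para-complex structures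 and one of which is a complex structure, all skew-symmetric for the metric, and whose three fundamental two-forms are closed. Theorem. Let $(M,J,g,\nabla)$ be a special para-Kähler manifold with para-Kähler form $\omega=g(J\cdot,\cdot)$, and let $\pi:N=T^*M\to M$ be its cotangent bundle. For $\xi\in N$, $p=\pi(\xi)$, the connection gives the decomposition of $T_\xi N$ into the $\nabla$-horizontal space (identified with $T_pM$ by $d\pi_\xi$) and the vertical space $\ker d\pi_\xi$ (identified with $T^*_pM$), hence $T_\xi N\cong T_pM\oplus T_p^*M$. With respect to it put, for $v,v'\in T_pM$ and $\alpha,\alpha'\in T_p^*M$, $$J_1(v,\alpha)=(Jv,\ \alpha\circ J),\qquad J_2(v,\alpha)=(\omega^{-1}\alpha,\ \omega v),\qquad J_3=J_1J_2,$$ $$g_N\big((v,\alpha),(v',\alpha')\big)=g(v,v')+g^{-1}(\alpha,\alpha'),$$ where $\omega$ is regarded as the isomorphism $v\mapsto\omega(v,\cdot)$ and $g^{-1}$ is the metric on $T^*M$ dual to $g$. Then $(N,J_1,J_2,J_3,g_N)$ is a para-hyper-Kähler manifold: $J_1$ and $J_2$ are (integrable) para-complex structures, $J_3$ is a complex structure,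 the three are pairwise anticommuting and skew-symmetric with respect to the pseudo-Riemannian metric $g_N$, and the two-forms $g_N(J_\alpha\cdot,\cdot)$, $\alpha=1,2,3$, are closed. -/

import Mathlib

open Bundle
open scoped Manifold ContDiff Topology

noncomputable section

section Structures

variable {E : Type*} [NormedAddCommGroup E] [NormedSpace ℝ E]
  {H : Type*} [TopologicalSpace H] (I : ModelWithCorners ℝ E H)
  (X : Type*) [TopologicalSpace X] [ChartedSpace H X]

/-- Fields of endomorphisms of the tangent spaces (smoothness is a separate condition). -/
abbrev EndField : Type _ := Π x : X, TangentSpace I x →L[ℝ] TangentSpace I x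

/-- Fields of bilinear forms on the tangent spaces (smoothness is a separate condition). -/
abbrev BilinField : Type _ := Π x : X, TangentSpace I x →L[ℝ] TangentSpace I x →L[ℝ] ℝ

/-- Distributions: fields of linear subspaces of the tangent spaces. -/
abbrev SubspaceField : Type _ := Π x : X, Submodule ℝ (TangentSpace I x)

variable {X}

/-- The eigendistribution `ker (Id - J)`. -/
def eigenPlus (J : EndField I X) : SubspaceField I X := fun x ↦
  LinearMap.ker (ContinuousLinearMap.id ℝ (TangentSpace I x) - J x).toLinearMap

/-- The eigendistribution `ker (Id + J)`. -/
def eigenMinus (J : EndField I X) : SubspaceField I X := fun x ↦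
  LinearMap.ker (ContinuousLinearMap.id ℝ (TangentSpace I x) + J x).toLinearMap

/-- The fundamental form `g (J ·, ·)`. -/
def fundForm (J : EndField I X) (g : BilinField I X) : BilinField I X := fun x ↦ g x ∘L J x

variable [IsManifold I ∞ X]

/-- `V` is a smooth vector field. -/
def IsSmoothVectorField (V : Π x : X, TangentSpace I x) : Prop :=
  ContMDiff I I.tangent ∞ (fun x ↦ (⟨x, V x⟩ : TangentBundle I X))

/-- `A` is a smooth section of the bundle `End TX`. -/
def IsSmoothEndField (A : EndField I X) : Prop :=
  ContMDiff I (I.prod 𝓘(ℝ, E →L[ℝ] E)) ∞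
    (fun x ↦ TotalSpace.mk' (E →L[ℝ] E)
      (E := fun x : X ↦ TangentSpace I x →L[ℝ] TangentSpace I x) x (A x))

/-- `b` is a smooth section of the bundle of bilinear forms on `TX`. -/
def IsSmoothBilinField (b : BilinField I X) : Prop :=
  ContMDiff I (I.prod 𝓘(ℝ, E →L[ℝ] E →L[ℝ] ℝ)) ∞
    (fun x ↦ TotalSpace.mk' (E →L[ℝ] E →L[ℝ] ℝ)
      (E := fun x : X ↦ TangentSpace I x →L[ℝ] TangentSpace I x →L[ℝ] ℝ) x (b x))

/-- A distribution is integrable if around every point there is a smooth coordinate system in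
which it is given by a fixed linear subspace of the model space (a foliated chart); the level sets
of the transverse coordinates are then its local leaves. -/
def IsIntegrableDistribution (D : SubspaceField I X) : Prop :=
  ∀ x₀ : X, ∃ φ ∈ IsManifold.maximalAtlas I ∞ X, x₀ ∈ φ.source ∧ ∃ W : Submodule ℝ E,
    ∀ x ∈ φ.source, ∀ v : TangentSpace I x,
      v ∈ D x ↔ mfderiv I 𝓘(ℝ, E) (φ.extend I) x v ∈ W

/-- Almost para-complex structures: smooth fields of involutions, different from the identity,
whose two eigendistributions have the same rank. -/
structure IsAlmostParaComplex (J : EndField I X) : Prop where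
  smooth : IsSmoothEndField I J
  ne_id : J ≠ fun x ↦ ContinuousLinearMap.id ℝ (TangentSpace I x)
  involution : ∀ (x : X) (v : TangentSpace I x), J x (J x v) = v
  rank_eq : ∀ x : X, Module.finrank ℝ (eigenPlus I J x) = Module.finrank ℝ (eigenMinus I J x)

/-- Para-complex structures: both eigendistributions are integrable. -/
structure IsParaComplex (J : EndField I X) : Prop extends IsAlmostParaComplex I J where
  integrable_plus : IsIntegrableDistribution I (eigenPlus I J)
  integrable_minus : IsIntegrableDistribution I (eigenMinus I J)

/-- Almost complex structures. -/
structure IsAlmostComplex (J : EndField I X) : Prop where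
  smooth : IsSmoothEndField I J
  sq_eq_neg : ∀ (x : X) (v : TangentSpace I x), J x (J x v) = -v

/-- Complex structures: almost complex structures that are integrable, i.e. around every point
there are holomorphic coordinates, a smooth coordinate system whose differential intertwines `J`
with a constant linear complex structure `J₀` of the model space. -/
structure IsComplexStructure (J : EndField I X) : Prop extends IsAlmostComplex I J where
  integrable : ∀ x₀ : X, ∃ φ ∈ IsManifold.maximalAtlas I ∞ X, x₀ ∈ φ.source ∧
    ∃ J₀ : E →L[ℝ] E, (∀ u : E, J₀ (J₀ u) = -u) ∧
      ∀ x ∈ φ.source, ∀ v : TangentSpace I x,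
        mfderiv I 𝓘(ℝ, E) (φ.extend I) x (J x v) = J₀ (mfderiv I 𝓘(ℝ, E) (φ.extend I) x v)

/-- Pseudo-Riemannian metrics, of arbitrary signature. -/
structure IsPseudoRiemannian (g : BilinField I X) : Prop where
  smooth : IsSmoothBilinField I g
  symm : ∀ (x : X) (v w : TangentSpace I x), g x v w = g x w v
  nondegenerate : ∀ (x : X) (v : TangentSpace I x), (∀ w : TangentSpace I x, g x v w = 0) → v = 0

/-- The endomorphism field `J` is skew-symmetric with respect to `g`. -/
def IsSkewFor (J : EndField I X) (g : BilinField I X) : Prop :=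
  ∀ (x : X) (v w : TangentSpace I x), g x (J x v) w = -g x v (J x w)

/-- The two-form `σ` is closed: `dσ (U, V, W) = 0` for all smooth vector fields, with `dσ` given
by the invariant formula for the exterior derivative. -/
def IsClosedTwoForm (σ : BilinField I X) : Prop :=
  ∀ U V W : Π x : X, TangentSpace I x,
    IsSmoothVectorField I U → IsSmoothVectorField I V → IsSmoothVectorField I W → ∀ x : X,
      mvfderiv I (fun y ↦ σ y (V y) (W y)) x (U x)
        - mvfderiv I (fun y ↦ σ y (U y) (W y)) x (V x)
        + mvfderiv I (fun y ↦ σ y (U y) (V y)) x (W x)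
        - σ x (VectorField.mlieBracket I U V x) (W x)
        + σ x (VectorField.mlieBracket I U W x) (V x)
        - σ x (VectorField.mlieBracket I V W x) (U x) = 0

/-- Para-Kähler structures `(J, g)`. -/
structure IsParaKahler (J : EndField I X) (g : BilinField I X) : Prop where
  paraComplex : IsParaComplex I J
  metric : IsPseudoRiemannian I g
  skew : IsSkewFor I J g
  closed : IsClosedTwoForm I (fundForm I J g)

/-- Para-hypercomplex structures `(J₁, J₂, J₃)`: three pairwise anticommuting endomorphism fields
with `J₃ = J₁ J₂`, two of which are para-complex structures and one a complex structure. -/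
structure IsParaHypercomplex (J₁ J₂ J₃ : EndField I X) : Prop where
  eq_comp : ∀ (x : X) (v : TangentSpace I x), J₃ x v = J₁ x (J₂ x v)
  anticomm₁₂ : ∀ (x : X) (v : TangentSpace I x), J₁ x (J₂ x v) = -J₂ x (J₁ x v)
  anticomm₁₃ : ∀ (x : X) (v : TangentSpace I x), J₁ x (J₃ x v) = -J₃ x (J₁ x v)
  anticomm₂₃ : ∀ (x : X) (v : TangentSpace I x), J₂ x (J₃ x v) = -J₃ x (J₂ x v)
  types : (IsParaComplex I J₁ ∧ IsParaComplex I J₂ ∧ IsComplexStructure I J₃) ∨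
    (IsParaComplex I J₁ ∧ IsComplexStructure I J₂ ∧ IsParaComplex I J₃) ∨
    (IsComplexStructure I J₁ ∧ IsParaComplex I J₂ ∧ IsParaComplex I J₃)

/-- Para-hyper-Hermitian structures. -/
structure IsParaHyperHermitian (J₁ J₂ J₃ : EndField I X) (g : BilinField I X) : Prop where
  hypercomplex : IsParaHypercomplex I J₁ J₂ J₃
  metric : IsPseudoRiemannian I g
  skew₁ : IsSkewFor I J₁ g
  skew₂ : IsSkewFor I J₂ g
  skew₃ : IsSkewFor I J₃ g

/-- Para-hyper-Kähler structures: the three fundamental two-forms are closed. -/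
structure IsParaHyperKahler (J₁ J₂ J₃ : EndField I X) (g : BilinField I X) : Prop
    extends IsParaHyperHermitian I J₁ J₂ J₃ g where
  closed₁ : IsClosedTwoForm I (fundForm I J₁ g)
  closed₂ : IsClosedTwoForm I (fundForm I J₂ g)
  closed₃ : IsClosedTwoForm I (fundForm I J₃ g)

variable {I}

/-- A linear connection is flat: `∇_U ∇_V W - ∇_V ∇_U W - ∇_{[U, V]} W = 0` for all smooth vector
fields. (`cov W x (U x)` is `(∇_U W) x`.) -/
def IsFlatConnection (cov : CovariantDerivative I E (TangentSpace I : X → Type _)) : Prop :=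
  ∀ U V W : Π x : X, TangentSpace I x,
    IsSmoothVectorField I U → IsSmoothVectorField I V → IsSmoothVectorField I W → ∀ x : X,
      cov (fun y ↦ cov W y (V y)) x (U x) - cov (fun y ↦ cov W y (U y)) x (V x)
        - cov W x (VectorField.mlieBracket I U V x) = 0

/-- The field of bilinear forms `σ` is parallel: `∇σ = 0`. -/
def IsParallelForm (cov : CovariantDerivative I E (TangentSpace I : X → Type _))
    (σ : BilinField I X) : Prop :=
  ∀ U V W : Π x : X, TangentSpace I x,
    IsSmoothVectorField I U → IsSmoothVectorField I V → IsSmoothVectorField I W → ∀ x : X,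
      mvfderiv I (fun y ↦ σ y (V y) (W y)) x (U x)
        - σ x (cov V x (U x)) (W x) - σ x (V x) (cov W x (U x)) = 0

/-- The tensor field `∇J` is symmetric: `(∇_U J) V = (∇_V J) U`, where
`(∇_U J) V = ∇_U (J V) - J (∇_U V)`. -/
def HasSymmetricDeriv (cov : CovariantDerivative I E (TangentSpace I : X → Type _))
    (J : EndField I X) : Prop :=
  ∀ U V : Π x : X, TangentSpace I x, IsSmoothVectorField I U → IsSmoothVectorField I V →
    ∀ x : X,
      cov (fun y ↦ J y (V y)) x (U x) - J x (cov V x (U x)) =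
        cov (fun y ↦ J y (U y)) x (V x) - J x (cov U x (V x))

/-- (Affine) special para-Kähler structures `(J, g, ∇)`. -/
structure IsSpecialParaKahler [FiniteDimensional ℝ E] (J : EndField I X) (g : BilinField I X)
    (cov : CovariantDerivative I E (TangentSpace I : X → Type _)) : Prop where
  paraKahler : IsParaKahler I J g
  smooth_cov : CovariantDerivative.ContMDiffCovariantDerivative cov ∞
  torsionFree : cov.torsion = 0
  flat : IsFlatConnection cov
  symplectic : IsParallelForm cov (fundForm I J g)
  symmetric : HasSymmetricDeriv cov J

end Structures

section Cotangent

variable {E : Type*} [NormedAddCommGroup E] [NormedSpace ℝ E]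
  {H : Type*} [TopologicalSpace H] (I : ModelWithCorners ℝ E H)
  (M : Type*) [TopologicalSpace M] [ChartedSpace H M]

/-- The total space of the cotangent bundle, with the topology and charts of a vector bundle. -/
abbrev CotangentBundle : Type _ :=
  TotalSpace (E →L[ℝ] ℝ) (fun p : M ↦ TangentSpace I p →L[ℝ] ℝ)

/-- The model with corners of the cotangent bundle as a manifold. -/
abbrev cotModel : ModelWithCorners ℝ (E × (E →L[ℝ] ℝ)) (ModelProd H (E →L[ℝ] ℝ)) :=
  I.prod 𝓘(ℝ, E →L[ℝ] ℝ)

variable {I M}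

instance instFiniteDimensionalTangentSpace [FiniteDimensional ℝ E] (p : M) :
    FiniteDimensional ℝ (TangentSpace I p) :=
  inferInstanceAs (FiniteDimensional ℝ E)

instance instT2SpaceTangentSpace (p : M) : T2Space (TangentSpace I p) :=
  inferInstanceAs (T2Space E)

variable [IsManifold I ∞ M]

/-- The fibrewise linear function `ξ ↦ ξ (Y (π ξ))` on the cotangent bundle given by a vector
field `Y` on the base. -/
def cotEval (Y : Π p : M, TangentSpace I p) (ξ : CotangentBundle I M) : ℝ :=
  ξ.snd (Y ξ.proj)

/-- The differential `dπ` of the projection of the cotangent bundle. -/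
def cotProjDeriv (ξ : CotangentBundle I M) :
    TangentSpace (cotModel I) ξ →L[ℝ] TangentSpace I ξ.proj :=
  mfderiv (cotModel I) I (TotalSpace.proj : CotangentBundle I M → M) ξ

theorem mdiff_cotEval {Y : Π p : M, TangentSpace I p} {ξ : CotangentBundle I M}
    (hY : MDifferentiableAt I I.tangent (fun p ↦ (⟨p, Y p⟩ : TangentBundle I M)) ξ.proj) :
    MDifferentiableAt (cotModel I) 𝓘(ℝ, ℝ) (cotEval Y) ξ := by
  have h1 : MDifferentiableAt (cotModel I) (I.prod 𝓘(ℝ, E →L[ℝ] ℝ))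
      (fun η : CotangentBundle I M ↦ TotalSpace.mk' (E →L[ℝ] ℝ)
        (E := fun p : M ↦ TangentSpace I p →L[ℝ] Bundle.Trivial M ℝ p) η.proj η.snd) ξ :=
    mdifferentiableAt_id
  have hp : MDifferentiableAt (cotModel I) I (TotalSpace.proj : CotangentBundle I M → M) ξ :=
    mdifferentiableAt_proj _
  have h2 : MDifferentiableAt (cotModel I) (I.prod 𝓘(ℝ, E))
      (fun η : CotangentBundle I M ↦ TotalSpace.mk' E
        (E := fun p : M ↦ TangentSpace I p) η.proj (Y η.proj)) ξ :=
    MDifferentiableAt.comp ξ hY hp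
  have h3 := MDifferentiableAt.clm_bundle_apply (F₁ := E) (F₂ := ℝ)
    (E₁ := fun p : M ↦ TangentSpace I p) (E₂ := Bundle.Trivial M ℝ)
    (b := fun η : CotangentBundle I M ↦ η.proj) (ϕ := fun η ↦ η.snd)
    (v := fun η ↦ Y η.proj) h1 h2
  rw [mdifferentiableAt_totalSpace] at h3
  exact h3.2

/-- The expression `d(cotEval Y)_ξ w - ξ (∇_{dπ w} Y)`; it depends on `Y` only through its value at
the base point of `ξ`. -/
def connectorAux (cov : CovariantDerivative I E (TangentSpace I : M → Type _))
    (ξ : CotangentBundle I M) (w : TangentSpace (cotModel I) ξ) (Y : Π p : M, TangentSpace I p) :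
    ℝ :=
  mvfderiv (cotModel I) (cotEval Y) ξ w - ξ.snd (cov Y ξ.proj (cotProjDeriv ξ w))

theorem tensorialAt_connectorAux (cov : CovariantDerivative I E (TangentSpace I : M → Type _))
    (ξ : CotangentBundle I M) (w : TangentSpace (cotModel I) ξ) :
    TensorialAt I E (connectorAux cov ξ w) ξ.proj where
  smul {f Y} hf hY := by
    have hp : MDifferentiableAt (cotModel I) I (TotalSpace.proj : CotangentBundle I M → M) ξ :=
      mdifferentiableAt_proj _
    have e : cotEval (f • Y) = (f ∘ TotalSpace.proj) * cotEval Y := by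
      funext η
      simp [cotEval]
    have hfp := MDifferentiableAt.comp ξ hf hp
    have hc : mfderiv (cotModel I) 𝓘(ℝ, ℝ) (f ∘ (TotalSpace.proj : CotangentBundle I M → M)) ξ
        = _ := mfderiv_comp ξ hf hp
    simp only [connectorAux, e, mvfderiv_mul hfp (mdiff_cotEval hY),
      cov.isCovariantDerivativeOn.leibniz hY hf]
    simp [mvfderiv, hc, cotEval, cotProjDeriv]
    ring
  add {Y Y'} hY hY' := by
    have e : cotEval (Y + Y') = cotEval Y + cotEval Y' := by
      funext η
      simp [cotEval]
    simp only [connectorAux, e, mvfderiv_add (mdiff_cotEval hY) (mdiff_cotEval hY'),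
      cov.isCovariantDerivativeOn.add hY hY']
    simp
    ring

theorem connectorAux_add (cov : CovariantDerivative I E (TangentSpace I : M → Type _))
    (ξ : CotangentBundle I M) (w w' : TangentSpace (cotModel I) ξ)
    (Y : Π p : M, TangentSpace I p) :
    connectorAux cov ξ (w + w') Y = connectorAux cov ξ w Y + connectorAux cov ξ w' Y := by
  have h1 := (mvfderiv (cotModel I) (cotEval Y) ξ).map_add w w'
  have h2 := (cotProjDeriv ξ).map_add w w'
  have h3 := (cov Y ξ.proj).map_add (cotProjDeriv ξ w) (cotProjDeriv ξ w')
  have h4 := ξ.snd.map_add (cov Y ξ.proj (cotProjDeriv ξ w)) (cov Y ξ.proj (cotProjDeriv ξ w'))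
  rw [connectorAux, connectorAux, connectorAux, h1, h2, h3, h4]
  ring

theorem connectorAux_smul (cov : CovariantDerivative I E (TangentSpace I : M → Type _))
    (ξ : CotangentBundle I M) (c : ℝ) (w : TangentSpace (cotModel I) ξ)
    (Y : Π p : M, TangentSpace I p) :
    connectorAux cov ξ (c • w) Y = c * connectorAux cov ξ w Y := by
  have h1 := (mvfderiv (cotModel I) (cotEval Y) ξ).map_smul c w
  have h2 := (cotProjDeriv ξ).map_smul c w
  have h3 := (cov Y ξ.proj).map_smul c (cotProjDeriv ξ w)
  have h4 := ξ.snd.map_smul c (cov Y ξ.proj (cotProjDeriv ξ w))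
  rw [connectorAux, connectorAux, h1, h2, h3, h4, smul_eq_mul, smul_eq_mul]
  ring

variable [FiniteDimensional ℝ E]

/-- The vertical projection `T_ξ T*M → T*_pM` of the linear connection: it sends `w` to the covector
`Y ↦ d(cotEval Y)_ξ w - ξ (∇_{dπ w} Y)`. Its kernel is the horizontal space; on a vector
`w = dα (v)` tangent to a one-form `α` with `α p = ξ` it is `∇_v α`, and on vertical vectors it is
the canonical identification of `ker dπ` with `T*_pM`. -/
def connector (cov : CovariantDerivative I E (TangentSpace I : M → Type _))
    (ξ : CotangentBundle I M) :
    TangentSpace (cotModel I) ξ →ₗ[ℝ] (TangentSpace I ξ.proj →L[ℝ] ℝ) where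
  toFun w := TensorialAt.mkHom (connectorAux cov ξ w) ξ.proj (tensorialAt_connectorAux cov ξ w)
  map_add' w w' := by
    ext v
    exact connectorAux_add cov ξ w w' _
  map_smul' c w := by
    ext v
    exact connectorAux_smul cov ξ c w _

theorem connector_apply (cov : CovariantDerivative I E (TangentSpace I : M → Type _))
    {ξ : CotangentBundle I M} {Y : Π p : M, TangentSpace I p}
    (hY : MDifferentiableAt I I.tangent (fun p ↦ (⟨p, Y p⟩ : TangentBundle I M)) ξ.proj)
    (w : TangentSpace (cotModel I) ξ) :
    connector cov ξ w (Y ξ.proj) =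
      mvfderiv (cotModel I) (cotEval Y) ξ w - ξ.snd (cov Y ξ.proj (cotProjDeriv ξ w)) :=
  TensorialAt.mkHom_apply (tensorialAt_connectorAux cov ξ w) hY

theorem eq_zero_of_connector (cov : CovariantDerivative I E (TangentSpace I : M → Type _))
    {ξ : CotangentBundle I M} {w : TangentSpace (cotModel I) ξ}
    (hπ : cotProjDeriv ξ w = 0) (hK : connector cov ξ w = 0) : w = 0 := by
  have hev (y : TangentSpace I ξ.proj) :
      mfderiv (cotModel I) 𝓘(ℝ, ℝ) (cotEval (FiberBundle.extend E y)) ξ w = 0 := by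
    have := connector_apply cov (ξ := ξ) (Y := FiberBundle.extend E y)
      (FiberBundle.mdifferentiableAt_extend ..) w
    rw [hK, hπ] at this
    simpa [mvfderiv] using this.symm
  have hp : MDifferentiableAt (cotModel I) I (TotalSpace.proj : CotangentBundle I M → M) ξ :=
    mdifferentiableAt_proj _
  have hφ : MDifferentiableAt (cotModel I) 𝓘(ℝ, E × (E →L[ℝ] ℝ)) (extChartAt (cotModel I) ξ) ξ :=
    mdifferentiableAt_extChartAt (mem_chart_source _ ξ)
  have hinv : (mfderiv (cotModel I) 𝓘(ℝ, E × (E →L[ℝ] ℝ))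
      (extChartAt (cotModel I) ξ) ξ).IsInvertible :=
    isInvertible_mfderiv_extChartAt (mem_extChartAt_source ξ)
  apply hinv.injective
  rw [ContinuousLinearMap.map_zero]
  have hnear : ∀ᶠ η in 𝓝 ξ,
      η.proj ∈ (trivializationAt E (TangentSpace I : M → Type _) ξ.proj).baseSet :=
    hp.continuousAt.eventually
      ((trivializationAt E (TangentSpace I : M → Type _) ξ.proj).open_baseSet.mem_nhds
        (FiberBundle.mem_baseSet_trivializationAt' _))
  have hchart (η : CotangentBundle I M) : extChartAt (cotModel I) ξ η =
      (extChartAt I ξ.proj η.proj, ContinuousLinearMap.inCoordinates E (TangentSpace I : M → Type _)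
        ℝ (Bundle.Trivial M ℝ) ξ.proj η.proj ξ.proj η.proj η.snd) := by
    have := hom_chart (HB := H) (E₁ := (TangentSpace I : M → Type _)) (E₂ := Bundle.Trivial M ℝ)
      (F₁ := E) (F₂ := ℝ) (𝕜 := ℝ) ξ η
    change (cotModel I) (chartAt (ModelProd H (E →L[ℝ] ℝ)) ξ η) = _
    erw [this]
    rfl
  refine Prod.ext ?_ ?_
  · have h1 := mfderiv_comp (I'' := 𝓘(ℝ, E)) ξ
      (ContinuousLinearMap.mdifferentiableAt (ContinuousLinearMap.fst ℝ E (E →L[ℝ] ℝ))) hφ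
    have h2 := mfderiv_comp (I'' := 𝓘(ℝ, E)) ξ
      (mdifferentiableAt_extChartAt (I := I) (mem_chart_source _ ξ.proj)) hp
    have h3 : (ContinuousLinearMap.fst ℝ E (E →L[ℝ] ℝ)) ∘ (extChartAt (cotModel I) ξ) =
        (extChartAt I ξ.proj) ∘ (TotalSpace.proj : CotangentBundle I M → M) := by
      funext η
      exact congr($(hchart η).1)
    rw [h3, h2, ContinuousLinearMap.mfderiv_eq] at h1
    have h4 := congr($h1 w)
    refine h4.symm.trans ?_
    change (mfderiv I 𝓘(ℝ, E) (extChartAt I ξ.proj) ξ.proj) (cotProjDeriv ξ w) = 0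
    rw [hπ, ContinuousLinearMap.map_zero]
  · refine ContinuousLinearMap.ext fun y ↦ ?_
    let L : (E × (E →L[ℝ] ℝ)) →L[ℝ] ℝ :=
      (ContinuousLinearMap.apply ℝ ℝ y) ∘L (ContinuousLinearMap.snd ℝ E (E →L[ℝ] ℝ))
    let t := trivializationAt E (TangentSpace I : M → Type _) ξ.proj
    have hy : L ∘ (extChartAt (cotModel I) ξ) =ᶠ[𝓝 ξ]
        cotEval (FiberBundle.extend E (x := ξ.proj) (t.symm ξ.proj y)) := by
      filter_upwards [hnear] with η hη
      have h5 : L (extChartAt (cotModel I) ξ η) = (extChartAt (cotModel I) ξ η).2 y := rfl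
      have h6 : FiberBundle.extend E (x := ξ.proj) (t.symm ξ.proj y) η.proj =
          t.symm η.proj (t ⟨ξ.proj, t.symm ξ.proj y⟩).2 := rfl
      rw [Function.comp_apply, h5, hchart η, cotEval, h6,
        t.apply_mk_symm (FiberBundle.mem_baseSet_trivializationAt' _)]
      have h7 : Trivialization.continuousLinearMapAt ℝ
          (trivializationAt ℝ (Bundle.Trivial M ℝ) ξ.proj) η.proj = ContinuousLinearMap.id ℝ ℝ :=
        Trivial.continuousLinearMapAt_trivialization ℝ M ℝ η.proj
      rw [ContinuousLinearMap.inCoordinates, h7]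
      change η.snd (Trivialization.symmL ℝ t η.proj y) = η.snd (t.symm η.proj y)
      rw [Trivialization.symmL_apply t hη y]
    have h1 := mfderiv_comp (I'' := 𝓘(ℝ, ℝ)) ξ (ContinuousLinearMap.mdifferentiableAt L) hφ
    rw [hy.mfderiv_eq, ContinuousLinearMap.mfderiv_eq] at h1
    exact (congr($h1 w)).symm.trans (hev _)

/-- The identification `T_ξ T*M = H_ξ ⊕ ker dπ ≅ T_pM ⊕ T*_pM` given by a linear connection. -/
def splitting (cov : CovariantDerivative I E (TangentSpace I : M → Type _))
    (ξ : CotangentBundle I M) :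
    TangentSpace (cotModel I) ξ ≃ₗ[ℝ]
      TangentSpace I ξ.proj × (TangentSpace I ξ.proj →L[ℝ] ℝ) :=
  LinearEquiv.ofInjectiveOfFinrankEq
    ((cotProjDeriv ξ).toLinearMap.prod (connector cov ξ))
    (by
      rw [injective_iff_map_eq_zero]
      intro w hw
      exact eq_zero_of_connector cov (congrArg Prod.fst hw) (congrArg Prod.snd hw))
    rfl

/-- The endomorphism field on `T*M` given by endomorphisms `A ξ` of `T_pM ⊕ T*_pM`, `p = π ξ`. -/
def endOfSplitting (cov : CovariantDerivative I E (TangentSpace I : M → Type _))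
    (A : Π ξ : CotangentBundle I M,
      (TangentSpace I ξ.proj × (TangentSpace I ξ.proj →L[ℝ] ℝ)) →ₗ[ℝ]
        (TangentSpace I ξ.proj × (TangentSpace I ξ.proj →L[ℝ] ℝ))) :
    EndField (cotModel I) (CotangentBundle I M) := fun ξ ↦
  LinearMap.toContinuousLinearMap
    ((splitting cov ξ).symm.toLinearMap ∘ₗ A ξ ∘ₗ (splitting cov ξ).toLinearMap)

/-- `J^∇ (v, α) = (J v, α ∘ J)`. -/
def cotJNabla (cov : CovariantDerivative I E (TangentSpace I : M → Type _)) (J : EndField I M) :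
    EndField (cotModel I) (CotangentBundle I M) :=
  endOfSplitting cov fun ξ ↦
    { toFun := fun q ↦ (J ξ.proj q.1, q.2 ∘L J ξ.proj)
      map_add' := fun q r ↦ by ext <;> simp
      map_smul' := fun c q ↦ by ext <;> simp }

/-- `J^σ (v, α) = (σ⁻¹ α, σ v)`, for `σ` considered as the map `v ↦ σ (v, ·)`. -/
def cotJOmega (cov : CovariantDerivative I E (TangentSpace I : M → Type _)) (σ : BilinField I M) :
    EndField (cotModel I) (CotangentBundle I M) :=
  endOfSplitting cov fun ξ ↦
    { toFun := fun q ↦ ((σ ξ.proj).inverse q.2, σ ξ.proj q.1)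
      map_add' := fun q r ↦ by ext <;> simp
      map_smul' := fun c q ↦ by ext <;> simp }

/-- `g_N ((v, α), (v', α')) = g (v, v') + g⁻¹ (α, α')`, where `g⁻¹ (α, α') = α' (g⁻¹ α)` for `g`
considered as the map `v ↦ g (v, ·)`. -/
def cotMetric (cov : CovariantDerivative I E (TangentSpace I : M → Type _)) (g : BilinField I M) :
    BilinField (cotModel I) (CotangentBundle I M) := fun ξ ↦
  LinearMap.toContinuousLinearMap
    { toFun := fun w ↦ LinearMap.toContinuousLinearMap
        { toFun := fun w' ↦
            g ξ.proj (splitting cov ξ w).1 (splitting cov ξ w').1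
              + (splitting cov ξ w').2 ((g ξ.proj).inverse (splitting cov ξ w).2)
          map_add' := fun w' w'' ↦ by simp; ring
          map_smul' := fun c w' ↦ by simp; ring }
      map_add' := fun w w' ↦ by ext; simp; ring
      map_smul' := fun c w ↦ by ext; simp; ring }

end Cotangent

end

/-!
A flat torsion-free connection `∇` has affine coordinates `χ`, in which `ω` is constant, and since
`∇ J` is symmetric the form `dχ ∘ J` is closed, so `dχ ∘ J = dφ` for a second system of coordinates
`φ`. The momenta `p` of `χ` have the differential `w ↦ K w`, for `K` the projection to the vertical
part, expressed in the frame of `χ`. Hence `J₂` is constant in the coordinates `(χ, p)` of the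
cotangent bundle, `J₃` is constant in `(φ, p)`, and the fundamental forms have constant coefficients
in `(χ, p)` (those of `J₁` and `J₃`) or in `(φ, p)` (that of `J₂`), so they are closed.

For `J₁`, let `J₀` be the matrix of `J` in the coordinates `χ` at a point; then
`Ψ = (χ + J₀ ∘ φ) / 2` satisfies `dΨ ∘ J = J₀ ∘ dΨ`, and `J₁` is constant in the coordinates given
by `Ψ` and its momenta: the connection terms of the two sides agree because `∇ J` is symmetric.

Affine coordinates come from a Frobenius theorem for `dG = G * A` with values in a Banach algebra,
which is solved along the rays through the origin.
-/

noncomputable section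

section Frobenius

open Set Metric

variable {E : Type*} [NormedAddCommGroup E] [NormedSpace ℝ E]
  {F : Type*} [NormedAddCommGroup F] [NormedSpace ℝ F]
  {𝔸 : Type*} [NormedRing 𝔸] [NormedAlgebra ℝ 𝔸]

/-- Quantitative `C^{1,1}` maps: on `s` the map `A`, its derivative and the Lipschitz constant of
its derivative are bounded by `K`. -/
structure HasC11BoundOn (A : E → F) (s : Set E) (K : ℝ) : Prop where
  differentiableAt : ∀ x ∈ s, DifferentiableAt ℝ A x
  norm_le : ∀ x ∈ s, ‖A x‖ ≤ K
  norm_fderiv_le : ∀ x ∈ s, ‖fderiv ℝ A x‖ ≤ K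
  norm_fderiv_sub_le : ∀ x ∈ s, ∀ y ∈ s, ‖fderiv ℝ A x - fderiv ℝ A y‖ ≤ K * ‖x - y‖

namespace HasC11BoundOn

theorem norm_sub_sub_le {A : E → F} {s : Set E} {K : ℝ} (hA : HasC11BoundOn A s K)
    (hs : Convex ℝ s) {x y : E} (hx : x ∈ s) (hy : y ∈ s) :
    ‖A y - A x - fderiv ℝ A x (y - x)‖ ≤ K * ‖y - x‖ ^ 2 := by
  have hK : 0 ≤ K := (norm_nonneg _).trans (hA.norm_le x hx)
  have hseg := hs.segment_subset hx hy
  calc ‖A y - A x - fderiv ℝ A x (y - x)‖ ≤ K * ‖y - x‖ * ‖y - x‖ :=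
        (convex_segment x y).norm_image_sub_le_of_norm_hasFDerivWithin_le'
          (fun z hz ↦ (hA.differentiableAt z (hseg hz)).hasFDerivAt.hasFDerivWithinAt)
          (fun z hz ↦ (hA.norm_fderiv_sub_le z (hseg hz) x hx).trans (by
            gcongr
            exact norm_sub_le_of_mem_segment hz))
          (left_mem_segment ℝ x y) (right_mem_segment ℝ x y)
    _ = K * ‖y - x‖ ^ 2 := by ring

theorem mono {A : E → F} {s t : Set E} {K : ℝ} (hA : HasC11BoundOn A s K) (hts : t ⊆ s) :
    HasC11BoundOn A t K :=
  ⟨fun x hx ↦ hA.differentiableAt x (hts hx), fun x hx ↦ hA.norm_le x (hts hx),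
    fun x hx ↦ hA.norm_fderiv_le x (hts hx),
    fun x hx y hy ↦ hA.norm_fderiv_sub_le x (hts hx) y (hts hy)⟩

end HasC11BoundOn

theorem exists_hasC11BoundOn_ball {A : E → F} {z : E} (hA : ContDiffAt ℝ 2 A z) :
    ∃ K > 0, ∃ r > 0, HasC11BoundOn A (ball z r) K := by
  have hA' : ContDiffAt ℝ 1 (fderiv ℝ A) z := hA.fderiv_right (by norm_num)
  obtain ⟨L, s, hs, hlip⟩ := hA'.exists_lipschitzOnWith
  have hdiff : ∀ᶠ x in 𝓝 z, DifferentiableAt ℝ A x :=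
    (hA.eventually (by simp)).mono fun x hx ↦ hx.differentiableAt (by simp)
  have hbound : ∀ᶠ x in 𝓝 z, ‖A x‖ < ‖A z‖ + 1 :=
    hA.continuousAt.norm.eventually_lt_const (lt_add_one _)
  have hbound' : ∀ᶠ x in 𝓝 z, ‖fderiv ℝ A x‖ < ‖fderiv ℝ A z‖ + 1 :=
    hA'.continuousAt.norm.eventually_lt_const (lt_add_one _)
  obtain ⟨r, hr, hball⟩ := eventually_nhds_iff_ball.1
    (hdiff.and (hbound.and (hbound'.and (Filter.eventually_mem_set.2 hs))))
  have hA₀ : 0 ≤ ‖A z‖ := norm_nonneg _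
  have hA₁ : 0 ≤ ‖fderiv ℝ A z‖ := norm_nonneg _
  refine ⟨‖A z‖ + ‖fderiv ℝ A z‖ + 1 + L, by positivity, r, hr, fun x hx ↦ (hball x hx).1,
    fun x hx ↦ ?_, fun x hx ↦ ?_, fun x hx y hy ↦ ?_⟩
  · linarith [(hball x hx).2.1]
  · linarith [(hball x hx).2.2.1]
  · have h₃ := hlip.norm_sub_le (hball x hx).2.2.2 (hball y hy).2.2.2
    refine h₃.trans ?_
    gcongr
    linarith

/-- The propagator of a time-dependent coefficient `a` in a normed algebra: the solution of the
linear equation `γ' = γ * a` on `[0, 1]` with `γ 0 = 1`. -/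
structure IsPropagator (a γ : ℝ → 𝔸) : Prop where
  map_zero : γ 0 = 1
  hasDerivWithinAt : ∀ t ∈ Icc (0 : ℝ) 1, HasDerivWithinAt γ (γ t * a t) (Icc 0 1) t

theorem exists_isPropagator [CompleteSpace 𝔸] {a : ℝ → 𝔸} (ha : ContinuousOn a (Icc 0 1))
    {k : ℝ} (hk : ∀ t ∈ Icc (0 : ℝ) 1, ‖a t‖ ≤ k) (hk1 : (‖(1 : 𝔸)‖ + 1) * k ≤ 1) :
    ∃ γ : ℝ → 𝔸, IsPropagator a γ := by
  have hk0 : 0 ≤ k := (norm_nonneg _).trans (hk 0 (by simp))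
  have hball : ∀ x ∈ closedBall (1 : 𝔸) 1, ‖x‖ ≤ ‖(1 : 𝔸)‖ + 1 := fun x hx ↦ by
    have h := norm_le_norm_add_norm_sub' x 1
    rw [mem_closedBall, dist_eq_norm] at hx
    linarith
  have hpl : IsPicardLindelof (fun t x ↦ x * a t) (tmin := 0) (tmax := 1) ⟨0, by simp⟩ (1 : 𝔸)
      1 0 1 ⟨k, hk0⟩ := by
    refine ⟨fun t ht ↦ ?_, fun _ _ ↦ continuousOn_const.mul ha, fun t ht x hx ↦ ?_, by simp⟩
    · refine (LipschitzWith.of_dist_le_mul fun x y ↦ ?_).lipschitzOnWith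
      rw [dist_eq_norm, dist_eq_norm, ← sub_mul, mul_comm]
      exact norm_mul_le_of_le le_rfl (hk t ht)
    · calc ‖x * a t‖ ≤ ‖x‖ * ‖a t‖ := norm_mul_le _ _
        _ ≤ (‖(1 : 𝔸)‖ + 1) * k := by
          gcongr
          exacts [hball x (by simpa using hx), hk t ht]
        _ ≤ _ := by simpa using hk1
  obtain ⟨γ, hγ0, hγ⟩ := hpl.exists_eq_forall_mem_Icc_hasDerivWithinAt₀
  exact ⟨γ, hγ0, hγ⟩

theorem gronwallBound_zero_left (K ε x : ℝ) :
    gronwallBound 0 K ε x = gronwallBound 0 K 1 x * ε := by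
  unfold gronwallBound
  split_ifs <;> ring

namespace IsPropagator

variable {a γ : ℝ → 𝔸} {k : ℝ}

theorem norm_sub_le (hγ : IsPropagator a γ) (hk : ∀ t ∈ Icc (0 : ℝ) 1, ‖a t‖ ≤ k)
    {S S' : ℝ → 𝔸} {ε : ℝ} (hS : ∀ t ∈ Icc (0 : ℝ) 1, HasDerivWithinAt S (S' t) (Icc 0 1) t)
    (hε : ∀ t ∈ Icc (0 : ℝ) 1, ‖S t * a t - S' t‖ ≤ ε) {t : ℝ} (ht : t ∈ Icc (0 : ℝ) 1) :
    ‖γ t - S t‖ ≤ gronwallBound ‖1 - S 0‖ k ε t := by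
  have hk0 : 0 ≤ k := (norm_nonneg _).trans (hk t ht)
  have hright {f f' : ℝ → 𝔸}
      (hf : ∀ t ∈ Icc (0 : ℝ) 1, HasDerivWithinAt f (f' t) (Icc 0 1) t) :
      ∀ t ∈ Ico (0 : ℝ) 1, HasDerivWithinAt f (f' t) (Ici t) t := fun t ht ↦
    (hf t (Ico_subset_Icc_self ht)).mono_of_mem_nhdsWithin (Icc_mem_nhdsGE_of_mem ht)
  have h := dist_le_of_approx_trajectories_ODE_of_mem (v := fun t x ↦ x * a t)
    (s := fun _ ↦ univ) (K := ⟨k, hk0⟩) (εf := 0) (εg := ε) (δ := ‖1 - S 0‖)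
    (fun t ht ↦ (LipschitzWith.of_dist_le_mul fun x y ↦ by
      rw [dist_eq_norm, dist_eq_norm, ← sub_mul, mul_comm]
      exact norm_mul_le_of_le le_rfl (hk t (Ico_subset_Icc_self ht))).lipschitzOnWith)
    (fun t ht ↦ (hγ.hasDerivWithinAt t ht).continuousWithinAt) (hright hγ.hasDerivWithinAt)
    (fun t _ ↦ (dist_self _).le) (fun _ _ ↦ mem_univ _)
    (fun t ht ↦ (hS t ht).continuousWithinAt) (hright hS)
    (fun t ht ↦ by
      rw [dist_comm, dist_eq_norm]
      exact hε t (Ico_subset_Icc_self ht))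
    (fun _ _ ↦ mem_univ _) (by rw [hγ.map_zero, dist_eq_norm]) t ht
  rwa [dist_eq_norm, zero_add, sub_zero] at h

theorem norm_le (hγ : IsPropagator a γ) (hk : ∀ t ∈ Icc (0 : ℝ) 1, ‖a t‖ ≤ k) {t : ℝ}
    (ht : t ∈ Icc (0 : ℝ) 1) : ‖γ t‖ ≤ ‖(1 : 𝔸)‖ * Real.exp k := by
  have hk0 : 0 ≤ k := (norm_nonneg _).trans (hk t ht)
  have h := hγ.norm_sub_le hk (S := 0) (S' := 0) (ε := 0)
    (fun t _ ↦ hasDerivWithinAt_const t _ 0) (fun t _ ↦ by simp) ht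
  rw [gronwallBound_ε0] at h
  calc ‖γ t‖ ≤ ‖(1 : 𝔸)‖ * Real.exp (k * t) := by simpa using h
    _ ≤ ‖(1 : 𝔸)‖ * Real.exp k := by
      gcongr
      exact mul_le_of_le_one_right hk0 ht.2

theorem eq_one (hγ : IsPropagator 0 γ) {t : ℝ} (ht : t ∈ Icc (0 : ℝ) 1) : γ t = 1 := by
  have h := hγ.norm_sub_le (k := 0) (fun t _ ↦ by simp) (S := 1) (S' := 0) (ε := 0)
    (fun t _ ↦ hasDerivWithinAt_const t _ 1) (fun t _ ↦ by simp) ht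
  rw [Pi.one_apply, Pi.one_apply, sub_self, norm_zero, gronwallBound_ε0_δ0] at h
  exact sub_eq_zero.1 (norm_le_zero_iff.1 h)

end IsPropagator

-- Varying the ray through `x` by `h` varies its propagator `g` by `g * (t • a h)` to first order:
-- flatness cancels the first order terms of the resulting defect.
theorem ray_defect_eq {a : E →L[ℝ] 𝔸} {a' : E →L[ℝ] E →L[ℝ] 𝔸} {x h : E}
    (hflat : a' h x + a h * a x = a' x h + a x * a h) (g b : 𝔸) (t : ℝ) :
    g * (1 + t • a h) * b - (g * a x * (1 + t • a h) + g * (t • a' x h + a h)) =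
      g * (t • (a h * a h) + t • t • (a h * a' h x)
        + (1 + t • a h) * (b - (a x + a h + t • a' h x))) := by
  have hcomm : t • (a' x h + a x * a h) = t • (a' h x + a h * a x) := by rw [hflat]
  calc g * (1 + t • a h) * b - (g * a x * (1 + t • a h) + g * (t • a' x h + a h))
      = g * ((1 + t • a h) * b - a x - a h - t • (a' x h + a x * a h)) := by
        simp only [mul_add, mul_sub, add_mul, mul_one, one_mul, smul_mul_assoc, mul_smul_comm,
          smul_add, mul_assoc]
        abel
    _ = _ := by
        rw [hcomm]
        simp only [mul_add, mul_sub, add_mul, one_mul, smul_mul_assoc, mul_smul_comm, smul_add]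
        abel

theorem norm_ray_defect_le {a : E →L[ℝ] 𝔸} {a' : E →L[ℝ] E →L[ℝ] 𝔸} {x h : E} {R : 𝔸}
    {K L ρ t : ℝ} (ht : t ∈ Icc (0 : ℝ) 1) (ha : ‖a‖ ≤ K) (ha' : ‖a'‖ ≤ K) (hx : ‖x‖ ≤ ρ)
    (hh : ‖h‖ ≤ 2 * ρ) (hR : ‖R‖ ≤ L * ‖h‖ ^ 2) :
    ‖t • (a h * a h) + t • t • (a h * a' h x) + (1 + t • a h) * R‖ ≤
      (K ^ 2 + K ^ 2 * ρ + (‖(1 : 𝔸)‖ + K * (2 * ρ)) * L) * ‖h‖ ^ 2 := by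
  have ht1 : ‖t‖ ≤ 1 := by rw [Real.norm_of_nonneg ht.1]; exact ht.2
  have hah : ‖a h‖ ≤ K * ‖h‖ := a.le_of_opNorm_le ha h
  have ha'h : ‖a' h x‖ ≤ K * ‖h‖ * ρ :=
    (a' h).le_of_opNorm_le_of_le (a'.le_of_opNorm_le ha' h) hx
  have hah' : ‖a h‖ ≤ K * (2 * ρ) := a.le_of_opNorm_le_of_le ha hh
  have hK : 0 ≤ K := (norm_nonneg _).trans ha
  have hρ : 0 ≤ ρ := (norm_nonneg _).trans hx
  have hsmul (y : 𝔸) : ‖t • y‖ ≤ ‖y‖ := by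
    rw [norm_smul]
    exact mul_le_of_le_one_left (norm_nonneg _) ht1
  calc ‖t • (a h * a h) + t • t • (a h * a' h x) + (1 + t • a h) * R‖
      ≤ ‖a h‖ * ‖a h‖ + ‖a h‖ * ‖a' h x‖ + (‖(1 : 𝔸)‖ + ‖a h‖) * ‖R‖ := by
        refine norm_add₃_le.trans (add_le_add_three ?_ ?_ ?_)
        · exact (hsmul _).trans (norm_mul_le _ _)
        · exact (hsmul _).trans ((hsmul _).trans (norm_mul_le _ _))
        · exact norm_mul_le_of_le (norm_add_le_of_le le_rfl (hsmul _)) le_rfl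
    _ ≤ K * ‖h‖ * (K * ‖h‖) + K * ‖h‖ * (K * ‖h‖ * ρ)
          + (‖(1 : 𝔸)‖ + K * (2 * ρ)) * (L * ‖h‖ ^ 2) := by
        gcongr
    _ = _ := by ring

theorem hasDerivWithinAt_ray {A : E → E →L[ℝ] 𝔸} {x : E} {γ : ℝ → 𝔸}
    (hγ : IsPropagator (fun t ↦ A (t • x) x) γ) {t : ℝ} (ht : t ∈ Icc (0 : ℝ) 1)
    (hA : DifferentiableAt ℝ A (t • x)) (h : E) :
    HasDerivWithinAt (fun t ↦ γ t * (1 + t • A (t • x) h))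
      (γ t * A (t • x) x * (1 + t • A (t • x) h)
        + γ t * (t • fderiv ℝ A (t • x) x h + A (t • x) h)) (Icc 0 1) t := by
  have hray : HasDerivAt (fun s : ℝ ↦ s • x) x t := by
    simpa only [id_eq, one_smul] using (hasDerivAt_id t).smul_const x
  have hAh : HasDerivAt (fun s : ℝ ↦ A (s • x) h) (fderiv ℝ A (t • x) x h) t :=
    (ContinuousLinearMap.apply ℝ 𝔸 h).hasFDerivAt.comp_hasDerivAt t
      (hA.hasFDerivAt.comp_hasDerivAt t hray)
  refine ((hγ.hasDerivWithinAt t ht).mul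
    (((hasDerivAt_id t).smul hAh).const_add 1).hasDerivWithinAt).congr_deriv ?_
  simp only [Pi.smul_apply', id_eq, one_smul]

theorem smul_mem_ball_zero {x : E} {ρ t : ℝ} (hx : x ∈ ball (0 : E) ρ)
    (ht : t ∈ Icc (0 : ℝ) 1) : t • x ∈ ball (0 : E) ρ := by
  have hρ : 0 < ρ := pos_of_mem_ball hx
  simpa using (convex_ball (0 : E) ρ).starConvex (mem_ball_self hρ) |>.smul_mem hx ht.1 ht.2

theorem HasC11BoundOn.norm_ray_remainder_le {A : E → E →L[ℝ] 𝔸} {K ρ : ℝ}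
    (hA : HasC11BoundOn A (ball 0 ρ) K) {x y : E} (hx : x ∈ ball (0 : E) ρ)
    (hy : y ∈ ball (0 : E) ρ) {t : ℝ} (ht : t ∈ Icc (0 : ℝ) 1) :
    ‖A (t • y) y - (A (t • x) x + A (t • x) (y - x) + t • fderiv ℝ A (t • x) (y - x) x)‖ ≤
      (K * ρ + K) * ‖y - x‖ ^ 2 := by
  have hxt := smul_mem_ball_zero hx ht
  have hyt := smul_mem_ball_zero hy ht
  have hyρ : ‖y‖ ≤ ρ := (mem_ball_zero_iff.1 hy).le
  have hK : 0 ≤ K := (norm_nonneg _).trans (hA.norm_le x hx)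
  have ht1 : ‖t‖ ≤ 1 := by rw [Real.norm_of_nonneg ht.1]; exact ht.2
  have hsplit : A (t • y) y - (A (t • x) x + A (t • x) (y - x) + t • fderiv ℝ A (t • x) (y - x) x) =
      (A (t • y) - A (t • x) - fderiv ℝ A (t • x) (t • y - t • x)) y
        + t • fderiv ℝ A (t • x) (y - x) (y - x) := by
    simp only [map_smul, map_sub, sub_apply, smul_apply, smul_sub]
    abel
  have hth : ‖t • y - t • x‖ ≤ ‖y - x‖ := by
    rw [← smul_sub, norm_smul]
    exact mul_le_of_le_one_left (norm_nonneg _) ht1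
  have htaylor : ‖A (t • y) - A (t • x) - fderiv ℝ A (t • x) (t • y - t • x)‖ ≤ K * ‖y - x‖ ^ 2 :=
    (hA.norm_sub_sub_le (convex_ball 0 ρ) hxt hyt).trans (by gcongr)
  calc _ ≤ K * ‖y - x‖ ^ 2 * ρ + 1 * (K * ‖y - x‖ * ‖y - x‖) := by
        rw [hsplit]
        refine norm_add_le_of_le (ContinuousLinearMap.le_of_opNorm_le_of_le _ htaylor hyρ) ?_
        rw [norm_smul]
        gcongr
        exact ContinuousLinearMap.le_of_opNorm_le _
          (ContinuousLinearMap.le_of_opNorm_le _ (hA.norm_fderiv_le _ hxt) _) _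
    _ = (K * ρ + K) * ‖y - x‖ ^ 2 := by ring

theorem HasC11BoundOn.norm_apply_smul_le {A : E → E →L[ℝ] F} {K ρ : ℝ}
    (hA : HasC11BoundOn A (ball 0 ρ) K) {x : E} (hx : x ∈ ball (0 : E) ρ) {t : ℝ}
    (ht : t ∈ Icc (0 : ℝ) 1) : ‖A (t • x) x‖ ≤ K * ρ :=
  (A (t • x)).le_of_opNorm_le_of_le (hA.norm_le _ (smul_mem_ball_zero hx ht))
    (mem_ball_zero_iff.1 hx).le

theorem HasC11BoundOn.exists_norm_propagator_sub_le {A : E → E →L[ℝ] 𝔸} {K ρ : ℝ}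
    (hA : HasC11BoundOn A (ball 0 ρ) K)
    (hflat : ∀ x ∈ ball (0 : E) ρ, ∀ u v,
      fderiv ℝ A x u v + A x u * A x v = fderiv ℝ A x v u + A x v * A x u)
    {γ : E → ℝ → 𝔸} (hγ : ∀ x ∈ ball (0 : E) ρ, IsPropagator (fun t ↦ A (t • x) x) (γ x))
    {x : E} (hx : x ∈ ball (0 : E) ρ) :
    ∃ C, ∀ y ∈ ball (0 : E) ρ,
      ‖γ y 1 - γ x 1 - γ x 1 * A x (y - x)‖ ≤ C * ‖y - x‖ ^ 2 := by
  set D := K ^ 2 + K ^ 2 * ρ + (‖(1 : 𝔸)‖ + K * (2 * ρ)) * (K * ρ + K)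
  refine ⟨gronwallBound 0 (K * ρ) 1 1 * (‖(1 : 𝔸)‖ * Real.exp (K * ρ) * D), fun y hy ↦ ?_⟩
  have hxρ : ‖x‖ ≤ ρ := (mem_ball_zero_iff.1 hx).le
  have hyρ : ‖y‖ ≤ ρ := (mem_ball_zero_iff.1 hy).le
  have hyx : ‖y - x‖ ≤ 2 * ρ := (norm_sub_le _ _).trans (by linarith)
  have hdefect (t : ℝ) (ht : t ∈ Icc (0 : ℝ) 1) :
      ‖γ x t * (1 + t • A (t • x) (y - x)) * A (t • y) y
        - (γ x t * A (t • x) x * (1 + t • A (t • x) (y - x))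
          + γ x t * (t • fderiv ℝ A (t • x) x (y - x) + A (t • x) (y - x)))‖ ≤
        ‖(1 : 𝔸)‖ * Real.exp (K * ρ) * (D * ‖y - x‖ ^ 2) := by
    have hxt := smul_mem_ball_zero hx ht
    rw [ray_defect_eq (hflat _ hxt (y - x) x)]
    exact norm_mul_le_of_le ((hγ x hx).norm_le (fun s hs ↦ hA.norm_apply_smul_le hx hs) ht)
      (norm_ray_defect_le ht (hA.norm_le _ hxt) (hA.norm_fderiv_le _ hxt) hxρ hyx
        (hA.norm_ray_remainder_le hx hy ht))
  have h := (hγ y hy).norm_sub_le (fun t ht ↦ hA.norm_apply_smul_le hy ht)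
    (fun t ht ↦ hasDerivWithinAt_ray (hγ x hx) ht
      (hA.differentiableAt _ (smul_mem_ball_zero hx ht)) (y - x)) hdefect
    (right_mem_Icc.2 zero_le_one)
  simpa only [one_smul, zero_smul, add_zero, mul_one, mul_add, (hγ x hx).map_zero, sub_self,
    norm_zero, gronwallBound_zero_left _ (_ * _), ← sub_sub, ← mul_assoc] using h

theorem HasC11BoundOn.hasFDerivAt_propagator {A : E → E →L[ℝ] 𝔸} {K ρ : ℝ}
    (hA : HasC11BoundOn A (ball 0 ρ) K)
    (hflat : ∀ x ∈ ball (0 : E) ρ, ∀ u v,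
      fderiv ℝ A x u v + A x u * A x v = fderiv ℝ A x v u + A x v * A x u)
    {γ : E → ℝ → 𝔸} (hγ : ∀ x ∈ ball (0 : E) ρ, IsPropagator (fun t ↦ A (t • x) x) (γ x))
    {x : E} (hx : x ∈ ball (0 : E) ρ) :
    HasFDerivAt (fun y ↦ γ y 1) (ContinuousLinearMap.mul ℝ 𝔸 (γ x 1) ∘L A x) x := by
  obtain ⟨C, hC⟩ := hA.exists_norm_propagator_sub_le hflat hγ hx
  have hquad : (fun y ↦ γ y 1 - γ x 1 - γ x 1 * A x (y - x)) =O[𝓝 x] fun y ↦ ‖y - x‖ ^ 2 := by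
    refine Asymptotics.IsBigO.of_bound C ?_
    filter_upwards [isOpen_ball.mem_nhds hx] with y hy
    simpa only [norm_pow, norm_norm] using hC y hy
  rw [hasFDerivAt_iff_isLittleO]
  exact hquad.trans_isLittleO (Asymptotics.isLittleO_pow_sub_sub x one_lt_two)

theorem contDiffOn_of_hasFDerivAt_mul {A : E → E →L[ℝ] 𝔸} {G : E → 𝔸} {s : Set E} (hs : IsOpen s)
    (hA : ContDiffOn ℝ ∞ A s)
    (hG : ∀ x ∈ s, HasFDerivAt G (ContinuousLinearMap.mul ℝ 𝔸 (G x) ∘L A x) x) :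
    ContDiffOn ℝ ∞ G s := by
  have hn (n : ℕ) : ContDiffOn ℝ n G s := by
    induction n with
    | zero => exact contDiffOn_zero.2 fun x hx ↦ (hG x hx).continuousAt.continuousWithinAt
    | succ n ih =>
      rw [Nat.cast_add, Nat.cast_one, contDiffOn_succ_iff_fderiv_of_isOpen hs]
      refine ⟨fun x hx ↦ (hG x hx).differentiableAt.differentiableWithinAt, by simp, ?_⟩
      have hGA : ContDiffOn ℝ n (fun x ↦ ContinuousLinearMap.mul ℝ 𝔸 (G x) ∘L A x) s :=
        ((ContinuousLinearMap.mul ℝ 𝔸).contDiff.comp_contDiffOn ih).clm_comp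
          (hA.of_le (mod_cast le_top))
      exact hGA.congr fun x hx ↦ (hG x hx).fderiv
  exact contDiffOn_infty.2 hn

variable [CompleteSpace 𝔸]

theorem exists_parallel_of_flat_zero {A : E → E →L[ℝ] 𝔸} (hA : ContDiffAt ℝ 2 A 0)
    (hflat : ∀ᶠ x in 𝓝 (0 : E), ∀ u v,
      fderiv ℝ A x u v + A x u * A x v = fderiv ℝ A x v u + A x v * A x u) :
    ∃ G : E → 𝔸, G 0 = 1 ∧
      ∀ᶠ x in 𝓝 (0 : E), HasFDerivAt G (ContinuousLinearMap.mul ℝ 𝔸 (G x) ∘L A x) x := by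
  obtain ⟨K, hK, r, hr, hbound⟩ := exists_hasC11BoundOn_ball hA
  obtain ⟨s, hs, hflat⟩ := eventually_nhds_iff_ball.1 hflat
  obtain ⟨ρ, hρ, hρr, hρs, hρ1⟩ :
      ∃ ρ > 0, ρ ≤ r ∧ ρ ≤ s ∧ (‖(1 : 𝔸)‖ + 1) * (K * ρ) ≤ 1 := by
    refine ⟨min (min r s) (1 / ((‖(1 : 𝔸)‖ + 1) * K)), by positivity,
      (min_le_left _ _).trans (min_le_left _ _), (min_le_left _ _).trans (min_le_right _ _), ?_⟩
    rw [← mul_assoc, ← le_div_iff₀' (by positivity)]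
    exact min_le_right _ _
  have hbound := hbound.mono (ball_subset_ball hρr)
  have hsol (x : E) (hx : x ∈ ball (0 : E) ρ) :
      ∃ γ, IsPropagator (fun t ↦ A (t • x) x) γ := by
    refine exists_isPropagator (fun t ht ↦ ?_) (fun t ht ↦ hbound.norm_apply_smul_le hx ht) hρ1
    have hcont := (hbound.differentiableAt _ (smul_mem_ball_zero hx ht)).continuousAt
    exact ((hcont.comp (f := fun t : ℝ ↦ t • x) (by fun_prop)).clm_apply
      continuousAt_const).continuousWithinAt
  choose! γ hγ using hsol
  refine ⟨fun x ↦ γ x 1, ?_, ?_⟩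
  · have hγ0 := hγ 0 (mem_ball_self hρ)
    simp only [smul_zero, map_zero] at hγ0
    exact hγ0.eq_one (right_mem_Icc.2 zero_le_one)
  · filter_upwards [ball_mem_nhds 0 hρ] with x hx
    exact hbound.hasFDerivAt_propagator (fun x hx ↦ hflat x (ball_subset_ball hρs hx)) hγ hx

theorem exists_parallel_of_flat {A : E → E →L[ℝ] 𝔸} {z : E} (hA : ContDiffAt ℝ 2 A z)
    (hflat : ∀ᶠ x in 𝓝 z, ∀ u v,
      fderiv ℝ A x u v + A x u * A x v = fderiv ℝ A x v u + A x v * A x u) :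
    ∃ G : E → 𝔸, G z = 1 ∧
      ∀ᶠ x in 𝓝 z, HasFDerivAt G (ContinuousLinearMap.mul ℝ 𝔸 (G x) ∘L A x) x := by
  have htrans : Filter.Tendsto (z + ·) (𝓝 (0 : E)) (𝓝 z) := by
    simpa using (continuous_const_add z).tendsto 0
  have htrans' : Filter.Tendsto (· - z) (𝓝 z) (𝓝 (0 : E)) :=
    tendsto_sub_nhds_zero_iff.2 Filter.tendsto_id
  obtain ⟨G, hG0, hG⟩ := exists_parallel_of_flat_zero (A := fun x ↦ A (z + x))
    (ContDiffAt.comp 0 (by simpa using hA) (by fun_prop))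
    ((htrans.eventually hflat).mono fun x hx ↦ by simpa only [fderiv_comp_add_left] using hx)
  refine ⟨fun x ↦ G (x - z), by simpa using hG0, (htrans'.eventually hG).mono fun x hx ↦ ?_⟩
  rw [hasFDerivAt_comp_sub]
  simpa only [add_sub_cancel] using hx

theorem exists_primitive_of_closed [CompleteSpace F] {η : E → E →L[ℝ] F} {z : E} {ρ : ℝ}
    (hη : ContDiffOn ℝ ∞ η (ball z ρ))
    (hcl : ∀ x ∈ ball z ρ, ∀ u v, fderiv ℝ η x u v = fderiv ℝ η x v u) :
    ∃ f : E → F, ContDiffOn ℝ ∞ f (ball z ρ) ∧ ∀ x ∈ ball z ρ, HasFDerivAt f (η x) x := by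
  obtain ⟨f, hf⟩ := (convex_ball z ρ).exists_forall_hasFDerivAt_of_fderiv_symmetric isOpen_ball
    (hη.differentiableOn (by simp)) hcl
  refine ⟨f, ?_, hf⟩
  rw [contDiffOn_infty_iff_fderiv_of_isOpen isOpen_ball]
  exact ⟨fun x hx ↦ (hf x hx).differentiableAt.differentiableWithinAt,
    hη.congr fun x hx ↦ (hf x hx).fderiv⟩

-- A parallel frame `G` turns the covariant exterior derivative of `T` into the ordinary exterior
-- derivative of the one-form `G ∘ T`.
theorem exists_primitive_comp_of_parallel [CompleteSpace F] {Γ : E → E →L[ℝ] F →L[ℝ] F}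
    {G : E → F →L[ℝ] F} {T : E → E →L[ℝ] F} {z : E} {ρ : ℝ} (hGs : ContDiffOn ℝ ∞ G (ball z ρ))
    (hG : ∀ x ∈ ball z ρ, HasFDerivAt G (ContinuousLinearMap.mul ℝ (F →L[ℝ] F) (G x) ∘L Γ x) x)
    (hT : ContDiffOn ℝ ∞ T (ball z ρ))
    (hTsymm : ∀ x ∈ ball z ρ, ∀ u v,
      fderiv ℝ T x u v + Γ x u (T x v) = fderiv ℝ T x v u + Γ x v (T x u)) :
    ∃ f : E → F, ContDiffOn ℝ ∞ f (ball z ρ) ∧ ∀ x ∈ ball z ρ, HasFDerivAt f (G x ∘L T x) x := by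
  refine exists_primitive_of_closed (hGs.clm_comp hT) fun x hx u v ↦ ?_
  have hTd : HasFDerivAt T (fderiv ℝ T x) x :=
    ((hT.contDiffAt (isOpen_ball.mem_nhds hx)).differentiableAt (by simp)).hasFDerivAt
  have hGT (u v : E) : fderiv ℝ (fun x ↦ G x ∘L T x) x u v =
      G x (fderiv ℝ T x u v + Γ x u (T x v)) := by
    rw [((hG x hx).clm_comp hTd).fderiv, map_add]
    rfl
  rw [hGT, hGT, hTsymm x hx]

theorem exists_affine_coordinates [CompleteSpace E] {Γ : E → E →L[ℝ] E →L[ℝ] E}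
    {T : E → E →L[ℝ] E} {U : Set E} (hU : IsOpen U) {z : E} (hz : z ∈ U)
    (hΓ : ContDiffOn ℝ ∞ Γ U) (hT : ContDiffOn ℝ ∞ T U)
    (hsymm : ∀ x ∈ U, ∀ u v, Γ x u v = Γ x v u)
    (hflat : ∀ x ∈ U, ∀ u v w,
      fderiv ℝ Γ x u v w + Γ x u (Γ x v w) = fderiv ℝ Γ x v u w + Γ x v (Γ x u w))
    (hTsymm : ∀ x ∈ U, ∀ u v,
      fderiv ℝ T x u v + Γ x u (T x v) = fderiv ℝ T x v u + Γ x v (T x u)) :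
    ∃ ρ > 0, ball z ρ ⊆ U ∧ ∃ (G : E → E →L[ℝ] E) (χ φ : E → E),
      ContDiffOn ℝ ∞ G (ball z ρ) ∧ ContDiffOn ℝ ∞ χ (ball z ρ) ∧ ContDiffOn ℝ ∞ φ (ball z ρ) ∧
      (∀ x ∈ ball z ρ, IsUnit (G x)) ∧
      (∀ x ∈ ball z ρ, ∀ u, fderiv ℝ G x u = G x ∘L Γ x u) ∧
      (∀ x ∈ ball z ρ, HasFDerivAt χ (G x) x) ∧
      ∀ x ∈ ball z ρ, HasFDerivAt φ (G x ∘L T x) x := by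
  have hUz : ∀ᶠ x in 𝓝 z, x ∈ U := hU.mem_nhds hz
  obtain ⟨G, hG0, hG⟩ := exists_parallel_of_flat (𝔸 := E →L[ℝ] E)
    ((hΓ.contDiffAt hUz).of_le (by norm_cast))
    (hUz.mono fun x hx u v ↦ ContinuousLinearMap.ext fun w ↦ hflat x hx u v w)
  have hunit : ∀ᶠ x in 𝓝 z, IsUnit (G x) :=
    hG.self_of_nhds.continuousAt.eventually
      (Units.isOpen.mem_nhds (by rw [hG0]; exact isUnit_one))
  obtain ⟨ρ, hρ, hball⟩ := eventually_nhds_iff_ball.1 (hUz.and (hG.and hunit))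
  have hsub : ball z ρ ⊆ U := fun x hx ↦ (hball x hx).1
  have hGd := fun x hx ↦ (hball x hx).2.1
  have hGs : ContDiffOn ℝ ∞ G (ball z ρ) :=
    contDiffOn_of_hasFDerivAt_mul isOpen_ball (hΓ.mono hsub) hGd
  obtain ⟨χ, hχs, hχ⟩ := exists_primitive_comp_of_parallel hGs hGd
    (T := fun _ ↦ ContinuousLinearMap.id ℝ E) contDiffOn_const fun x hx u v ↦ by
      simpa using hsymm x (hsub hx) u v
  obtain ⟨φ, hφs, hφ⟩ := exists_primitive_comp_of_parallel hGs hGd (hT.mono hsub)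
    fun x hx ↦ hTsymm x (hsub hx)
  exact ⟨ρ, hρ, hsub, G, χ, φ, hGs, hχs, hφs, fun x hx ↦ (hball x hx).2.2,
    fun x hx u ↦ by rw [(hGd x hx).fderiv]; rfl, hχ, hφ⟩

end Frobenius

section Coordinates

open Set

variable {E : Type*} [NormedAddCommGroup E] [NormedSpace ℝ E]

theorem exists_openPartialHomeomorph_contDiffOn [CompleteSpace E] {f : E → E} {W : Set E}
    (hW : IsOpen W) {z₀ : E} (hz₀ : z₀ ∈ W) (hf : ContDiffOn ℝ ∞ f W)
    (hinv : (fderiv ℝ f z₀).IsInvertible) :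
    ∃ e : OpenPartialHomeomorph E E, z₀ ∈ e.source ∧ e.source ⊆ W ∧ (∀ z, e z = f z) ∧
      ContDiffOn ℝ ∞ e.symm e.target := by
  have hf₀ : ContDiffAt ℝ ∞ f z₀ := hf.contDiffAt (hW.mem_nhds hz₀)
  obtain ⟨f', hf'⟩ := hinv
  have hd : HasFDerivAt f (f' : E →L[ℝ] E) z₀ := by
    rw [hf']; exact (hf₀.differentiableAt (by simp)).hasFDerivAt
  let e₀ := hf₀.toOpenPartialHomeomorph f hd (by simp)
  let W' : Set E := W ∩ fderiv ℝ f ⁻¹' range ((↑) : (E ≃L[ℝ] E) → E →L[ℝ] E)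
  have hW' : IsOpen W' := (hf.continuousOn_fderiv_of_isOpen hW (by simp)).isOpen_inter_preimage hW
    ContinuousLinearEquiv.isOpen
  let e := e₀.restrOpen W' hW'
  have hes : e.source = e₀.source ∩ W' := e₀.restrOpen_source W' hW'
  refine ⟨e, ?_, ?_, fun z ↦ rfl, fun y hy ↦ ?_⟩
  · rw [hes]
    exact ⟨hf₀.mem_toOpenPartialHomeomorph_source hd (by simp), hz₀, f', hf'⟩
  · rw [hes]
    exact inter_subset_right.trans inter_subset_left
  · have hy' : e.symm y ∈ e.source := e.map_target hy
    rw [hes] at hy'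
    obtain ⟨g, hg⟩ := hy'.2.2
    have hfy : ContDiffAt ℝ ∞ e (e.symm y) := hf.contDiffAt (hW.mem_nhds hy'.2.1)
    have hdy : HasFDerivAt e (g : E →L[ℝ] E) (e.symm y) := by
      rw [hg]; exact (hfy.differentiableAt (by simp)).hasFDerivAt
    exact (e.contDiffAt_symm hy hdy hfy).contDiffWithinAt

variable {H : Type*} [TopologicalSpace H] {I : ModelWithCorners ℝ E H} [I.Boundaryless]
  {X : Type*} [TopologicalSpace X] [ChartedSpace H X]

theorem isInvertible_mfderiv_extend {φ : OpenPartialHomeomorph X H}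
    (hφ : φ ∈ IsManifold.maximalAtlas I ∞ X) {x : X} (hx : x ∈ φ.source) :
    (mvfderiv I (φ.extend I) x).IsInvertible := by
  let Φ : PartialDiffeomorph I 𝓘(ℝ, E) X E ∞ :=
    { toPartialEquiv := φ.extend I
      open_source := φ.isOpen_extend_source
      open_target := φ.isOpen_extend_target
      contMDiffOn_toFun := by
        rw [φ.extend_source]
        exact φ.contMDiffOn_extend hφ
      contMDiffOn_invFun := by
        rw [φ.extend_target']
        exact contMDiffOn_extend_symm hφ }
  have h : IsLocalDiffeomorphAt I 𝓘(ℝ, E) ∞ (φ.extend I) x :=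
    ⟨Φ, by rwa [φ.extend_source], fun _ _ ↦ rfl⟩
  exact ⟨h.mfderivToContinuousLinearEquiv (by simp), rfl⟩

variable [IsManifold I ∞ X]

theorem isInvertible_mfderiv_extChartAt_symm {x : X} {z : E}
    (hz : z ∈ (extChartAt I x).target) :
    (mfderiv 𝓘(ℝ, E) I (extChartAt I x).symm z).IsInvertible := by
  have h := isInvertible_mfderivWithin_extChartAt_symm (I := I) hz
  rwa [I.range_eq_univ, mfderivWithin_univ] at h

theorem contMDiffAt_extChartAt_symm {x : X} {z : E} (hz : z ∈ (extChartAt I x).target) :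
    ContMDiffAt 𝓘(ℝ, E) I ∞ (extChartAt I x).symm z :=
  (contMDiffOn_extChartAt_symm x).contMDiffAt ((isOpen_extChartAt_target x).mem_nhds hz)

theorem fderiv_comp_extChartAt_symm {V : Type*} [NormedAddCommGroup V] [NormedSpace ℝ V]
    {F : X → V} {x : X} {z : E} (hz : z ∈ (extChartAt I x).target)
    (hF : MDifferentiableAt I 𝓘(ℝ, V) F ((extChartAt I x).symm z)) :
    fderiv ℝ (F ∘ (extChartAt I x).symm) z =
      mvfderiv I F ((extChartAt I x).symm z) ∘L mfderiv 𝓘(ℝ, E) I (extChartAt I x).symm z := by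
  rw [← mfderiv_eq_fderiv]
  exact mfderiv_comp z hF ((contMDiffAt_extChartAt_symm hz).mdifferentiableAt (by simp))

theorem exists_chart_eq_comp_extChartAt (x₀ : X) {e : OpenPartialHomeomorph E E}
    (he : ContDiffOn ℝ ∞ e e.source) (hes : ContDiffOn ℝ ∞ e.symm e.target)
    (hsub : e.source ⊆ (extChartAt I x₀).target) :
    ∃ φ ∈ IsManifold.maximalAtlas I ∞ X,
      φ.source = (extChartAt I x₀).source ∩ extChartAt I x₀ ⁻¹' e.source ∧
      ∀ x, φ.extend I x = e (extChartAt I x₀ x) := by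
  let iH : OpenPartialHomeomorph H E := I.toHomeomorph.toOpenPartialHomeomorph
  let φ : OpenPartialHomeomorph X H := ((chartAt H x₀).trans iH).trans (e.trans iH.symm)
  have hsrc : φ.source = (extChartAt I x₀).source ∩ extChartAt I x₀ ⁻¹' e.source := by
    ext x
    simp [φ, iH]
  refine ⟨φ, OpenPartialHomeomorph.mem_maximalAtlas_of_contMDiffOn φ ?_ ?_, hsrc, fun x ↦ ?_⟩
  · refine I.contMDiffOn_symm.comp ((contMDiffOn_iff_contDiffOn.2 he).comp
      ((contMDiffOn_extChartAt (x := x₀)).mono fun x hx ↦ ?_) fun x hx ↦ ?_) fun x _ ↦ ?_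
    · exact extChartAt_source I x₀ ▸ (hsrc ▸ hx).1
    · exact (hsrc ▸ hx).2
    · exact I.range_eq_univ ▸ mem_univ _
  · have htgt (y : H) (hy : y ∈ φ.target) : I y ∈ e.target := by
      simp only [φ, iH, mfld_simps] at hy
      exact hy.1
    exact (contMDiffOn_extChartAt_symm x₀).comp ((contMDiffOn_iff_contDiffOn.2 hes).comp
      I.contMDiff.contMDiffOn htgt) fun y hy ↦ hsub (e.map_target (htgt y hy))
  · exact I.right_inv (I.range_eq_univ ▸ mem_univ _)

theorem exists_chart_of_isInvertible_mfderiv [CompleteSpace E] {F : X → E} {U : Set X}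
    (hU : IsOpen U) {x₀ : X} (hx₀ : x₀ ∈ U) (hF : ContMDiffOn I 𝓘(ℝ, E) ∞ F U)
    (hinv : (mvfderiv I F x₀).IsInvertible) :
    ∃ φ ∈ IsManifold.maximalAtlas I ∞ X, x₀ ∈ φ.source ∧ φ.source ⊆ U ∧
      ∀ x ∈ φ.source, φ.extend I x = F x := by
  let κ := extChartAt I x₀
  have hκx₀ : κ.symm (κ x₀) = x₀ := extChartAt_to_inv x₀
  let W : Set E := κ.target ∩ κ.symm ⁻¹' U
  have hW : IsOpen W := (continuousOn_extChartAt_symm x₀).isOpen_inter_preimage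
    (isOpen_extChartAt_target x₀) hU
  have hz₀ : κ x₀ ∈ W := ⟨mem_extChartAt_target x₀, by rwa [mem_preimage, hκx₀]⟩
  have hfW : ContDiffOn ℝ ∞ (F ∘ κ.symm) W := by
    rw [← contMDiffOn_iff_contDiffOn]
    exact hF.comp ((contMDiffOn_extChartAt_symm x₀).mono inter_subset_left) fun z hz ↦ hz.2
  have hfd : (fderiv ℝ (F ∘ κ.symm) (κ x₀)).IsInvertible := by
    have hFx₀ : MDifferentiableAt I 𝓘(ℝ, E) F x₀ :=
      (hF.contMDiffAt (hU.mem_nhds hx₀)).mdifferentiableAt (by simp)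
    rw [fderiv_comp_extChartAt_symm hz₀.1 (by rwa [hκx₀])]
    refine ContinuousLinearMap.IsInvertible.comp ?_ (isInvertible_mfderiv_extChartAt_symm hz₀.1)
    rwa [hκx₀]
  obtain ⟨e, he₀, heW, heF, hes⟩ := exists_openPartialHomeomorph_contDiffOn hW hz₀ hfW hfd
  obtain ⟨φ, hφ, hsrc, hφe⟩ := exists_chart_eq_comp_extChartAt (I := I) x₀
    ((hfW.mono heW).congr fun z _ ↦ heF z) hes (heW.trans inter_subset_left)
  have hinv (x : X) (hx : x ∈ φ.source) : κ.symm (κ x) = x := κ.left_inv (hsrc ▸ hx).1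
  refine ⟨φ, hφ, hsrc ▸ ⟨mem_extChartAt_source x₀, he₀⟩, fun x hx ↦ ?_, fun x hx ↦ ?_⟩
  · have hxU : κ.symm (κ x) ∈ U := (heW (hsrc ▸ hx).2).2
    rwa [hinv x hx] at hxU
  · rw [hφe, heF, Function.comp_apply]
    exact congrArg F (hinv x hx)

end Coordinates

section Smoothness

open Set ContinuousLinearMap VectorField

variable {E : Type*} [NormedAddCommGroup E] [NormedSpace ℝ E]
  {H : Type*} [TopologicalSpace H] {I : ModelWithCorners ℝ E H}
  {X : Type*} [TopologicalSpace X] [ChartedSpace H X]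
  {V : Type*} [NormedAddCommGroup V] [NormedSpace ℝ V]

theorem contMDiffAt_clm_inverse [CompleteSpace E] {S : X → E →L[ℝ] V} {x₀ : X}
    (hS : ContMDiffAt I 𝓘(ℝ, E →L[ℝ] V) ∞ S x₀) (h : (S x₀).IsInvertible) :
    ContMDiffAt I 𝓘(ℝ, V →L[ℝ] E) ∞ (fun x ↦ (S x).inverse) x₀ :=
  h.contDiffAt_map_inverse.contMDiffAt.comp x₀ hS

set_option synthInstance.maxHeartbeats 200000 in
theorem contDiff_flip {V W : Type*} [NormedAddCommGroup V] [NormedSpace ℝ V]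
    [NormedAddCommGroup W] [NormedSpace ℝ W] :
    ContDiff ℝ ∞ (fun f : V →L[ℝ] W →L[ℝ] ℝ ↦ f.flip) := by
  have hflip : IsBoundedLinearMap ℝ (fun f : V →L[ℝ] W →L[ℝ] ℝ ↦ f.flip) :=
    ⟨⟨fun _ _ ↦ rfl, fun _ _ ↦ rfl⟩, 1, one_pos, fun f ↦ by rw [opNorm_flip, one_mul]⟩
  exact hflip.contDiff

theorem contMDiffAt_flip {W : Type*} [NormedAddCommGroup W] [NormedSpace ℝ W]
    {B : X → V →L[ℝ] W →L[ℝ] ℝ} {x₀ : X}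
    (hB : ContMDiffAt I 𝓘(ℝ, V →L[ℝ] W →L[ℝ] ℝ) ∞ B x₀) :
    ContMDiffAt I 𝓘(ℝ, W →L[ℝ] V →L[ℝ] ℝ) ∞ (fun x ↦ (B x).flip) x₀ :=
  contDiff_flip.contMDiff.contMDiffAt.comp x₀ hB

variable [IsManifold I ∞ X]

/-- The differential of `F` at `x`, precomposed with the trivialization of the tangent bundle
around `x₀`: a family of linear maps between fixed spaces, whose smoothness in `x` can be used
without bundles. -/
def derivInTriv (I : ModelWithCorners ℝ E H) [IsManifold I ∞ X] (F : X → V) (x₀ x : X) :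
    E →L[ℝ] V :=
  mvfderiv I F x ∘L (trivializationAt E (TangentSpace I : X → Type _) x₀).symmL ℝ x

theorem contMDiffAt_derivInTriv {F : X → V} {x₀ : X} (hF : ContMDiffAt I 𝓘(ℝ, V) ∞ F x₀) :
    ContMDiffAt I 𝓘(ℝ, E →L[ℝ] V) ∞ (derivInTriv I F x₀) x₀ := by
  have heq : derivInTriv I F x₀ =
      inTangentCoordinates I 𝓘(ℝ, V) id F (mfderiv I 𝓘(ℝ, V) F) x₀ := by
    funext x
    simp only [inTangentCoordinates, inCoordinates,
      TangentBundle.continuousLinearMapAt_model_space (𝕜 := ℝ) (F x₀) (F x)]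
    rfl
  rw [heq]
  exact hF.mfderiv_const (m := ∞) (by simp)

theorem eventually_mem_baseSet (x₀ : X) : ∀ᶠ x in 𝓝 x₀,
    x ∈ (trivializationAt E (TangentSpace I : X → Type _) x₀).baseSet :=
  (trivializationAt E (TangentSpace I : X → Type _) x₀).open_baseSet.mem_nhds
    (FiberBundle.mem_baseSet_trivializationAt' _)

theorem isInvertible_derivInTriv {F : X → V} {x₀ x : X} (h : (mvfderiv I F x).IsInvertible)
    (hx : x ∈ (trivializationAt E (TangentSpace I : X → Type _) x₀).baseSet) :
    (derivInTriv I F x₀ x).IsInvertible := by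
  let t := trivializationAt E (TangentSpace I : X → Type _) x₀
  refine h.comp ⟨(t.continuousLinearEquivAt ℝ x hx).symm, ?_⟩
  ext u
  simp [t, Trivialization.symmL_apply _ hx]

theorem derivInTriv_trivializationAt_apply {F : X → V} {x₀ x : X}
    (hx : x ∈ (trivializationAt E (TangentSpace I : X → Type _) x₀).baseSet)
    (v : TangentSpace I x) :
    derivInTriv I F x₀ x (trivializationAt E (TangentSpace I : X → Type _) x₀ ⟨x, v⟩).2 =
      mvfderiv I F x v := by
  rw [derivInTriv, comp_apply, Trivialization.symmL_apply _ hx]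
  exact congrArg _ (Trivialization.symm_apply_apply_mk _ hx _)

theorem contMDiffAt_mvfderiv_apply {F : X → V} {Y : Π x : X, TangentSpace I x} {x₀ : X}
    (hF : ContMDiffAt I 𝓘(ℝ, V) ∞ F x₀)
    (hY : ContMDiffAt I I.tangent ∞ (fun x ↦ (⟨x, Y x⟩ : TangentBundle I X)) x₀) :
    ContMDiffAt I 𝓘(ℝ, V) ∞ (fun x ↦ mvfderiv I F x (Y x)) x₀ := by
  refine ((contMDiffAt_derivInTriv hF).clm_apply
    ((contMDiffAt_section x₀).1 hY)).congr_of_eventuallyEq ?_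
  filter_upwards [eventually_mem_baseSet (I := I) x₀] with x hx
  exact (derivInTriv_trivializationAt_apply hx (Y x)).symm

theorem contMDiffAt_inverse_derivInTriv [CompleteSpace E] {F : X → V} {x₀ : X}
    (hF : ContMDiffAt I 𝓘(ℝ, V) ∞ F x₀) (hinv : (mvfderiv I F x₀).IsInvertible) :
    ContMDiffAt I 𝓘(ℝ, V →L[ℝ] E) ∞ (fun x ↦ (derivInTriv I F x₀ x).inverse) x₀ :=
  contMDiffAt_clm_inverse (contMDiffAt_derivInTriv hF)
    (isInvertible_derivInTriv hinv (eventually_mem_baseSet x₀).self_of_nhds)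

theorem contMDiffAt_of_mvfderiv_apply [CompleteSpace E] {F : X → V}
    {Y : Π x : X, TangentSpace I x} {x₀ : X}
    (hF : ContMDiffAt I 𝓘(ℝ, V) ∞ F x₀) (hinv : ∀ᶠ x in 𝓝 x₀, (mvfderiv I F x).IsInvertible)
    (hY : ContMDiffAt I 𝓘(ℝ, V) ∞ (fun x ↦ mvfderiv I F x (Y x)) x₀) :
    ContMDiffAt I I.tangent ∞ (fun x ↦ (⟨x, Y x⟩ : TangentBundle I X)) x₀ := by
  refine (contMDiffAt_section x₀).2 (((contMDiffAt_inverse_derivInTriv hF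
    hinv.self_of_nhds).clm_apply hY).congr_of_eventuallyEq ?_)
  filter_upwards [eventually_mem_baseSet (I := I) x₀, hinv] with x hx hx'
  rw [← derivInTriv_trivializationAt_apply hx,
    (isInvertible_derivInTriv hx' hx).inverse_apply_self]

theorem contMDiffAt_endField_of_mvfderiv [CompleteSpace E] {F : X → V} {A : EndField I X} {x₀ : X}
    (hF : ContMDiffAt I 𝓘(ℝ, V) ∞ F x₀) (hinv : ∀ᶠ x in 𝓝 x₀, (mvfderiv I F x).IsInvertible)
    (c : V →L[ℝ] V)
    (hA : ∀ᶠ x in 𝓝 x₀, ∀ v : TangentSpace I x, mvfderiv I F x (A x v) = c (mvfderiv I F x v)) :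
    ContMDiffAt I (I.prod 𝓘(ℝ, E →L[ℝ] E)) ∞
    (fun x ↦ TotalSpace.mk' (E →L[ℝ] E)
      (E := fun x : X ↦ TangentSpace I x →L[ℝ] TangentSpace I x) x (A x)) x₀ := by
  rw [contMDiffAt_hom_bundle]
  refine ⟨contMDiffAt_id, ?_⟩
  refine ((contMDiffAt_inverse_derivInTriv hF hinv.self_of_nhds).clm_comp
    ((contMDiffAt_const (c := c)).clm_comp (contMDiffAt_derivInTriv hF))).congr_of_eventuallyEq ?_
  filter_upwards [eventually_mem_baseSet (I := I) x₀, hinv, hA] with x hx hx' hAx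
  have hcomm : derivInTriv I F x₀ x ∘L inCoordinates E (TangentSpace I : X → Type _) E
      (TangentSpace I : X → Type _) x₀ x x₀ x (A x) = c ∘L derivInTriv I F x₀ x := by
    ext u
    simp only [derivInTriv, inCoordinates, comp_apply]
    rw [← hAx, Trivialization.symmL_continuousLinearMapAt _ hx]
  rw [← hcomm]
  ext u
  exact ((isInvertible_derivInTriv hx' hx).inverse_apply_self _).symm

theorem contMDiffAt_bilinField_of_mvfderiv {F : X → V} {b : BilinField I X} {x₀ : X}
    (hF : ContMDiffAt I 𝓘(ℝ, V) ∞ F x₀) (c : V →L[ℝ] V →L[ℝ] ℝ)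
    (hb : ∀ᶠ x in 𝓝 x₀, ∀ v w : TangentSpace I x,
      b x v w = c (mvfderiv I F x v) (mvfderiv I F x w)) :
    ContMDiffAt I (I.prod 𝓘(ℝ, E →L[ℝ] E →L[ℝ] ℝ)) ∞
    (fun x ↦ TotalSpace.mk' (E →L[ℝ] E →L[ℝ] ℝ)
      (E := fun x : X ↦ TangentSpace I x →L[ℝ] TangentSpace I x →L[ℝ] ℝ) x (b x)) x₀ := by
  refine (contMDiffAt_hom_bundle (E₂ := fun x : X ↦ TangentSpace I x →L[ℝ] Bundle.Trivial X ℝ x)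
    (F₂ := E →L[ℝ] ℝ) _).2 ⟨contMDiffAt_id, ?_⟩
  have hS := contMDiffAt_derivInTriv hF
  have hpullback : ContMDiffAt I 𝓘(ℝ, E →L[ℝ] E →L[ℝ] ℝ) ∞
      (fun x ↦ ((c ∘L derivInTriv I F x₀ x).flip ∘L derivInTriv I F x₀ x).flip) x₀ :=
    contMDiffAt_flip ((contMDiffAt_flip ((contMDiffAt_const (c := c)).clm_comp hS)).clm_comp hS)
  refine hpullback.congr_of_eventuallyEq ?_
  filter_upwards [eventually_mem_baseSet (I := I) x₀, hb] with x hx hbx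
  ext u v
  refine (inCoordinates_apply_eq₂ (𝕜 := ℝ) (F₁ := E) (F₂ := E) (F₃ := ℝ)
    (E₁ := (TangentSpace I : X → Type _)) (E₂ := (TangentSpace I : X → Type _))
    (E₃ := Bundle.Trivial X ℝ) (x₀ := x₀) (x := x) (ϕ := b x) (v := u) (w := v)
    hx hx (by simp)).trans ?_
  simp [derivInTriv, hbx, Trivialization.symmL_apply _ hx]

theorem IsSmoothBilinField.comp_endField {b : BilinField I X} {A : EndField I X}
    (hb : IsSmoothBilinField I b) (hA : IsSmoothEndField I A) :
    IsSmoothBilinField I (fun x ↦ b x ∘L A x) := by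
  intro x₀
  have hA' := ((contMDiffAt_hom_bundle _).1 (hA x₀)).2
  have hb' := ((contMDiffAt_hom_bundle
    (E₂ := fun x : X ↦ TangentSpace I x →L[ℝ] Bundle.Trivial X ℝ x)
    (F₂ := E →L[ℝ] ℝ) _).1 (hb x₀)).2
  refine (contMDiffAt_hom_bundle (E₂ := fun x : X ↦ TangentSpace I x →L[ℝ] Bundle.Trivial X ℝ x)
    (F₂ := E →L[ℝ] ℝ) _).2 ⟨contMDiffAt_id, ?_⟩
  refine (hb'.clm_comp hA').congr_of_eventuallyEq ?_
  filter_upwards [eventually_mem_baseSet (I := I) x₀] with x hx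
  ext u
  simp only [inCoordinates, comp_apply]
  rw [Trivialization.symmL_continuousLinearMapAt _ hx]

end Smoothness

section Bracket

open VectorField

variable {E : Type*} [NormedAddCommGroup E] [NormedSpace ℝ E]
  {V : Type*} [NormedAddCommGroup V] [NormedSpace ℝ V]

theorem fderiv_fderiv_apply {F : E → V} {Y : E → E} {z : E} (hF : ContDiffAt ℝ 2 F z)
    (hY : DifferentiableAt ℝ Y z) (u : E) :
    fderiv ℝ (fun w ↦ fderiv ℝ F w (Y w)) z u =
      fderiv ℝ (fderiv ℝ F) z u (Y z) + fderiv ℝ F z (fderiv ℝ Y z u) := by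
  have hdF : DifferentiableAt ℝ (fderiv ℝ F) z :=
    (hF.fderiv_right (m := 1) (by norm_num)).differentiableAt (by simp)
  rw [(hdF.hasFDerivAt.clm_apply hY.hasFDerivAt).fderiv]
  simp [add_comm]

theorem fderiv_lieBracket {F : E → V} {Y Z : E → E} {z : E} (hF : ContDiffAt ℝ 2 F z)
    (hY : DifferentiableAt ℝ Y z) (hZ : DifferentiableAt ℝ Z z) :
    fderiv ℝ F z (lieBracket ℝ Y Z z) =
      fderiv ℝ (fun w ↦ fderiv ℝ F w (Z w)) z (Y z)
        - fderiv ℝ (fun w ↦ fderiv ℝ F w (Y w)) z (Z z) := by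
  have hsymm := hF.isSymmSndFDerivAt (by simp)
  rw [fderiv_fderiv_apply hF hZ, fderiv_fderiv_apply hF hY, lieBracket_eq, hsymm.eq (Y z), map_sub]
  abel

variable {H : Type*} [TopologicalSpace H] {I : ModelWithCorners ℝ E H} [I.Boundaryless]
  {X : Type*} [TopologicalSpace X] [ChartedSpace H X] [IsManifold I ∞ X]

theorem fderiv_comp_extChartAt_symm_mpullback {F : X → V} {x : X} {z : E}
    (hz : z ∈ (extChartAt I x).target)
    (hF : MDifferentiableAt I 𝓘(ℝ, V) F ((extChartAt I x).symm z))
    (Y : Π x : X, TangentSpace I x) :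
    fderiv ℝ (F ∘ (extChartAt I x).symm) z (mpullback 𝓘(ℝ, E) I (extChartAt I x).symm Y z) =
      mvfderiv I F ((extChartAt I x).symm z) (Y ((extChartAt I x).symm z)) := by
  rw [fderiv_comp_extChartAt_symm hz hF]
  exact congrArg _ ((isInvertible_mfderiv_extChartAt_symm hz).self_apply_inverse _)

variable [CompleteSpace E]

theorem differentiableAt_mpullback_extChartAt_symm {Y : Π x : X, TangentSpace I x} {x : X} {z : E}
    (hz : z ∈ (extChartAt I x).target)
    (hY : ContMDiffAt I I.tangent ∞ (fun y ↦ (⟨y, Y y⟩ : TangentBundle I X))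
      ((extChartAt I x).symm z)) :
    DifferentiableAt ℝ (mpullback 𝓘(ℝ, E) I (extChartAt I x).symm Y) z := by
  have h := (hY.of_le (by simp)).mpullback_vectorField_preimage (m := 1)
    (contMDiffAt_extChartAt_symm hz) (isInvertible_mfderiv_extChartAt_symm hz) (by norm_cast)
  exact (contMDiffAt_vectorSpace_iff_contDiffAt.1 h).differentiableAt (by simp)

theorem mvfderiv_mlieBracket {F : X → V} {x : X} {Y Z : Π x : X, TangentSpace I x}
    (hF : ContMDiffAt I 𝓘(ℝ, V) ∞ F x)
    (hY : ContMDiffAt I I.tangent ∞ (fun x ↦ (⟨x, Y x⟩ : TangentBundle I X)) x)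
    (hZ : ContMDiffAt I I.tangent ∞ (fun x ↦ (⟨x, Z x⟩ : TangentBundle I X)) x) :
    mvfderiv I F x (mlieBracket I Y Z x) =
      mvfderiv I (fun y ↦ mvfderiv I F y (Z y)) x (Y x)
        - mvfderiv I (fun y ↦ mvfderiv I F y (Y y)) x (Z x) := by
  let κ := extChartAt I x
  have hκx : κ x ∈ κ.target := mem_extChartAt_target x
  have hκ : κ.symm (κ x) = x := extChartAt_to_inv x
  rw [← hκ] at hF hY hZ
  let pull (Y : Π x : X, TangentSpace I x) : E → E := mpullback 𝓘(ℝ, E) I κ.symm Y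
  have htwo : minSmoothness ℝ 2 ≤ ∞ :=
    minSmoothness_of_isRCLikeNormedField.trans_le (by norm_cast)
  have : IsManifold I (minSmoothness ℝ 2) X := .of_le htwo
  have hbracket : pull (mlieBracket I Y Z) (κ x) = lieBracket ℝ (pull Y) (pull Z) (κ x) := by
    rw [← lieBracketWithin_univ, ← mlieBracketWithin_eq_lieBracketWithin, mlieBracketWithin_univ]
    exact mpullback_mlieBracket (hY.mdifferentiableAt (by simp)) (hZ.mdifferentiableAt (by simp))
      (contMDiffAt_extChartAt_symm hκx) htwo
  have hsmooth : ∀ᶠ z in 𝓝 (κ x), ContMDiffAt I 𝓘(ℝ, V) 2 F (κ.symm z) :=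
    (contMDiffAt_extChartAt_symm hκx).continuousAt.eventually
      ((contMDiffAt_iff_contMDiffAt_nhds (by simp)).1 (hF.of_le (by norm_cast)))
  have hmixed (Y Z : Π x : X, TangentSpace I x)
      (hZ : ContMDiffAt I I.tangent ∞ (fun x ↦ (⟨x, Z x⟩ : TangentBundle I X)) (κ.symm (κ x))) :
      fderiv ℝ (fun z ↦ fderiv ℝ (F ∘ κ.symm) z (pull Z z)) (κ x) (pull Y (κ x)) =
        mvfderiv I (fun y ↦ mvfderiv I F y (Z y)) (κ.symm (κ x)) (Y (κ.symm (κ x))) := by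
    rw [← fderiv_comp_extChartAt_symm_mpullback hκx
      ((contMDiffAt_mvfderiv_apply hF hZ).mdifferentiableAt (by simp)) Y]
    refine congrArg (fun D : E →L[ℝ] V ↦ D (pull Y (κ x))) (Filter.EventuallyEq.fderiv_eq ?_)
    filter_upwards [hsmooth, extChartAt_target_mem_nhds x] with z hFz hz
    exact fderiv_comp_extChartAt_symm_mpullback hz (hFz.mdifferentiableAt (by simp)) Z
  have hFκ : ContDiffAt ℝ 2 (F ∘ κ.symm) (κ x) := contMDiffAt_iff_contDiffAt.1
    ((hF.comp (κ x) (contMDiffAt_extChartAt_symm hκx)).of_le (by norm_cast))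
  have hmain := fderiv_lieBracket hFκ (differentiableAt_mpullback_extChartAt_symm hκx hY)
    (differentiableAt_mpullback_extChartAt_symm hκx hZ)
  rw [← hbracket, fderiv_comp_extChartAt_symm_mpullback hκx (hF.mdifferentiableAt (by simp)),
    hmixed Y Z hZ, hmixed Z Y hY, hκ] at hmain
  exact hmain

end Bracket

section ConstantCoordinates

open Set ContinuousLinearMap

variable {E : Type*} [NormedAddCommGroup E] [NormedSpace ℝ E]
  {H : Type*} [TopologicalSpace H] {I : ModelWithCorners ℝ E H}
  {X : Type*} [TopologicalSpace X] [ChartedSpace H X]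
  {V : Type*} [NormedAddCommGroup V] [NormedSpace ℝ V]
  {W : Type*} [NormedAddCommGroup W] [NormedSpace ℝ W]
  {Z : Type*} [NormedAddCommGroup Z] [NormedSpace ℝ Z]

theorem mvfderiv_clm_comp {f : X → V} {x : X} (hf : MDifferentiableAt I 𝓘(ℝ, V) f x)
    (L : V →L[ℝ] W) (u : TangentSpace I x) :
    mvfderiv I (fun y ↦ L (f y)) x u = L (mvfderiv I f x u) :=
  congr($((L.hasFDerivAt (x := f x)).hasMFDerivAt.comp x hf.hasMFDerivAt |>.mfderiv) u)

theorem hasMFDerivAt_prodMk_space {f : X → V} {h : X → W} {x : X}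
    (hf : MDifferentiableAt I 𝓘(ℝ, V) f x) (hh : MDifferentiableAt I 𝓘(ℝ, W) h x) :
    HasMFDerivAt I 𝓘(ℝ, V × W) (fun y ↦ (f y, h y)) x
      ((mvfderiv I f x).prod (mvfderiv I h x)) :=
  ⟨hf.hasMFDerivAt.1.prodMk hh.hasMFDerivAt.1, hf.hasMFDerivAt.2.prodMk hh.hasMFDerivAt.2⟩

theorem mvfderiv_prodMk {f : X → V} {h : X → W} {x : X} (hf : MDifferentiableAt I 𝓘(ℝ, V) f x)
    (hh : MDifferentiableAt I 𝓘(ℝ, W) h x) (u : TangentSpace I x) :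
    mvfderiv I (fun y ↦ (f y, h y)) x u = (mvfderiv I f x u, mvfderiv I h x u) :=
  congr($((hasMFDerivAt_prodMk_space hf hh).mfderiv) u)

theorem mvfderiv_bilin {f : X → V} {h : X → W} {x : X} (hf : MDifferentiableAt I 𝓘(ℝ, V) f x)
    (hh : MDifferentiableAt I 𝓘(ℝ, W) h x) (c : V →L[ℝ] W →L[ℝ] Z) (u : TangentSpace I x) :
    mvfderiv I (fun y ↦ c (f y) (h y)) x u =
      c (mvfderiv I f x u) (h x) + c (f x) (mvfderiv I h x u) := by
  have hcomp := HasMFDerivAt.comp (f := fun y ↦ (f y, h y)) x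
    (c.isBoundedBilinearMap.hasFDerivAt (f x, h x)).hasMFDerivAt
    (hasMFDerivAt_prodMk_space hf hh)
  exact (congr($hcomp.mfderiv u)).trans (add_comm _ _)

theorem mvfderiv_congr {f h : X → V} {x : X} (hfh : f =ᶠ[𝓝 x] h) (u : TangentSpace I x) :
    mvfderiv I f x u = mvfderiv I h x u :=
  congr($(hfh.mfderiv_eq) u)

theorem mvfderiv_eq_zero_of_eventuallyEq_const {f : X → V} {x : X} {e : V}
    (hf : ∀ᶠ y in 𝓝 x, f y = e) (u : TangentSpace I x) :
    mvfderiv I f x u = 0 := by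
  rw [mvfderiv_congr (h := fun _ ↦ e) hf u, mvfderiv_const]
  rfl

variable (I) in
/-- `F` is a system of smooth coordinates on the open set `U`: a local diffeomorphism to the model
space, not required to be injective. -/
structure IsCoordinateOn (F : X → E) (U : Set X) : Prop where
  isOpen : IsOpen U
  contMDiffOn : ContMDiffOn I 𝓘(ℝ, E) ∞ F U
  isInvertible : ∀ x ∈ U, (mvfderiv I F x).IsInvertible

namespace IsCoordinateOn

variable {F : X → E} {U : Set X}

theorem contMDiffAt (h : IsCoordinateOn I F U) {x : X} (hx : x ∈ U) :
    ContMDiffAt I 𝓘(ℝ, E) ∞ F x :=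
  h.contMDiffOn.contMDiffAt (h.isOpen.mem_nhds hx)

theorem eventually_isInvertible (h : IsCoordinateOn I F U) {x : X} (hx : x ∈ U) :
    ∀ᶠ y in 𝓝 x, (mvfderiv I F y).IsInvertible :=
  Filter.mem_of_superset (h.isOpen.mem_nhds hx) h.isInvertible

theorem exists_chart [CompleteSpace E] [IsManifold I ∞ X] [I.Boundaryless]
    (h : IsCoordinateOn I F U) {x₀ : X} (hx₀ : x₀ ∈ U) :
    ∃ φ ∈ IsManifold.maximalAtlas I ∞ X, x₀ ∈ φ.source ∧ φ.source ⊆ U ∧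
      ∀ x ∈ φ.source, mfderiv I 𝓘(ℝ, E) (φ.extend I) x = mvfderiv I F x := by
  obtain ⟨φ, hφ, hx₀φ, hU, hF⟩ :=
    exists_chart_of_isInvertible_mfderiv h.isOpen hx₀ h.contMDiffOn (h.isInvertible x₀ hx₀)
  refine ⟨φ, hφ, hx₀φ, hU, fun x hx ↦ Filter.EventuallyEq.mfderiv_eq ?_⟩
  filter_upwards [φ.open_source.mem_nhds hx] using hF

end IsCoordinateOn

/-- The endomorphism field `A` is given on `U` by the constant endomorphism `c` of the model space
in the smooth coordinates `F`. -/
structure IsConstantIn (A : EndField I X) (U : Set X) (F : X → E) (c : E →L[ℝ] E) : Prop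
    extends IsCoordinateOn I F U where
  mvfderiv_apply : ∀ x ∈ U, ∀ v : TangentSpace I x,
    mvfderiv I F x (A x v) = c (mvfderiv I F x v)

namespace IsConstantIn

variable {A : EndField I X} {U : Set X} {F : X → E} {c : E →L[ℝ] E}

theorem id_sub (h : IsConstantIn A U F c) :
    IsConstantIn (fun x ↦ ContinuousLinearMap.id ℝ (TangentSpace I x) - A x) U F
      (ContinuousLinearMap.id ℝ E - c) where
  toIsCoordinateOn := h.toIsCoordinateOn
  mvfderiv_apply x hx v := (map_sub (mvfderiv I F x) v (A x v)).trans <| by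
    rw [h.mvfderiv_apply x hx]
    rfl

theorem id_add (h : IsConstantIn A U F c) :
    IsConstantIn (fun x ↦ ContinuousLinearMap.id ℝ (TangentSpace I x) + A x) U F
      (ContinuousLinearMap.id ℝ E + c) where
  toIsCoordinateOn := h.toIsCoordinateOn
  mvfderiv_apply x hx v := (map_add (mvfderiv I F x) v (A x v)).trans <| by
    rw [h.mvfderiv_apply x hx]
    rfl

theorem exists_chart_apply [CompleteSpace E] [IsManifold I ∞ X] [I.Boundaryless]
    (h : IsConstantIn A U F c) {x₀ : X} (hx₀ : x₀ ∈ U) :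
    ∃ φ ∈ IsManifold.maximalAtlas I ∞ X, x₀ ∈ φ.source ∧ ∀ x ∈ φ.source, ∀ v : TangentSpace I x,
      mfderiv I 𝓘(ℝ, E) (φ.extend I) x (A x v) = c (mfderiv I 𝓘(ℝ, E) (φ.extend I) x v) := by
  obtain ⟨φ, hφ, hx₀φ, hU, hF⟩ := h.exists_chart hx₀
  refine ⟨φ, hφ, hx₀φ, fun x hx v ↦ ?_⟩
  rw [hF x hx]
  exact h.mvfderiv_apply x (hU hx) v

end IsConstantIn

/-- Around every point there are smooth coordinates in which the endomorphism field is constant,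
i.e. it is integrable as a `G`-structure. -/
def IsLocallyConstantField (A : EndField I X) : Prop :=
  ∀ x₀ : X, ∃ U F c, x₀ ∈ U ∧ IsConstantIn A U F c

namespace IsLocallyConstantField

variable {A : EndField I X} [IsManifold I ∞ X] [CompleteSpace E]

theorem isSmoothEndField (hA : IsLocallyConstantField A) : IsSmoothEndField I A := by
  intro x₀
  obtain ⟨U, F, c, hx₀, h⟩ := hA x₀
  refine contMDiffAt_endField_of_mvfderiv (h.contMDiffAt hx₀) (h.eventually_isInvertible hx₀) c ?_
  filter_upwards [h.isOpen.mem_nhds hx₀] using h.mvfderiv_apply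

variable [I.Boundaryless]

theorem isIntegrableDistribution_ker (hA : IsLocallyConstantField A) :
    IsIntegrableDistribution I (fun x ↦ LinearMap.ker (A x).toLinearMap) := by
  intro x₀
  obtain ⟨U, F, c, hx₀, h⟩ := hA x₀
  obtain ⟨φ, hφ, hx₀φ, hU, hF⟩ := h.exists_chart hx₀
  refine ⟨φ, hφ, hx₀φ, LinearMap.ker c.toLinearMap, fun x hx v ↦ ?_⟩
  have hinj : A x v = 0 ↔ mvfderiv I F x (A x v) = 0 :=
    (map_eq_zero_iff _ (h.isInvertible x (hU hx)).injective).symm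
  rw [h.mvfderiv_apply x (hU hx) v, ← hF x hx] at hinj
  exact hinj

theorem isIntegrableDistribution_eigenPlus (hA : IsLocallyConstantField A) :
    IsIntegrableDistribution I (eigenPlus I A) :=
  isIntegrableDistribution_ker fun x₀ ↦
    let ⟨U, F, _, hx₀, h⟩ := hA x₀
    ⟨U, F, _, hx₀, h.id_sub⟩

theorem isIntegrableDistribution_eigenMinus (hA : IsLocallyConstantField A) :
    IsIntegrableDistribution I (eigenMinus I A) :=
  isIntegrableDistribution_ker fun x₀ ↦
    let ⟨U, F, _, hx₀, h⟩ := hA x₀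
    ⟨U, F, _, hx₀, h.id_add⟩

end IsLocallyConstantField

theorem isClosedTwoForm_of_mvfderiv [IsManifold I ∞ X] [I.Boundaryless] [CompleteSpace E]
    {b : BilinField I X}
    (hb : ∀ x₀ : X, ∃ (F : X → V) (c : V →L[ℝ] V →L[ℝ] ℝ), ContMDiffAt I 𝓘(ℝ, V) ∞ F x₀ ∧
      (∀ u v, c u v = -c v u) ∧ ∀ᶠ x in 𝓝 x₀, ∀ v w : TangentSpace I x,
        b x v w = c (mvfderiv I F x v) (mvfderiv I F x w)) :
    IsClosedTwoForm I b := by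
  intro Y₁ Y₂ Y₃ h₁ h₂ h₃ x
  obtain ⟨F, c, hF, hc, hbc⟩ := hb x
  have hd (Y Z : Π x : X, TangentSpace I x) (hY : IsSmoothVectorField I Y)
      (hZ : IsSmoothVectorField I Z) (u : TangentSpace I x) :
      mvfderiv I (fun y ↦ b y (Y y) (Z y)) x u =
        c (mvfderiv I (fun y ↦ mvfderiv I F y (Y y)) x u) (mvfderiv I F x (Z x)) +
          c (mvfderiv I F x (Y x)) (mvfderiv I (fun y ↦ mvfderiv I F y (Z y)) x u) := by
    rw [← mvfderiv_bilin ((contMDiffAt_mvfderiv_apply hF (hY x)).mdifferentiableAt (by simp))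
      ((contMDiffAt_mvfderiv_apply hF (hZ x)).mdifferentiableAt (by simp)) c u]
    refine mvfderiv_congr ?_ u
    filter_upwards [hbc] with y hy using hy _ _
  rw [hd Y₂ Y₃ h₂ h₃, hd Y₁ Y₃ h₁ h₃, hd Y₁ Y₂ h₁ h₂]
  simp only [hbc.self_of_nhds, mvfderiv_mlieBracket hF (h₁ x) (h₂ x),
    mvfderiv_mlieBracket hF (h₁ x) (h₃ x), mvfderiv_mlieBracket hF (h₂ x) (h₃ x), map_sub,
    sub_apply]
  rw [hc (mvfderiv I F x (Y₁ x)) (mvfderiv I (fun y ↦ mvfderiv I F y (Y₂ y)) x (Y₃ x)),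
    hc (mvfderiv I F x (Y₁ x)) (mvfderiv I (fun y ↦ mvfderiv I F y (Y₃ y)) x (Y₂ x)),
    hc (mvfderiv I F x (Y₂ x)) (mvfderiv I (fun y ↦ mvfderiv I F y (Y₃ y)) x (Y₁ x))]
  ring

end ConstantCoordinates

section LocalConnection

open Set ContinuousLinearMap

variable {E : Type*} [NormedAddCommGroup E] [NormedSpace ℝ E]
  {H : Type*} [TopologicalSpace H] {I : ModelWithCorners ℝ E H}
  {X : Type*} [TopologicalSpace X] [ChartedSpace H X] [IsManifold I ∞ X]

variable (I) in
/-- The vector field `Y`, which is defined everywhere, is smooth on `U`. Local frames are encoded in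
this way, with irrelevant values outside `U`. -/
def IsSmoothVectorFieldOn (Y : Π x : X, TangentSpace I x) (U : Set X) : Prop :=
  ContMDiffOn I I.tangent ∞ (fun x ↦ (⟨x, Y x⟩ : TangentBundle I X)) U

namespace IsSmoothVectorFieldOn

variable {Y Z : Π x : X, TangentSpace I x} {U : Set X} {x : X}

theorem contMDiffAt (h : IsSmoothVectorFieldOn I Y U) (hU : IsOpen U) (hx : x ∈ U) :
    ContMDiffAt I I.tangent ∞ (fun x ↦ (⟨x, Y x⟩ : TangentBundle I X)) x :=
  ContMDiffOn.contMDiffAt h (hU.mem_nhds hx)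

theorem mdifferentiableAt (h : IsSmoothVectorFieldOn I Y U) (hU : IsOpen U) (hx : x ∈ U) :
    MDifferentiableAt I I.tangent (fun x ↦ (⟨x, Y x⟩ : TangentBundle I X)) x :=
  (h.contMDiffAt hU hx).mdifferentiableAt (by simp)

theorem endField_apply {A : EndField I X} (h : IsSmoothVectorFieldOn I Y U)
    (hA : IsSmoothEndField I A) : IsSmoothVectorFieldOn I (fun x ↦ A x (Y x)) U :=
  ContMDiffOn.clm_bundle_apply (F₁ := E) (F₂ := E) (E₁ := fun x : X ↦ TangentSpace I x)
    (E₂ := fun x : X ↦ TangentSpace I x) (b := fun x ↦ x) (hA.contMDiffOn (s := U)) h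

theorem bilinField_apply {b : BilinField I X} (hY : IsSmoothVectorFieldOn I Y U)
    (hZ : IsSmoothVectorFieldOn I Z U) (hb : IsSmoothBilinField I b) :
    ContMDiffOn I 𝓘(ℝ, ℝ) ∞ (fun x ↦ b x (Y x) (Z x)) U := by
  have hbYZ := ContMDiffOn.clm_bundle_apply₂ (F₁ := E) (F₂ := E) (F₃ := ℝ)
    (E₁ := fun x : X ↦ TangentSpace I x) (E₂ := fun x : X ↦ TangentSpace I x)
    (E₃ := Bundle.Trivial X ℝ) (b := fun x ↦ x) (hb.contMDiffOn (s := U)) hY hZ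
  exact fun x hx ↦ ((contMDiffWithinAt_totalSpace).1 (hbYZ x hx)).2

theorem exists_extension [FiniteDimensional ℝ E] [T2Space X] (h : IsSmoothVectorFieldOn I Y U)
    (hU : IsOpen U) (hx : x ∈ U) :
    ∃ Y' : Π x : X, TangentSpace I x, IsSmoothVectorField I Y' ∧ ∀ᶠ y in 𝓝 x, Y' y = Y y := by
  obtain ⟨f, -, hf⟩ := (SmoothBumpFunction.nhds_basis_tsupport (I := I) x).mem_iff.1
    (hU.mem_nhds hx)
  refine ⟨fun y ↦ f y • Y y, ContMDiffOn.smul_section_of_tsupport f.contMDiff.contMDiffOn hU hf h,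
    ?_⟩
  filter_upwards [f.eventuallyEq_one] with y hy
  rw [hy]
  exact one_smul _ _

variable {cov : CovariantDerivative I E (TangentSpace I : X → Type _)}

theorem cov_congr {Y' : Π x : X, TangentSpace I x} (hY : IsSmoothVectorFieldOn I Y U)
    (hU : IsOpen U) (hx : x ∈ U) (h : ∀ᶠ y in 𝓝 x, Y' y = Y y) :
    ∀ᶠ y in 𝓝 x, cov Y' y = cov Y y := by
  filter_upwards [h.eventually_nhds, hU.mem_nhds hx] with y hy hyU
  have hYy := hY.mdifferentiableAt hU hyU
  refine cov.isCovariantDerivativeOn.congr_of_eventuallyEq (hYy.congr_of_eventuallyEq ?_) hYy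
    Filter.univ_mem hy
  filter_upwards [hy] with z hz
  rw [hz]

theorem cov_apply [FiniteDimensional ℝ E] [T2Space X]
    (hcov : CovariantDerivative.ContMDiffCovariantDerivative cov ∞) (hU : IsOpen U)
    (hY : IsSmoothVectorFieldOn I Y U) (hZ : IsSmoothVectorFieldOn I Z U) :
    IsSmoothVectorFieldOn I (fun x ↦ cov Y x (Z x)) U := by
  intro x hx
  obtain ⟨Y', hY', hYY'⟩ := hY.exists_extension hU hx
  have hcovY' := (hcov.contMDiff.contMDiff (σ := Y') hY'.contMDiffOn).contMDiffAt
    (x := x) Filter.univ_mem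
  have hcovY'Z := ContMDiffAt.clm_bundle_apply (F₁ := E) (F₂ := E)
    (E₁ := fun x : X ↦ TangentSpace I x) (E₂ := fun x : X ↦ TangentSpace I x) (b := fun x ↦ x)
    hcovY' (hZ.contMDiffAt hU hx)
  refine (hcovY'Z.congr_of_eventuallyEq ?_).contMDiffWithinAt
  filter_upwards [hY.cov_congr (cov := cov) hU hx hYY'] with y hy
  change (⟨y, cov Y y (Z y)⟩ : TangentBundle I X) = ⟨y, cov Y' y (Z y)⟩
  rw [hy]

end IsSmoothVectorFieldOn

variable [FiniteDimensional ℝ E] [T2Space X]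
  {cov : CovariantDerivative I E (TangentSpace I : X → Type _)}
  {Y₁ Y₂ Y₃ : Π x : X, TangentSpace I x} {U : Set X} {x : X}

theorem IsFlatConnection.apply_of_smoothOn (hflat : IsFlatConnection cov)
    (hcov : CovariantDerivative.ContMDiffCovariantDerivative cov ∞) (hU : IsOpen U)
    (h₁ : IsSmoothVectorFieldOn I Y₁ U) (h₂ : IsSmoothVectorFieldOn I Y₂ U)
    (h₃ : IsSmoothVectorFieldOn I Y₃ U) (hx : x ∈ U) :
    cov (fun y ↦ cov Y₃ y (Y₂ y)) x (Y₁ x) - cov (fun y ↦ cov Y₃ y (Y₁ y)) x (Y₂ x)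
      - cov Y₃ x (VectorField.mlieBracket I Y₁ Y₂ x) = 0 := by
  obtain ⟨Z₁, hZ₁, e₁⟩ := h₁.exists_extension hU hx
  obtain ⟨Z₂, hZ₂, e₂⟩ := h₂.exists_extension hU hx
  obtain ⟨Z₃, hZ₃, e₃⟩ := h₃.exists_extension hU hx
  have hcov₃ := h₃.cov_congr (cov := cov) hU hx e₃
  have hcov_cov {Y Z : Π x : X, TangentSpace I x} (hY : IsSmoothVectorFieldOn I Y U)
      (e : ∀ᶠ y in 𝓝 x, Z y = Y y) :
      cov (fun y ↦ cov Z₃ y (Z y)) x = cov (fun y ↦ cov Y₃ y (Y y)) x := by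
    refine ((h₃.cov_apply hcov hU hY).cov_congr hU hx ?_).self_of_nhds
    filter_upwards [e, hcov₃] with y hy hcovy
    rw [hy, hcovy]
  have hflatZ := hflat Z₁ Z₂ Z₃ hZ₁ hZ₂ hZ₃ x
  rwa [hcov_cov h₂ e₂, hcov_cov h₁ e₁, hcov₃.self_of_nhds, e₁.self_of_nhds, e₂.self_of_nhds,
    Filter.EventuallyEq.mlieBracket_vectorField_eq e₁ e₂] at hflatZ

theorem IsParallelForm.apply_of_smoothOn {b : BilinField I X} (hb : IsParallelForm cov b)
    (hU : IsOpen U) (h₁ : IsSmoothVectorFieldOn I Y₁ U) (h₂ : IsSmoothVectorFieldOn I Y₂ U)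
    (h₃ : IsSmoothVectorFieldOn I Y₃ U) (hx : x ∈ U) :
    mvfderiv I (fun y ↦ b y (Y₂ y) (Y₃ y)) x (Y₁ x)
      - b x (cov Y₂ x (Y₁ x)) (Y₃ x) - b x (Y₂ x) (cov Y₃ x (Y₁ x)) = 0 := by
  obtain ⟨Z₁, hZ₁, e₁⟩ := h₁.exists_extension hU hx
  obtain ⟨Z₂, hZ₂, e₂⟩ := h₂.exists_extension hU hx
  obtain ⟨Z₃, hZ₃, e₃⟩ := h₃.exists_extension hU hx
  have hbYZ : (fun y ↦ b y (Z₂ y) (Z₃ y)) =ᶠ[𝓝 x] fun y ↦ b y (Y₂ y) (Y₃ y) := by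
    filter_upwards [e₂, e₃] with y hy₂ hy₃
    rw [hy₂, hy₃]
  have hbZ := hb Z₁ Z₂ Z₃ hZ₁ hZ₂ hZ₃ x
  rwa [mvfderiv_congr hbYZ, (h₃.cov_congr hU hx e₃).self_of_nhds,
    (h₂.cov_congr hU hx e₂).self_of_nhds, e₁.self_of_nhds, e₂.self_of_nhds, e₃.self_of_nhds] at hbZ

theorem HasSymmetricDeriv.apply_of_smoothOn {A : EndField I X} (hsymm : HasSymmetricDeriv cov A)
    (hA : IsSmoothEndField I A) (hU : IsOpen U) (h₁ : IsSmoothVectorFieldOn I Y₁ U)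
    (h₂ : IsSmoothVectorFieldOn I Y₂ U) (hx : x ∈ U) :
    cov (fun y ↦ A y (Y₂ y)) x (Y₁ x) - A x (cov Y₂ x (Y₁ x)) =
      cov (fun y ↦ A y (Y₁ y)) x (Y₂ x) - A x (cov Y₁ x (Y₂ x)) := by
  obtain ⟨Z₁, hZ₁, e₁⟩ := h₁.exists_extension hU hx
  obtain ⟨Z₂, hZ₂, e₂⟩ := h₂.exists_extension hU hx
  have hcov_apply {Y Z : Π x : X, TangentSpace I x} (hY : IsSmoothVectorFieldOn I Y U)
      (e : ∀ᶠ y in 𝓝 x, Z y = Y y) :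
      cov (fun y ↦ A y (Z y)) x = cov (fun y ↦ A y (Y y)) x := by
    refine ((hY.endField_apply hA).cov_congr hU hx ?_).self_of_nhds
    filter_upwards [e] with y hy
    rw [hy]
  have hsymmZ := hsymm Z₁ Z₂ hZ₁ hZ₂ x
  rwa [hcov_apply h₂ e₂, hcov_apply h₁ e₁, (h₁.cov_congr hU hx e₁).self_of_nhds,
    (h₂.cov_congr hU hx e₂).self_of_nhds, e₁.self_of_nhds, e₂.self_of_nhds] at hsymmZ

end LocalConnection

section CoordinateFields

open Set ContinuousLinearMap VectorField

variable {E : Type*} [NormedAddCommGroup E] [NormedSpace ℝ E]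
  {H : Type*} [TopologicalSpace H] {I : ModelWithCorners ℝ E H}
  {X : Type*} [TopologicalSpace X] [ChartedSpace H X]

variable (I) in
/-- The vector field with constant components `e` in the coordinates `F`. Like every local frame
here it is defined everywhere, with irrelevant values where `F` is not a coordinate system. -/
def coordField (F : X → E) (e : E) (x : X) : TangentSpace I x :=
  (mvfderiv I F x).inverse e

/-- The matrix of the endomorphism field `A` in the coordinates `F`. -/
def endInCoord (F : X → E) (A : EndField I X) (x : X) : E →L[ℝ] E :=
  mvfderiv I F x ∘L A x ∘L (mvfderiv I F x).inverse

namespace IsCoordinateOn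

variable {F : X → E} {U : Set X} {x : X}

theorem mono {V : Set X} (h : IsCoordinateOn I F U) (hV : IsOpen V) (hVU : V ⊆ U) :
    IsCoordinateOn I F V :=
  ⟨hV, h.contMDiffOn.mono hVU, fun x hx ↦ h.isInvertible x (hVU hx)⟩

theorem injective (h : IsCoordinateOn I F U) (hx : x ∈ U) :
    Function.Injective (mvfderiv I F x) :=
  (h.isInvertible x hx).injective

theorem mvfderiv_coordField (h : IsCoordinateOn I F U) (hx : x ∈ U) (e : E) :
    mvfderiv I F x (coordField I F e x) = e :=
  (h.isInvertible x hx).self_apply_inverse e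

theorem eventually_mvfderiv_coordField (h : IsCoordinateOn I F U) (hx : x ∈ U) (e : E) :
    ∀ᶠ y in 𝓝 x, mvfderiv I F y (coordField I F e y) = e := by
  filter_upwards [h.isOpen.mem_nhds hx] with y hy using h.mvfderiv_coordField hy e

theorem coordField_mvfderiv (h : IsCoordinateOn I F U) (hx : x ∈ U) (v : TangentSpace I x) :
    coordField I F (mvfderiv I F x v) x = v :=
  (h.isInvertible x hx).inverse_apply_self v

theorem endInCoord_mvfderiv (h : IsCoordinateOn I F U) (hx : x ∈ U) (A : EndField I X)
    (v : TangentSpace I x) : endInCoord F A x (mvfderiv I F x v) = mvfderiv I F x (A x v) :=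
  congrArg (fun w ↦ mvfderiv I F x (A x w)) (h.coordField_mvfderiv hx v)

theorem sum_repr_smul_coordField {ι : Type*} [Fintype ι] (h : IsCoordinateOn I F U) (hx : x ∈ U)
    (b : Module.Basis ι ℝ E) (v : TangentSpace I x) :
    ∑ i, b.repr (mvfderiv I F x v) i • coordField I F (b i) x = v := by
  apply h.injective hx
  simp only [map_sum, map_smul, h.mvfderiv_coordField hx]
  exact b.sum_repr _

variable [IsManifold I ∞ X]

theorem contMDiffOn_mvfderiv_apply (h : IsCoordinateOn I F U) {Y : Π x : X, TangentSpace I x}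
    (hY : IsSmoothVectorFieldOn I Y U) :
    ContMDiffOn I 𝓘(ℝ, E) ∞ (fun y ↦ mvfderiv I F y (Y y)) U := fun _ hx ↦
  (contMDiffAt_mvfderiv_apply (h.contMDiffAt hx) (hY.contMDiffAt h.isOpen hx)).contMDiffWithinAt

theorem mdifferentiableAt_mvfderiv_apply (h : IsCoordinateOn I F U)
    {Y : Π x : X, TangentSpace I x} (hY : IsSmoothVectorFieldOn I Y U) (hx : x ∈ U) :
    MDifferentiableAt I 𝓘(ℝ, E) (fun y ↦ mvfderiv I F y (Y y)) x :=
  ((h.contMDiffOn_mvfderiv_apply hY).contMDiffAt (h.isOpen.mem_nhds hx)).mdifferentiableAt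
    (by simp)

variable [CompleteSpace E]

theorem isSmoothVectorFieldOn_coordField (h : IsCoordinateOn I F U) (e : E) :
    IsSmoothVectorFieldOn I (coordField I F e) U := fun _ hx ↦
  (contMDiffAt_of_mvfderiv_apply (h.contMDiffAt hx) (h.eventually_isInvertible hx)
    ((contMDiffAt_const (c := e)).congr_of_eventuallyEq
      (h.eventually_mvfderiv_coordField hx e))).contMDiffWithinAt

theorem contMDiffOn_endInCoord_apply (h : IsCoordinateOn I F U) {A : EndField I X}
    (hA : IsSmoothEndField I A) (e : E) :
    ContMDiffOn I 𝓘(ℝ, E) ∞ (fun x ↦ endInCoord F A x e) U :=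
  h.contMDiffOn_mvfderiv_apply ((h.isSmoothVectorFieldOn_coordField e).endField_apply hA)

theorem mlieBracket_coordField [I.Boundaryless] (h : IsCoordinateOn I F U) (hx : x ∈ U)
    (e f : E) : mlieBracket I (coordField I F e) (coordField I F f) x = 0 := by
  apply h.injective hx
  rw [mvfderiv_mlieBracket (h.contMDiffAt hx)
    ((h.isSmoothVectorFieldOn_coordField e).contMDiffAt h.isOpen hx)
    ((h.isSmoothVectorFieldOn_coordField f).contMDiffAt h.isOpen hx), map_zero,
    mvfderiv_eq_zero_of_eventuallyEq_const (h.eventually_mvfderiv_coordField hx e),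
    mvfderiv_eq_zero_of_eventuallyEq_const (h.eventually_mvfderiv_coordField hx f), sub_zero]

end IsCoordinateOn

end CoordinateFields

section Christoffel

open Set ContinuousLinearMap

variable {E : Type*} [NormedAddCommGroup E] [NormedSpace ℝ E]
  {H : Type*} [TopologicalSpace H] {I : ModelWithCorners ℝ E H}
  {X : Type*} [TopologicalSpace X] [ChartedSpace H X] [IsManifold I ∞ X]
  {cov : CovariantDerivative I E (TangentSpace I : X → Type _)} {F : X → E} {U : Set X} {x : X}

theorem cov_sum {ι : Type*} {s : Finset ι} {Y : ι → Π x : X, TangentSpace I x}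
    (hY : ∀ i ∈ s, MDifferentiableAt I I.tangent (fun x ↦ (⟨x, Y i x⟩ : TangentBundle I X)) x) :
    cov (fun x ↦ ∑ i ∈ s, Y i x) x = ∑ i ∈ s, cov (Y i) x := by
  classical
  induction s using Finset.induction_on with
  | empty => exact cov.isCovariantDerivativeOn.zero
  | insert i s hi ih =>
    have hs := fun j hj ↦ hY j (Finset.mem_insert_of_mem hj)
    simp only [Finset.sum_insert hi]
    rw [← ih hs]
    exact cov.isCovariantDerivativeOn.add (hY i (Finset.mem_insert_self i s))
      (MDifferentiableAt.sum_section hs)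

theorem IsCoordinateOn.mvfderiv_cov_smul_coordField [CompleteSpace E] (h : IsCoordinateOn I F U)
    (hx : x ∈ U) {f : X → ℝ} (hf : MDifferentiableAt I 𝓘(ℝ, ℝ) f x) (e : E)
    (u : TangentSpace I x) :
    mvfderiv I F x (cov (f • coordField I F e) x u) =
      f x • mvfderiv I F x (cov (coordField I F e) x u) + mvfderiv I f x u • e := by
  rw [cov.isCovariantDerivativeOn.leibniz
    ((h.isSmoothVectorFieldOn_coordField e).mdifferentiableAt h.isOpen hx) hf]
  simp only [add_apply, smul_apply, smulRight_apply, map_add, map_smul, h.mvfderiv_coordField hx e]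

variable [FiniteDimensional ℝ E]

/-- The Christoffel symbols `Γ u v` of the connection in the coordinates `F`: the components of
the derivative in the direction of `u` of the coordinate field of `v`. The expansion in a basis
makes the linearity in `v` manifest. -/
def christoffel (cov : CovariantDerivative I E (TangentSpace I : X → Type _)) (F : X → E) (x : X) :
    E →L[ℝ] E →L[ℝ] E :=
  (∑ i, (LinearMap.toContinuousLinearMap ((Module.finBasis ℝ E).coord i)).smulRight
    (mvfderiv I F x ∘L cov (coordField I F (Module.finBasis ℝ E i)) x ∘L
      (mvfderiv I F x).inverse : E →L[ℝ] E)).flip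

theorem christoffel_apply_eq_sum (u v : E) : christoffel cov F x u v =
    ∑ i, (Module.finBasis ℝ E).repr v i •
      mvfderiv I F x (cov (coordField I F (Module.finBasis ℝ E i)) x (coordField I F u x)) := by
  simp [christoffel, coordField, sum_apply]

namespace IsCoordinateOn

theorem mvfderiv_cov (h : IsCoordinateOn I F U) {Y : Π x : X, TangentSpace I x}
    (hY : IsSmoothVectorFieldOn I Y U) (hx : x ∈ U) (u : TangentSpace I x) :
    mvfderiv I F x (cov Y x u) = mvfderiv I (fun y ↦ mvfderiv I F y (Y y)) x u +
      christoffel cov F x (mvfderiv I F x u) (mvfderiv I F x (Y x)) := by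
  let b := Module.finBasis ℝ E
  let c (i) : E →L[ℝ] ℝ := LinearMap.toContinuousLinearMap (b.coord i)
  let Y' : X → E := fun y ↦ mvfderiv I F y (Y y)
  have hY' : MDifferentiableAt I 𝓘(ℝ, E) Y' x := h.mdifferentiableAt_mvfderiv_apply hY hx
  have hcY' (i) : MDifferentiableAt I 𝓘(ℝ, ℝ) (c i ∘ Y') x :=
    (c i).mdifferentiableAt.comp x hY'
  have hb (i) := (h.isSmoothVectorFieldOn_coordField (b i)).mdifferentiableAt h.isOpen hx
  have hexpand : ∀ᶠ y in 𝓝 x, (∑ i, ((c i ∘ Y') • coordField I F (b i)) y) = Y y := by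
    filter_upwards [h.isOpen.mem_nhds hx] with y hy using h.sum_repr_smul_coordField hy b (Y y)
  rw [← (hY.cov_congr h.isOpen hx hexpand).self_of_nhds,
    cov_sum fun i _ ↦ (hcY' i).smul_section (hb i), sum_apply, map_sum]
  simp only [h.mvfderiv_cov_smul_coordField hx (hcY' _)]
  rw [Finset.sum_add_distrib, christoffel_apply_eq_sum, h.coordField_mvfderiv hx, add_comm]
  refine congrArg (· + _) ?_
  have hder (i) : mvfderiv I (c i ∘ Y') x u = b.repr (mvfderiv I Y' x u) i :=
    mvfderiv_clm_comp hY' (c i) u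
  simp only [hder]
  exact b.sum_repr _

theorem christoffel_apply (h : IsCoordinateOn I F U) (hx : x ∈ U) (u v : E) :
    christoffel cov F x u v = mvfderiv I F x (cov (coordField I F v) x (coordField I F u x)) := by
  rw [h.mvfderiv_cov (h.isSmoothVectorFieldOn_coordField v) hx,
    mvfderiv_eq_zero_of_eventuallyEq_const (h.eventually_mvfderiv_coordField hx v),
    h.mvfderiv_coordField hx, h.mvfderiv_coordField hx, zero_add]

theorem cov_coordField_symm [I.Boundaryless] (h : IsCoordinateOn I F U)
    (htor : cov.torsion = 0) (hx : x ∈ U) (u v : E) :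
    cov (coordField I F v) x (coordField I F u x) =
      cov (coordField I F u) x (coordField I F v x) := by
  have htor_apply := cov.torsion_eq_zero_iff.1 htor
    ((h.isSmoothVectorFieldOn_coordField u).mdifferentiableAt h.isOpen hx)
    ((h.isSmoothVectorFieldOn_coordField v).mdifferentiableAt h.isOpen hx)
  rw [h.mlieBracket_coordField hx] at htor_apply
  exact sub_eq_zero.1 htor_apply

theorem christoffel_symm [I.Boundaryless] (h : IsCoordinateOn I F U) (htor : cov.torsion = 0)
    (hx : x ∈ U) (u v : E) : christoffel cov F x u v = christoffel cov F x v u := by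
  rw [h.christoffel_apply hx, h.christoffel_apply hx, h.cov_coordField_symm htor hx]

variable [T2Space X]

theorem contMDiffOn_christoffel_apply (h : IsCoordinateOn I F U)
    (hcov : CovariantDerivative.ContMDiffCovariantDerivative cov ∞) (u v : E) :
    ContMDiffOn I 𝓘(ℝ, E) ∞ (fun x ↦ christoffel cov F x u v) U :=
  (h.contMDiffOn_mvfderiv_apply ((h.isSmoothVectorFieldOn_coordField v).cov_apply hcov h.isOpen
    (h.isSmoothVectorFieldOn_coordField u))).congr fun _ hx ↦ h.christoffel_apply hx u v

variable [I.Boundaryless]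

theorem christoffel_flat (h : IsCoordinateOn I F U)
    (hcov : CovariantDerivative.ContMDiffCovariantDerivative cov ∞) (hflat : IsFlatConnection cov)
    (hx : x ∈ U) (u v w : E) :
    mvfderiv I (fun y ↦ christoffel cov F y v w) x (coordField I F u x) +
        christoffel cov F x u (christoffel cov F x v w) =
      mvfderiv I (fun y ↦ christoffel cov F y u w) x (coordField I F v x) +
        christoffel cov F x v (christoffel cov F x u w) := by
  have hsmooth (e : E) := h.isSmoothVectorFieldOn_coordField e
  have hsecond (u v : E) :
      mvfderiv I F x (cov (fun y ↦ cov (coordField I F w) y (coordField I F v y)) x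
          (coordField I F u x)) =
        mvfderiv I (fun y ↦ christoffel cov F y v w) x (coordField I F u x) +
          christoffel cov F x u (christoffel cov F x v w) := by
    rw [h.mvfderiv_cov ((hsmooth w).cov_apply hcov h.isOpen (hsmooth v)) hx,
      h.mvfderiv_coordField hx, ← h.christoffel_apply hx]
    refine congrArg (· + _) (mvfderiv_congr ?_ _)
    filter_upwards [h.isOpen.mem_nhds hx] with y hy using (h.christoffel_apply hy v w).symm
  have hcurv := hflat.apply_of_smoothOn hcov h.isOpen (hsmooth u) (hsmooth v) (hsmooth w) hx
  rw [h.mlieBracket_coordField hx, map_zero, sub_zero, sub_eq_zero] at hcurv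
  rw [← hsecond, ← hsecond, hcurv]

theorem endInCoord_symmetric (h : IsCoordinateOn I F U) {A : EndField I X}
    (hA : IsSmoothEndField I A) (htor : cov.torsion = 0) (hsymm : HasSymmetricDeriv cov A)
    (hx : x ∈ U) (u v : E) :
    mvfderiv I (fun y ↦ endInCoord F A y v) x (coordField I F u x) +
        christoffel cov F x u (endInCoord F A x v) =
      mvfderiv I (fun y ↦ endInCoord F A y u) x (coordField I F v x) +
        christoffel cov F x v (endInCoord F A x u) := by
  have hsmooth (e : E) := h.isSmoothVectorFieldOn_coordField e
  have hcovA (u v : E) :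
      mvfderiv I F x (cov (fun y ↦ A y (coordField I F v y)) x (coordField I F u x)) =
        mvfderiv I (fun y ↦ endInCoord F A y v) x (coordField I F u x) +
          christoffel cov F x u (endInCoord F A x v) := by
    rw [h.mvfderiv_cov ((hsmooth v).endField_apply hA) hx, h.mvfderiv_coordField hx]
    rfl
  have hsymm_apply := hsymm.apply_of_smoothOn hA h.isOpen (hsmooth u) (hsmooth v) hx
  rw [h.cov_coordField_symm htor hx u v, sub_left_inj] at hsymm_apply
  rw [← hcovA, ← hcovA, hsymm_apply]

end IsCoordinateOn

end Christoffel

section AffineCoordinates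

open Set ContinuousLinearMap

variable {E : Type*} [NormedAddCommGroup E] [NormedSpace ℝ E]
  {H : Type*} [TopologicalSpace H] {I : ModelWithCorners ℝ E H}
  {X : Type*} [TopologicalSpace X] [ChartedSpace H X] [IsManifold I ∞ X]
  {V : Type*} [NormedAddCommGroup V] [NormedSpace ℝ V]
  {W : Type*} [NormedAddCommGroup W] [NormedSpace ℝ W]

theorem isCoordinateOn_extChartAt (x₀ : X) :
    IsCoordinateOn I (extChartAt I x₀) (extChartAt I x₀).source where
  isOpen := isOpen_extChartAt_source x₀
  contMDiffOn := by
    rw [extChartAt_source]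
    exact contMDiffOn_extChartAt
  isInvertible _ := isInvertible_mfderiv_extChartAt

theorem contDiffOn_comp_extChartAt_symm {f : X → V} {x₀ : X}
    (hf : ContMDiffOn I 𝓘(ℝ, V) ∞ f (extChartAt I x₀).source) :
    ContDiffOn ℝ ∞ (f ∘ (extChartAt I x₀).symm) (extChartAt I x₀).target :=
  contMDiffOn_iff_contDiffOn.1
    (hf.comp (contMDiffOn_extChartAt_symm x₀) (extChartAt I x₀).mapsTo_symm)

theorem mvfderiv_comp_extChartAt {f : E → V} {x₀ x : X} (hx : x ∈ (extChartAt I x₀).source)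
    (hf : DifferentiableAt ℝ f (extChartAt I x₀ x)) :
    mvfderiv I (f ∘ extChartAt I x₀) x =
      fderiv ℝ f (extChartAt I x₀ x) ∘L mvfderiv I (extChartAt I x₀) x :=
  (hf.hasFDerivAt.hasMFDerivAt.comp x
    (((isCoordinateOn_extChartAt x₀).contMDiffAt hx).mdifferentiableAt
      (by simp)).hasMFDerivAt).mfderiv

theorem IsCoordinateOn.comp_extChartAt {x₀ : X} {χ : E → E} {s : Set E} (hs : IsOpen s)
    (hχ : ContDiffOn ℝ ∞ χ s) (hinv : ∀ z ∈ s, IsUnit (fderiv ℝ χ z)) :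
    IsCoordinateOn I (χ ∘ extChartAt I x₀) ((extChartAt I x₀).source ∩ extChartAt I x₀ ⁻¹' s) where
  isOpen := (continuousOn_extChartAt x₀).isOpen_inter_preimage (isOpen_extChartAt_source x₀) hs
  contMDiffOn := hχ.contMDiffOn.comp
    ((isCoordinateOn_extChartAt x₀).contMDiffOn.mono inter_subset_left) fun _ hx ↦ hx.2
  isInvertible x hx := by
    rw [mvfderiv_comp_extChartAt hx.1 ((hχ.contDiffAt (hs.mem_nhds hx.2)).differentiableAt
      (by simp))]
    obtain ⟨e, he⟩ := hinv _ hx.2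
    exact IsInvertible.comp ⟨ContinuousLinearEquiv.unitsEquiv ℝ E e, by rw [← he]; rfl⟩
      ((isCoordinateOn_extChartAt x₀).isInvertible x hx.1)

theorem clm_fderiv_comp_extChartAt_symm {f : X → V} {x₀ x : X}
    (hx : x ∈ (extChartAt I x₀).source)
    (hf : DifferentiableAt ℝ (f ∘ (extChartAt I x₀).symm) (extChartAt I x₀ x)) (L : V →L[ℝ] W)
    (u : E) :
    L (fderiv ℝ (f ∘ (extChartAt I x₀).symm) (extChartAt I x₀ x) u) =
      mvfderiv I (fun y ↦ L (f y)) x (coordField I (extChartAt I x₀) u x) := by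
  have hcomp : (fun y ↦ L (f y)) =ᶠ[𝓝 x]
      (L ∘ f ∘ (extChartAt I x₀).symm) ∘ extChartAt I x₀ := by
    filter_upwards [(isOpen_extChartAt_source x₀).mem_nhds hx] with y hy
    exact congrArg (L ∘ f) ((extChartAt I x₀).left_inv hy).symm
  rw [mvfderiv_congr hcomp, mvfderiv_comp_extChartAt hx (L.differentiableAt.comp _ hf),
    fderiv_comp _ L.differentiableAt hf, L.fderiv, comp_apply,
    (isCoordinateOn_extChartAt x₀).mvfderiv_coordField hx]
  rfl

section Boundaryless

variable [I.Boundaryless]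

theorem eventually_eq_of_mvfderiv_eq_zero {f : X → V} {x₀ : X}
    (hf : ∀ᶠ x in 𝓝 x₀, MDifferentiableAt I 𝓘(ℝ, V) f x ∧ mvfderiv I f x = 0) :
    ∀ᶠ x in 𝓝 x₀, f x = f x₀ := by
  let κ := extChartAt I x₀
  have hκ : κ.symm (κ x₀) = x₀ := extChartAt_to_inv x₀
  have hsymm := (continuousAt_extChartAt_symm (I := I) x₀).eventually (hκ.symm ▸ hf)
  obtain ⟨ρ, hρ, hball⟩ := Metric.eventually_nhds_iff_ball.1
    (hsymm.and (extChartAt_target_mem_nhds (I := I) x₀))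
  have hfderiv {z : E} (hz : z ∈ Metric.ball (κ x₀) ρ) :
      HasFDerivAt (f ∘ κ.symm) (0 : E →L[ℝ] V) z := by
    obtain ⟨⟨hfz, hfz'⟩, hztar⟩ := hball z hz
    have hcomp := (hfz.hasMFDerivAt.comp z ((contMDiffAt_extChartAt_symm hztar).mdifferentiableAt
      (by simp)).hasMFDerivAt).hasFDerivAt
    rw [show mfderiv I 𝓘(ℝ, V) f (κ.symm z) = 0 from hfz'] at hcomp
    exact hcomp
  filter_upwards [extChartAt_source_mem_nhds (I := I) x₀,
    continuousAt_extChartAt (I := I) x₀ (Metric.ball_mem_nhds _ hρ)] with x hx hxρ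
  have hconst := Metric.isOpen_ball.is_const_of_fderiv_eq_zero (𝕜 := ℝ) (f := f ∘ κ.symm)
    (convex_ball (κ x₀) ρ).isPreconnected
    (fun z hz ↦ (hfderiv hz).differentiableAt.differentiableWithinAt)
    (fun z hz ↦ (hfderiv hz).fderiv) hxρ (Metric.mem_ball_self hρ)
  exact (congrArg f (κ.left_inv hx)).symm.trans (hconst.trans (congrArg f hκ))

theorem eq_of_mvfderiv_eq_zero {f : X → V} {U : Set X} (hU : IsOpen U) (hUc : IsPreconnected U)
    (hf : ∀ x ∈ U, MDifferentiableAt I 𝓘(ℝ, V) f x) (hf' : ∀ x ∈ U, mvfderiv I f x = 0)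
    {x y : X} (hx : x ∈ U) (hy : y ∈ U) : f x = f y := by
  refine hUc.induction₂ (fun x y ↦ f x = f y) (fun x hx ↦ ?_)
    (fun _ _ _ _ _ _ ↦ Eq.trans) (fun _ _ _ _ ↦ Eq.symm) hx hy
  refine nhdsWithin_le_nhds ((eventually_eq_of_mvfderiv_eq_zero (I := I) (f := f) ?_).mono
    fun _ ↦ Eq.symm)
  filter_upwards [hU.mem_nhds hx] with y hy using ⟨hf y hy, hf' y hy⟩

end Boundaryless

variable [FiniteDimensional ℝ E] {cov : CovariantDerivative I E (TangentSpace I : X → Type _)}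

theorem cov_coordField_eq_zero_of_parallel {κ χ : X → E} {U : Set X}
    (hκ : IsCoordinateOn I κ U) (hχ : IsCoordinateOn I χ U) {G : X → E →L[ℝ] E}
    (hχκ : ∀ y ∈ U, ∀ v : TangentSpace I y, mvfderiv I χ y v = G y (mvfderiv I κ y v))
    {x : X} (hx : x ∈ U) (hG : MDifferentiableAt I 𝓘(ℝ, E →L[ℝ] E) G x)
    (hparallel : ∀ (u : TangentSpace I x) (w : E),
      mvfderiv I G x u w = G x (christoffel cov κ x (mvfderiv I κ x u) w)) (e : E) :
    cov (coordField I χ e) x = 0 := by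
  ext u
  apply hχ.injective hx
  have hfield := hχ.isSmoothVectorFieldOn_coordField e
  have hconst : ∀ᶠ y in 𝓝 x, G y (mvfderiv I κ y (coordField I χ e y)) = e := by
    filter_upwards [hχ.isOpen.mem_nhds hx] with y hy
    rw [← hχκ y hy, hχ.mvfderiv_coordField hy]
  have hleibniz := mvfderiv_bilin hG (hκ.mdifferentiableAt_mvfderiv_apply hfield hx)
    (ContinuousLinearMap.id ℝ (E →L[ℝ] E)) u
  rw [hχκ x hx, hκ.mvfderiv_cov hfield hx, map_add, ← hparallel, add_comm]
  exact hleibniz.symm.trans ((mvfderiv_eq_zero_of_eventuallyEq_const hconst u).trans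
    (map_zero (mvfderiv I χ x)).symm)

variable [I.Boundaryless] [T2Space X]

set_option synthInstance.maxHeartbeats 200000 in
theorem exists_affine_coordinates_in_chart {A : EndField I X} (hA : IsSmoothEndField I A)
    (hcov : CovariantDerivative.ContMDiffCovariantDerivative cov ∞) (htor : cov.torsion = 0)
    (hflat : IsFlatConnection cov) (hsymm : HasSymmetricDeriv cov A) (x₀ : X) :
    ∃ ρ > 0, Metric.ball (extChartAt I x₀ x₀) ρ ⊆ (extChartAt I x₀).target ∧
      ∃ (G : E → E →L[ℝ] E) (χ φ : E → E),
        let B := Metric.ball (extChartAt I x₀ x₀) ρ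
        let κ := extChartAt I x₀
        ContDiffOn ℝ ∞ G B ∧ ContDiffOn ℝ ∞ χ B ∧ ContDiffOn ℝ ∞ φ B ∧
          (∀ z ∈ B, IsUnit (G z)) ∧ (∀ z ∈ B, HasFDerivAt χ (G z) z) ∧
          ∀ x ∈ κ.source, κ x ∈ B →
            (∀ u, fderiv ℝ G (κ x) u = G (κ x) ∘L christoffel cov κ x u) ∧
              HasFDerivAt φ (G (κ x) ∘L endInCoord κ A x) (κ x) := by
  set κ := extChartAt I x₀
  have hκ : IsCoordinateOn I κ κ.source := isCoordinateOn_extChartAt x₀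
  let Γ : E → E →L[ℝ] E →L[ℝ] E := christoffel cov κ ∘ κ.symm
  let T : E → E →L[ℝ] E := endInCoord κ A ∘ κ.symm
  have hΓκ {x : X} (hx : x ∈ κ.source) : Γ (κ x) = christoffel cov κ x :=
    congrArg (christoffel cov κ) (κ.left_inv hx)
  have hTκ {x : X} (hx : x ∈ κ.source) : T (κ x) = endInCoord κ A x :=
    congrArg (endInCoord κ A) (κ.left_inv hx)
  have htar : IsOpen κ.target := isOpen_extChartAt_target x₀
  have hΓ : ContDiffOn ℝ ∞ Γ κ.target :=
    contDiffOn_clm_apply.2 fun u ↦ contDiffOn_clm_apply.2 fun v ↦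
      contDiffOn_comp_extChartAt_symm (hκ.contMDiffOn_christoffel_apply hcov u v)
  have hT : ContDiffOn ℝ ∞ T κ.target := contDiffOn_clm_apply.2 fun v ↦
    contDiffOn_comp_extChartAt_symm (hκ.contMDiffOn_endInCoord_apply hA v)
  have hΓd {x : X} (hx : x ∈ κ.source) (u v w : E) : fderiv ℝ Γ (κ x) u v w =
      mvfderiv I (fun y ↦ christoffel cov κ y v w) x (coordField I κ u x) :=
    clm_fderiv_comp_extChartAt_symm hx
      ((hΓ.contDiffAt (htar.mem_nhds (κ.map_source hx))).differentiableAt (by simp))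
      ((apply ℝ E w).comp (apply ℝ (E →L[ℝ] E) v)) u
  have hTd {x : X} (hx : x ∈ κ.source) (u v : E) : fderiv ℝ T (κ x) u v =
      mvfderiv I (fun y ↦ endInCoord κ A y v) x (coordField I κ u x) :=
    clm_fderiv_comp_extChartAt_symm hx
      ((hT.contDiffAt (htar.mem_nhds (κ.map_source hx))).differentiableAt (by simp))
      (apply ℝ E v) u
  have of_source {P : E → Prop} (h : ∀ x ∈ κ.source, P (κ x)) (z : E) (hz : z ∈ κ.target) : P z :=
    κ.right_inv hz ▸ h _ (κ.map_target hz)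
  obtain ⟨ρ, hρ, hball, G, χ, φ, hG, hχ, hφ, hunit, hGd, hχd, hφd⟩ :=
    exists_affine_coordinates htar (κ.map_source (mem_extChartAt_source x₀)) hΓ hT
      (of_source fun x hx u v ↦ by rw [hΓκ hx, hκ.christoffel_symm htor hx])
      (of_source fun x hx u v w ↦ by
        rw [hΓd hx, hΓd hx, hΓκ hx, hκ.christoffel_flat hcov hflat hx])
      (of_source fun x hx u v ↦ by
        rw [hTd hx, hTd hx, hΓκ hx, hTκ hx, hκ.endInCoord_symmetric hA htor hsymm hx])
  exact ⟨ρ, hρ, hball, G, χ, φ, hG, hχ, hφ, hunit, hχd, fun x hx hxB ↦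
    ⟨hΓκ hx ▸ hGd _ hxB, hTκ hx ▸ hφd _ hxB⟩⟩

theorem exists_affine_coordinates_of_flat {A : EndField I X} (hA : IsSmoothEndField I A)
    (hcov : CovariantDerivative.ContMDiffCovariantDerivative cov ∞) (htor : cov.torsion = 0)
    (hflat : IsFlatConnection cov) (hsymm : HasSymmetricDeriv cov A) (x₀ : X) :
    ∃ (U : Set X) (χ φ : X → E), x₀ ∈ U ∧ IsPreconnected U ∧ IsCoordinateOn I χ U ∧
      ContMDiffOn I 𝓘(ℝ, E) ∞ φ U ∧
      (∀ x ∈ U, ∀ v : TangentSpace I x, mvfderiv I φ x v = mvfderiv I χ x (A x v)) ∧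
      ∀ x ∈ U, ∀ e, cov (coordField I χ e) x = 0 := by
  obtain ⟨ρ, hρ, hball, G, χ, φ, hG, hχ, hφ, hunit, hχd, hκd⟩ :=
    exists_affine_coordinates_in_chart hA hcov htor hflat hsymm x₀
  set κ := extChartAt I x₀
  let U := κ.source ∩ κ ⁻¹' Metric.ball (κ x₀) ρ
  have hUc : IsPreconnected U := by
    rw [show U = κ.symm '' Metric.ball (κ x₀) ρ from
      (κ.symm_image_eq_source_inter_preimage hball).symm]
    exact (convex_ball _ _).isPreconnected.image _ ((continuousOn_extChartAt_symm x₀).mono hball)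
  have hχU : IsCoordinateOn I (χ ∘ κ) U := .comp_extChartAt Metric.isOpen_ball hχ fun z hz ↦
    (hχd z hz).fderiv ▸ hunit z hz
  have hκU : IsCoordinateOn I κ U :=
    (isCoordinateOn_extChartAt x₀).mono hχU.isOpen inter_subset_left
  have hdχ (x : X) (hx : x ∈ U) (v : TangentSpace I x) :
      mvfderiv I (χ ∘ κ) x v = G (κ x) (mvfderiv I κ x v) := by
    rw [mvfderiv_comp_extChartAt hx.1 (hχd _ hx.2).differentiableAt, (hχd _ hx.2).fderiv]
    rfl
  refine ⟨U, χ ∘ κ, φ ∘ κ, ⟨mem_extChartAt_source x₀, Metric.mem_ball_self hρ⟩, hUc, hχU,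
    hφ.contMDiffOn.comp hκU.contMDiffOn fun _ hx ↦ hx.2, fun x hx v ↦ ?_, fun x hx ↦ ?_⟩
  · rw [mvfderiv_comp_extChartAt hx.1 (hκd x hx.1 hx.2).2.differentiableAt,
      (hκd x hx.1 hx.2).2.fderiv, hdχ x hx, comp_apply, comp_apply]
    exact congrArg (G (κ x)) (hκU.endInCoord_mvfderiv hx A v)
  · have hGx : DifferentiableAt ℝ G (κ x) :=
      (hG.contDiffAt (Metric.isOpen_ball.mem_nhds hx.2)).differentiableAt (by simp)
    refine cov_coordField_eq_zero_of_parallel hκU hχU hdχ hx (G := G ∘ κ)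
      (hGx.mdifferentiableAt.comp x ((hκU.contMDiffAt hx).mdifferentiableAt (by simp)))
      fun u w ↦ ?_
    rw [mvfderiv_comp_extChartAt hx.1 hGx, comp_apply, (hκd x hx.1 hx.2).1]
    rfl

end AffineCoordinates

section SpecialCoordinates

open Set ContinuousLinearMap

variable {E : Type*} [NormedAddCommGroup E] [NormedSpace ℝ E]
  {H : Type*} [TopologicalSpace H] {I : ModelWithCorners ℝ E H}
  {X : Type*} [TopologicalSpace X] [ChartedSpace H X]
  {U : Set X} {χ φ : X → E}

theorem IsCoordinateOn.endInCoord_endInCoord (h : IsCoordinateOn I χ U) {x : X} (hx : x ∈ U)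
    {A : EndField I X} (hA : ∀ v : TangentSpace I x, A x (A x v) = v) (e : E) :
    endInCoord χ A x (endInCoord χ A x e) = e := by
  conv_lhs => rw [← h.mvfderiv_coordField hx e]
  rw [h.endInCoord_mvfderiv hx, h.endInCoord_mvfderiv hx, hA, h.mvfderiv_coordField hx]

variable [IsManifold I ∞ X]

/-- If `A₀` is the matrix of `A` at a point, then `dΨ = (dχ + A₀ ∘ dχ ∘ A) / 2` intertwines `A` and
`A₀` for the map `Ψ = (χ + A₀ φ) / 2`, and `dΨ = dχ` at that point. -/
theorem IsCoordinateOn.exists_isConstantIn_of_involutive [I.Boundaryless] [CompleteSpace E]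
    (hχ : IsCoordinateOn I χ U) (hφ : ContMDiffOn I 𝓘(ℝ, E) ∞ φ U) {A : EndField I X}
    (hφχ : ∀ x ∈ U, ∀ v : TangentSpace I x, mvfderiv I φ x v = mvfderiv I χ x (A x v))
    (hA : ∀ (x : X) (v : TangentSpace I x), A x (A x v) = v) {x₀ : X} (hx₀ : x₀ ∈ U) :
    ∃ V Ψ c, x₀ ∈ V ∧ IsConstantIn A V Ψ c := by
  let A₀ : E →L[ℝ] E := endInCoord χ A x₀
  let L : E × E →L[ℝ] E := (1 / 2 : ℝ) • (fst ℝ E E + A₀ ∘L snd ℝ E E)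
  let Ψ : X → E := fun x ↦ L (χ x, φ x)
  have hΨ : ContMDiffOn I 𝓘(ℝ, E) ∞ Ψ U :=
    L.contMDiff.comp_contMDiffOn (hχ.contMDiffOn.prodMk_space hφ)
  have hdΨ {x : X} (hx : x ∈ U) (v : TangentSpace I x) : mvfderiv I Ψ x v =
      (1 / 2 : ℝ) • (mvfderiv I χ x v + A₀ (mvfderiv I χ x (A x v))) := by
    have hχx := (hχ.contMDiffAt hx).mdifferentiableAt (by simp)
    have hφx := (hφ.contMDiffAt (hχ.isOpen.mem_nhds hx)).mdifferentiableAt (by simp)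
    rw [mvfderiv_clm_comp (hasMFDerivAt_prodMk_space hχx hφx).mdifferentiableAt,
      mvfderiv_prodMk hχx hφx, hφχ x hx]
    rfl
  have hdΨ₀ : mvfderiv I Ψ x₀ = mvfderiv I χ x₀ := by
    ext v
    rw [hdΨ hx₀, hχ.endInCoord_mvfderiv hx₀, hA, ← two_smul ℝ, smul_smul]
    norm_num
  obtain ⟨ψ, hψ, hx₀ψ, hsub, hψΨ⟩ := exists_chart_of_isInvertible_mfderiv hχ.isOpen hx₀ hΨ
    (hdΨ₀ ▸ hχ.isInvertible x₀ hx₀)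
  refine ⟨ψ.source, Ψ, A₀, hx₀ψ, ⟨ψ.open_source, hΨ.mono hsub, fun x hx ↦ ?_⟩, fun x hx v ↦ ?_⟩
  · have hψx : (ψ.extend I : X → E) =ᶠ[𝓝 x] Ψ := by
      filter_upwards [ψ.open_source.mem_nhds hx] using hψΨ
    exact ContinuousLinearMap.ext (mvfderiv_congr (I := I) hψx) ▸
      isInvertible_mfderiv_extend hψ hx
  · rw [hdΨ (hsub hx), hdΨ (hsub hx), hA, map_smul, map_add,
      hχ.endInCoord_endInCoord hx₀ (hA x₀), add_comm]

variable [FiniteDimensional ℝ E] {J : EndField I X} {g : BilinField I X}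
  {cov : CovariantDerivative I E (TangentSpace I : X → Type _)}

/-- Special coordinates on `U`: affine coordinates `χ` in which the form `g (J ·, ·)` is the
constant form `c`, together with the conjugate map `φ`, for which `dφ = dχ ∘ J`. -/
structure IsSpecialCoordinateOn (J : EndField I X) (g : BilinField I X)
    (cov : CovariantDerivative I E (TangentSpace I : X → Type _)) (U : Set X) (χ φ : X → E)
    (c : E →L[ℝ] E →L[ℝ] ℝ) : Prop extends IsCoordinateOn I χ U where
  contMDiffOn_conj : ContMDiffOn I 𝓘(ℝ, E) ∞ φ U
  mvfderiv_conj : ∀ x ∈ U, ∀ v : TangentSpace I x, mvfderiv I φ x v = mvfderiv I χ x (J x v)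
  cov_coordField : ∀ x ∈ U, ∀ e, cov (coordField I χ e) x = 0
  fundForm_eq : ∀ x ∈ U, ∀ v w : TangentSpace I x,
    fundForm I J g x v w = c (mvfderiv I χ x v) (mvfderiv I χ x w)

variable [I.Boundaryless] [T2Space X]

theorem IsParallelForm.apply_coordField_eq {b : BilinField I X} (hb : IsParallelForm cov b)
    (hbs : IsSmoothBilinField I b) (hU : IsPreconnected U) (hχ : IsCoordinateOn I χ U)
    (hcov : ∀ x ∈ U, ∀ e, cov (coordField I χ e) x = 0) {x y : X} (hx : x ∈ U) (hy : y ∈ U)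
    (e f : E) : b x (coordField I χ e x) (coordField I χ f x) =
      b y (coordField I χ e y) (coordField I χ f y) := by
  have hfield := hχ.isSmoothVectorFieldOn_coordField
  have hsmooth := (hfield e).bilinField_apply (hfield f) hbs
  refine eq_of_mvfderiv_eq_zero hχ.isOpen hU
    (fun z hz ↦ (hsmooth.contMDiffAt (hχ.isOpen.mem_nhds hz)).mdifferentiableAt (by simp))
    (fun z hz ↦ ContinuousLinearMap.ext fun u ↦ ?_) hx hy
  have hparallel := hb.apply_of_smoothOn hχ.isOpen (hfield (mvfderiv I χ z u)) (hfield e)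
    (hfield f) hz
  rw [hcov z hz, hcov z hz, hχ.coordField_mvfderiv hz] at hparallel
  simpa using hparallel

theorem IsSpecialParaKahler.exists_isSpecialCoordinateOn (h : IsSpecialParaKahler J g cov)
    (x₀ : X) : ∃ U χ φ c, x₀ ∈ U ∧ IsSpecialCoordinateOn J g cov U χ φ c := by
  have hJ : IsSmoothEndField I J := h.paraKahler.paraComplex.smooth
  obtain ⟨U, χ, φ, hx₀, hU, hχ, hφ, hφχ, hcov⟩ :=
    exists_affine_coordinates_of_flat hJ h.smooth_cov h.torsionFree h.flat h.symmetric x₀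
  let L : E →L[ℝ] E := (mvfderiv I χ x₀).inverse
  let b : E →L[ℝ] E →L[ℝ] ℝ := fundForm I J g x₀
  refine ⟨U, χ, φ, b.bilinearComp L L, hx₀, ⟨hχ, hφ, hφχ, hcov, fun x hx v w ↦ ?_⟩⟩
  conv_lhs => rw [← hχ.coordField_mvfderiv hx v, ← hχ.coordField_mvfderiv hx w]
  exact h.symplectic.apply_coordField_eq (h.paraKahler.metric.smooth.comp_endField hJ) hU hχ hcov
    hx hx₀ _ _

theorem IsConstantIn.cov_coordField {Ψ : X → E} {J₀ : E →L[ℝ] E} (h : IsConstantIn J U Ψ J₀)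
    (hJ : IsSmoothEndField I J) (htor : cov.torsion = 0) (hsymm : HasSymmetricDeriv cov J) {x : X}
    (hx : x ∈ U) (e : E) (v : TangentSpace I x) :
    cov (coordField I Ψ (J₀ e)) x v = cov (coordField I Ψ e) x (J x v) := by
  have hfield := h.isSmoothVectorFieldOn_coordField
  have hJfield (e : E) (y : X) (hy : y ∈ U) :
      J y (coordField I Ψ e y) = coordField I Ψ (J₀ e) y := by
    apply h.injective hy
    rw [h.mvfderiv_coordField hy, h.mvfderiv_apply y hy, h.mvfderiv_coordField hy]
  have hcov (e : E) : cov (fun y ↦ J y (coordField I Ψ e y)) x = cov (coordField I Ψ (J₀ e)) x := by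
    refine ((hfield (J₀ e)).cov_congr h.isOpen hx ?_).self_of_nhds
    filter_upwards [h.isOpen.mem_nhds hx] using hJfield e
  have hderiv := hsymm.apply_of_smoothOn hJ h.isOpen (hfield (mvfderiv I Ψ x v)) (hfield e) hx
  rwa [h.cov_coordField_symm htor hx, sub_left_inj, hcov, hcov,
    h.cov_coordField_symm htor hx e (J₀ (mvfderiv I Ψ x v)), ← hJfield _ x hx,
    h.coordField_mvfderiv hx] at hderiv

end SpecialCoordinates

section CotangentCoordinates

open Set ContinuousLinearMap

theorem isInvertible_of_injective_endo {V : Type*} [NormedAddCommGroup V]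
    [NormedSpace ℝ V] [FiniteDimensional ℝ V] {f : V →L[ℝ] V} (hf : Function.Injective f) :
    f.IsInvertible :=
  ⟨(LinearEquiv.ofInjectiveEndo f.toLinearMap hf).toContinuousLinearEquiv, by ext; rfl⟩

variable {E : Type*} [NormedAddCommGroup E] [NormedSpace ℝ E]
  {H : Type*} [TopologicalSpace H] {I : ModelWithCorners ℝ E H}
  {X : Type*} [TopologicalSpace X] [ChartedSpace H X] [IsManifold I ∞ X]
  {V : Type*} [NormedAddCommGroup V] [NormedSpace ℝ V]
  {F f : X → E} {U : Set X}

theorem mvfderiv_comp_proj {f : X → V} {ξ : CotangentBundle I X}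
    (hf : MDifferentiableAt I 𝓘(ℝ, V) f ξ.proj) (w : TangentSpace (cotModel I) ξ) :
    mvfderiv (cotModel I) (fun η : CotangentBundle I X ↦ f η.proj) ξ w =
      mvfderiv I f ξ.proj (cotProjDeriv ξ w) := by
  have hp : MDifferentiableAt (cotModel I) I (TotalSpace.proj : CotangentBundle I X → X) ξ :=
    mdifferentiableAt_proj _
  exact congr($(mfderiv_comp ξ hf hp) w)

theorem contMDiffAt_cotEval {Y : Π x : X, TangentSpace I x} {ξ : CotangentBundle I X}
    (hY : ContMDiffAt I I.tangent ∞ (fun p ↦ (⟨p, Y p⟩ : TangentBundle I X)) ξ.proj) :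
    ContMDiffAt (cotModel I) 𝓘(ℝ, ℝ) ∞ (cotEval Y) ξ := by
  have hcovector : ContMDiffAt (cotModel I) (I.prod 𝓘(ℝ, E →L[ℝ] ℝ)) ∞
      (fun η : CotangentBundle I X ↦ TotalSpace.mk' (E →L[ℝ] ℝ)
        (E := fun p : X ↦ TangentSpace I p →L[ℝ] Bundle.Trivial X ℝ p) η.proj η.snd) ξ :=
    contMDiffAt_id
  have hp : ContMDiffAt (cotModel I) I ∞ (TotalSpace.proj : CotangentBundle I X → X) ξ :=
    contMDiffAt_proj _
  have hvector : ContMDiffAt (cotModel I) (I.prod 𝓘(ℝ, E)) ∞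
      (fun η : CotangentBundle I X ↦ TotalSpace.mk' E
        (E := fun p : X ↦ TangentSpace I p) η.proj (Y η.proj)) ξ :=
    ContMDiffAt.comp ξ hY hp
  have hpairing := ContMDiffAt.clm_bundle_apply (F₁ := E) (F₂ := ℝ)
    (E₁ := fun p : X ↦ TangentSpace I p) (E₂ := Bundle.Trivial X ℝ)
    (b := fun η : CotangentBundle I X ↦ η.proj) (ϕ := fun η ↦ η.snd)
    (v := fun η ↦ Y η.proj) hcovector hvector
  rw [contMDiffAt_totalSpace] at hpairing
  exact hpairing.2

variable (I) in
/-- The momenta of the coordinates `F`: the fibre coordinates of the cotangent bundle dual to the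
coordinate fields of `F`. -/
def momentum (F : X → E) (ξ : CotangentBundle I X) : E →L[ℝ] ℝ :=
  ξ.snd ∘L (mvfderiv I F ξ.proj).inverse

theorem contMDiffAt_clm_of_apply [FiniteDimensional ℝ E] {Z H' N : Type*} [NormedAddCommGroup Z]
    [NormedSpace ℝ Z] [TopologicalSpace H'] {I' : ModelWithCorners ℝ Z H'} [TopologicalSpace N]
    [ChartedSpace H' N] {q : N → E →L[ℝ] V} {ξ : N}
    (hq : ∀ e, ContMDiffAt I' 𝓘(ℝ, V) ∞ (fun η ↦ q η e) ξ) :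
    ContMDiffAt I' 𝓘(ℝ, E →L[ℝ] V) ∞ q ξ := by
  let b := Module.finBasis ℝ E
  let S (i : Fin (Module.finrank ℝ E)) : V →L[ℝ] E →L[ℝ] V :=
    smulRightL ℝ E V (LinearMap.toContinuousLinearMap (b.coord i))
  have hqS : q = fun η ↦ ∑ i, S i (q η (b i)) := by
    funext η
    refine ContinuousLinearMap.coe_injective (b.ext fun j ↦ ?_)
    simp [S, Finsupp.single_apply]
  rw [hqS]
  exact ContMDiffAt.sum fun i _ ↦ (S i).contMDiff.contMDiffAt.comp ξ (hq (b i))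

variable [FiniteDimensional ℝ E]

theorem IsCoordinateOn.contMDiffAt_momentum (h : IsCoordinateOn I F U) {ξ : CotangentBundle I X}
    (hξ : ξ.proj ∈ U) : ContMDiffAt (cotModel I) 𝓘(ℝ, E →L[ℝ] ℝ) ∞ (momentum I F) ξ :=
  contMDiffAt_clm_of_apply fun e ↦
    contMDiffAt_cotEval ((h.isSmoothVectorFieldOn_coordField e).contMDiffAt h.isOpen hξ)

theorem IsCoordinateOn.mvfderiv_momentum
    (cov : CovariantDerivative I E (TangentSpace I : X → Type _)) (h : IsCoordinateOn I F U)
    {ξ : CotangentBundle I X} (hξ : ξ.proj ∈ U) (w : TangentSpace (cotModel I) ξ) (e : E) :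
    mvfderiv (cotModel I) (momentum I F) ξ w e = connector cov ξ w (coordField I F e ξ.proj) +
      ξ.snd (cov (coordField I F e) ξ.proj (cotProjDeriv ξ w)) := by
  rw [connector_apply cov ((h.isSmoothVectorFieldOn_coordField e).mdifferentiableAt h.isOpen hξ),
    sub_add_cancel]
  exact (mvfderiv_clm_comp ((h.contMDiffAt_momentum hξ).mdifferentiableAt (by simp))
    (ContinuousLinearMap.apply ℝ ℝ e) w).symm

/-- The coordinates of the cotangent bundle given by coordinates `f` of the base and the momenta of
possibly different coordinates `F` of the base. -/
def cotCoord (f F : X → E) (ξ : CotangentBundle I X) : E × (E →L[ℝ] ℝ) :=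
  (f ξ.proj, momentum I F ξ)

theorem IsCoordinateOn.mvfderiv_cotCoord (hf : IsCoordinateOn I f U) (hF : IsCoordinateOn I F U)
    {ξ : CotangentBundle I X} (hξ : ξ.proj ∈ U) (w : TangentSpace (cotModel I) ξ) :
    mvfderiv (cotModel I) (cotCoord f F) ξ w =
      (mvfderiv I f ξ.proj (cotProjDeriv ξ w), mvfderiv (cotModel I) (momentum I F) ξ w) := by
  have hfξ : MDifferentiableAt I 𝓘(ℝ, E) f ξ.proj :=
    (hf.contMDiffAt hξ).mdifferentiableAt (by simp)
  have hp : MDifferentiableAt (cotModel I) I (TotalSpace.proj : CotangentBundle I X → X) ξ :=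
    mdifferentiableAt_proj _
  rw [← mvfderiv_comp_proj hfξ]
  exact mvfderiv_prodMk (hfξ.comp ξ hp) ((hF.contMDiffAt_momentum hξ).mdifferentiableAt (by simp)) w

theorem IsCoordinateOn.cotCoord (cov : CovariantDerivative I E (TangentSpace I : X → Type _))
    (hf : IsCoordinateOn I f U) (hF : IsCoordinateOn I F U) :
    IsCoordinateOn (cotModel I) (cotCoord f F)
      ((TotalSpace.proj : CotangentBundle I X → X) ⁻¹' U) := by
  refine ⟨hf.isOpen.preimage (FiberBundle.continuous_proj _ _), fun ξ hξ ↦ ?_, fun ξ hξ ↦ ?_⟩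
  · have hp : ContMDiffAt (cotModel I) I ∞ (TotalSpace.proj : CotangentBundle I X → X) ξ :=
      contMDiffAt_proj _
    exact (((hf.contMDiffAt hξ).comp ξ hp).prodMk_space
      (hF.contMDiffAt_momentum hξ)).contMDiffWithinAt
  · refine isInvertible_of_injective_endo (V := E × (E →L[ℝ] ℝ)) ?_
    refine (injective_iff_map_eq_zero
      (mvfderiv (cotModel I) (_root_.cotCoord f F) ξ)).2 fun w hw ↦ ?_
    rw [hf.mvfderiv_cotCoord hF hξ] at hw
    have hbase : cotProjDeriv ξ w = 0 :=
      hf.injective hξ ((congrArg Prod.fst hw).trans (map_zero _).symm)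
    refine eq_zero_of_connector cov hbase (ContinuousLinearMap.ext fun v ↦ ?_)
    have hfibre := hF.mvfderiv_momentum cov hξ w (mvfderiv I F ξ.proj v)
    have hmomentum : mvfderiv (cotModel I) (momentum I F) ξ w = 0 := congrArg Prod.snd hw
    rw [hbase, map_zero, map_zero, add_zero, hF.coordField_mvfderiv hξ, hmomentum] at hfibre
    exact hfibre.symm

end CotangentCoordinates

section Anticommuting

open Set ContinuousLinearMap

variable {E : Type*} [NormedAddCommGroup E] [NormedSpace ℝ E]
  {H : Type*} [TopologicalSpace H] {I : ModelWithCorners ℝ E H}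
  {X : Type*} [TopologicalSpace X] [ChartedSpace H X]

theorem finrank_eigenPlus_eq_of_anticomm {A B : EndField I X} {x : X}
    (hB : ∀ v : TangentSpace I x, B x (B x v) = v)
    (hAB : ∀ v : TangentSpace I x, A x (B x v) = -B x (A x v)) :
    Module.finrank ℝ (eigenPlus I A x) = Module.finrank ℝ (eigenMinus I A x) := by
  let e : TangentSpace I x ≃ₗ[ℝ] TangentSpace I x := LinearEquiv.ofInvolutive (B x).toLinearMap hB
  have hp (v : TangentSpace I x) : v ∈ eigenPlus I A x ↔ v - A x v = 0 := Iff.rfl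
  have hm (v : TangentSpace I x) : v ∈ eigenMinus I A x ↔ v + A x v = 0 := Iff.rfl
  have h : (eigenPlus I A x).map e.toLinearMap = eigenMinus I A x := by
    ext v
    rw [hm]
    refine ⟨?_, fun hv ↦ ⟨B x v, ?_, hB v⟩⟩
    · rintro ⟨u, hu, rfl⟩
      have hu' := (hp u).1 hu
      change B x u + A x (B x u) = 0
      rw [hAB, ← sub_eq_add_neg, ← map_sub, hu', map_zero]
    · refine (hp _).2 ?_
      rw [hAB, sub_neg_eq_add, ← map_add, hv, map_zero]
  rw [← h]
  exact (LinearEquiv.finrank_map_eq e _).symm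

theorem isAlmostParaComplex_of_anticomm [IsManifold I ∞ X] {A B : EndField I X}
    (hAs : IsSmoothEndField I A) (hA : ∀ (x : X) (v : TangentSpace I x), A x (A x v) = v)
    (hB : ∀ (x : X) (v : TangentSpace I x), B x (B x v) = v)
    (hAB : ∀ (x : X) (v : TangentSpace I x), A x (B x v) = -B x (A x v))
    (hne : ∃ (x : X) (v : TangentSpace I x), v ≠ 0) : IsAlmostParaComplex I A where
  smooth := hAs
  ne_id := by
    rintro rfl
    obtain ⟨x, v, hv⟩ := hne
    refine hv ?_
    have : IsAddTorsionFree (TangentSpace I x) := .of_isTorsionFree ℝ _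
    have hBzero (u : TangentSpace I x) : B x u = 0 := self_eq_neg.1 (hAB x u)
    rw [← hB x v, hBzero]
  involution := hA
  rank_eq _ := finrank_eigenPlus_eq_of_anticomm (hB _) (hAB _)

theorem isSkewFor_of_fundForm_antisymm {A : EndField I X} {g : BilinField I X}
    (hg : ∀ (x : X) (v w : TangentSpace I x), g x v w = g x w v)
    (hA : ∀ (x : X) (v w : TangentSpace I x), fundForm I A g x v w = -fundForm I A g x w v) :
    IsSkewFor I A g := fun x v w ↦
  (hA x v w).trans (congrArg Neg.neg (hg x (A x w) v))

end Anticommuting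

section FibreAlgebra

open Set ContinuousLinearMap

theorem isInvertible_of_nondegenerate {V : Type*} [NormedAddCommGroup V]
    [NormedSpace ℝ V] [FiniteDimensional ℝ V] {b : V →L[ℝ] V →L[ℝ] ℝ}
    (hb : ∀ v, (∀ w, b v w = 0) → v = 0) : b.IsInvertible := by
  have hfin : Module.finrank ℝ V = Module.finrank ℝ (V →L[ℝ] ℝ) := by
    rw [← (LinearMap.toContinuousLinearMap : (V →ₗ[ℝ] ℝ) ≃ₗ[ℝ] (V →L[ℝ] ℝ)).finrank_eq]
    exact (Subspace.dual_finrank_eq (K := ℝ) (V := V)).symm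
  have hinj : Function.Injective b.toLinearMap := by
    refine (injective_iff_map_eq_zero b.toLinearMap).2 fun v hv ↦ hb v fun w ↦ ?_
    have : b v = 0 := hv
    rw [this, zero_apply]
  exact ⟨(LinearEquiv.ofInjectiveOfFinrankEq b.toLinearMap hinj hfin).toContinuousLinearEquiv, by
    ext; rfl⟩

variable {E : Type*} [NormedAddCommGroup E] [NormedSpace ℝ E]
  {H : Type*} [TopologicalSpace H] {I : ModelWithCorners ℝ E H}
  {X : Type*} [TopologicalSpace X] [ChartedSpace H X] [IsManifold I ∞ X]
  {J : EndField I X} {g : BilinField I X}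

namespace IsPseudoRiemannian

variable [FiniteDimensional ℝ E]

theorem isInvertible (hg : IsPseudoRiemannian I g) (x : X) : (g x).IsInvertible :=
  isInvertible_of_nondegenerate (V := E) (b := g x) (hg.nondegenerate x)

theorem inverse_apply (hg : IsPseudoRiemannian I g) {x : X} (a : TangentSpace I x →L[ℝ] ℝ)
    (w : TangentSpace I x) : g x ((g x).inverse a) w = a w :=
  congr($((hg.isInvertible x).self_apply_inverse a) w)

theorem inverse_eq (hg : IsPseudoRiemannian I g) {x : X} {a : TangentSpace I x →L[ℝ] ℝ}
    {v : TangentSpace I x} (hv : ∀ w, g x v w = a w) : (g x).inverse a = v := by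
  rw [← (hg.isInvertible x).inverse_apply_self v]
  exact congrArg _ (ContinuousLinearMap.ext hv).symm

end IsPseudoRiemannian

namespace IsParaKahler

variable {x : X}

theorem sq_apply (h : IsParaKahler I J g) (v : TangentSpace I x) : J x (J x v) = v :=
  h.paraComplex.involution x v

theorem fundForm_nondegenerate (h : IsParaKahler I J g) (v : TangentSpace I x)
    (hv : ∀ w, fundForm I J g x v w = 0) : v = 0 := by
  rw [← h.sq_apply v, h.metric.nondegenerate x (J x v) hv, map_zero]

theorem fundForm_antisymm (h : IsParaKahler I J g) (v w : TangentSpace I x) :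
    fundForm I J g x v w = -fundForm I J g x w v := by
  have := h.skew x v w
  rw [h.metric.symm x v] at this
  exact this

theorem fundForm_apply_right (h : IsParaKahler I J g) (v w : TangentSpace I x) :
    fundForm I J g x v (J x w) = -fundForm I J g x (J x v) w :=
  neg_eq_iff_eq_neg.1 (h.skew x (J x v) w).symm

variable [FiniteDimensional ℝ E]

theorem isInvertible_fundForm (h : IsParaKahler I J g) (x : X) : (fundForm I J g x).IsInvertible :=
  isInvertible_of_nondegenerate (V := E) (b := fundForm I J g x)
    (h.fundForm_nondegenerate (x := x))

theorem fundForm_inverse_apply (h : IsParaKahler I J g)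
    (a : TangentSpace I x →L[ℝ] ℝ) (w : TangentSpace I x) :
    fundForm I J g x ((fundForm I J g x).inverse a) w = a w :=
  congr($((h.isInvertible_fundForm x).self_apply_inverse a) w)

theorem fundForm_inverse_eq (h : IsParaKahler I J g)
    {a : TangentSpace I x →L[ℝ] ℝ} {v : TangentSpace I x}
    (hv : ∀ w, fundForm I J g x v w = a w) : (fundForm I J g x).inverse a = v := by
  rw [← (h.isInvertible_fundForm x).inverse_apply_self v]
  exact congrArg _ (ContinuousLinearMap.ext hv).symm

theorem metric_inverse (h : IsParaKahler I J g) (a : TangentSpace I x →L[ℝ] ℝ) :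
    (g x).inverse a = J x ((fundForm I J g x).inverse a) :=
  h.metric.inverse_eq fun w ↦ h.fundForm_inverse_apply a w

theorem fundForm_inverse_comp (h : IsParaKahler I J g) (a : TangentSpace I x →L[ℝ] ℝ) :
    (fundForm I J g x).inverse (a ∘L J x) = -J x ((fundForm I J g x).inverse a) := by
  refine h.fundForm_inverse_eq fun w ↦ ?_
  rw [map_neg, neg_apply, ← h.fundForm_apply_right, h.fundForm_inverse_apply, comp_apply]

theorem metric_inverse_comp (h : IsParaKahler I J g) (a : TangentSpace I x →L[ℝ] ℝ) :
    (g x).inverse (a ∘L J x) = -(fundForm I J g x).inverse a := by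
  rw [h.metric_inverse, h.fundForm_inverse_comp, map_neg, h.sq_apply]

theorem metric_inverse_fundForm (h : IsParaKahler I J g) (v : TangentSpace I x) :
    (g x).inverse (fundForm I J g x v) = J x v :=
  h.metric.inverse_eq fun _ ↦ rfl

end IsParaKahler

variable [FiniteDimensional ℝ E]
  {cov : CovariantDerivative I E (TangentSpace I : X → Type _)} {ξ : CotangentBundle I X}

theorem splitting_cotJNabla (w : TangentSpace (cotModel I) ξ) :
    splitting cov ξ (cotJNabla cov J ξ w) =
      (J ξ.proj (cotProjDeriv ξ w), connector cov ξ w ∘L J ξ.proj) :=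
  (splitting cov ξ).apply_symm_apply _

theorem splitting_cotJOmega {b : BilinField I X} (w : TangentSpace (cotModel I) ξ) :
    splitting cov ξ (cotJOmega cov b ξ w) =
      ((b ξ.proj).inverse (connector cov ξ w), b ξ.proj (cotProjDeriv ξ w)) :=
  (splitting cov ξ).apply_symm_apply _

theorem cotProjDeriv_cotJNabla (w : TangentSpace (cotModel I) ξ) :
    cotProjDeriv ξ (cotJNabla cov J ξ w) = J ξ.proj (cotProjDeriv ξ w) :=
  congrArg Prod.fst (splitting_cotJNabla w)

theorem connector_cotJNabla (w : TangentSpace (cotModel I) ξ) :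
    connector cov ξ (cotJNabla cov J ξ w) = connector cov ξ w ∘L J ξ.proj :=
  congrArg Prod.snd (splitting_cotJNabla w)

theorem cotProjDeriv_cotJOmega {b : BilinField I X} (w : TangentSpace (cotModel I) ξ) :
    cotProjDeriv ξ (cotJOmega cov b ξ w) = (b ξ.proj).inverse (connector cov ξ w) :=
  congrArg Prod.fst (splitting_cotJOmega w)

theorem connector_cotJOmega {b : BilinField I X} (w : TangentSpace (cotModel I) ξ) :
    connector cov ξ (cotJOmega cov b ξ w) = b ξ.proj (cotProjDeriv ξ w) :=
  congrArg Prod.snd (splitting_cotJOmega w)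

theorem cotMetric_apply (w w' : TangentSpace (cotModel I) ξ) : cotMetric cov g ξ w w' =
    g ξ.proj (cotProjDeriv ξ w) (cotProjDeriv ξ w') +
      connector cov ξ w' ((g ξ.proj).inverse (connector cov ξ w)) := rfl

theorem eq_of_cotProjDeriv_of_connector {w w' : TangentSpace (cotModel I) ξ}
    (h₁ : cotProjDeriv ξ w = cotProjDeriv ξ w') (h₂ : connector cov ξ w = connector cov ξ w') :
    w = w' :=
  (splitting cov ξ).injective (Prod.ext h₁ h₂)

theorem exists_cotProjDeriv_connector (cov : CovariantDerivative I E (TangentSpace I : X → Type _))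
    (v : TangentSpace I ξ.proj) (a : TangentSpace I ξ.proj →L[ℝ] ℝ) :
    ∃ w : TangentSpace (cotModel I) ξ, cotProjDeriv ξ w = v ∧ connector cov ξ w = a := by
  have h := (splitting cov ξ).apply_symm_apply (v, a)
  exact ⟨_, congrArg Prod.fst h, congrArg Prod.snd h⟩

/-- The endomorphism field `J^∇ J^ω` of the cotangent bundle, the complex structure `J₃`; here `ω`
is the fundamental form of `(J, g)`. -/
def cotJProd (cov : CovariantDerivative I E (TangentSpace I : X → Type _)) (J : EndField I X)
    (g : BilinField I X) : EndField (cotModel I) (CotangentBundle I X) := fun ξ ↦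
  cotJNabla cov J ξ ∘L cotJOmega cov (fundForm I J g) ξ

theorem cotProjDeriv_cotJProd (w : TangentSpace (cotModel I) ξ) :
    cotProjDeriv ξ (cotJProd cov J g ξ w) =
      J ξ.proj ((fundForm I J g ξ.proj).inverse (connector cov ξ w)) := by
  rw [cotJProd, comp_apply, cotProjDeriv_cotJNabla, cotProjDeriv_cotJOmega]

theorem connector_cotJProd (w : TangentSpace (cotModel I) ξ) :
    connector cov ξ (cotJProd cov J g ξ w) =
      fundForm I J g ξ.proj (cotProjDeriv ξ w) ∘L J ξ.proj := by
  rw [cotJProd, comp_apply, connector_cotJNabla, connector_cotJOmega]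

theorem cotJNabla_cotJNabla (hJ : ∀ v, J ξ.proj (J ξ.proj v) = v)
    (w : TangentSpace (cotModel I) ξ) : cotJNabla cov J ξ (cotJNabla cov J ξ w) = w := by
  refine eq_of_cotProjDeriv_of_connector (cov := cov) ?_ (ContinuousLinearMap.ext fun v ↦ ?_)
  · rw [cotProjDeriv_cotJNabla, cotProjDeriv_cotJNabla, hJ]
  · rw [connector_cotJNabla, connector_cotJNabla, comp_apply, comp_apply, hJ]

theorem cotJOmega_cotJOmega {b : BilinField I X} (hb : (b ξ.proj).IsInvertible)
    (w : TangentSpace (cotModel I) ξ) : cotJOmega cov b ξ (cotJOmega cov b ξ w) = w := by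
  refine eq_of_cotProjDeriv_of_connector (cov := cov) ?_ ?_
  · rw [cotProjDeriv_cotJOmega, connector_cotJOmega, hb.inverse_apply_self]
  · rw [connector_cotJOmega, cotProjDeriv_cotJOmega, hb.self_apply_inverse]

namespace IsParaKahler

theorem cotJNabla_cotJOmega (h : IsParaKahler I J g) (w : TangentSpace (cotModel I) ξ) :
    cotJNabla cov J ξ (cotJOmega cov (fundForm I J g) ξ w) =
      -cotJOmega cov (fundForm I J g) ξ (cotJNabla cov J ξ w) := by
  refine eq_of_cotProjDeriv_of_connector (cov := cov) ?_ (ContinuousLinearMap.ext fun v ↦ ?_)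
  · rw [(cotProjDeriv ξ).map_neg, cotProjDeriv_cotJNabla, cotProjDeriv_cotJOmega,
      cotProjDeriv_cotJOmega, connector_cotJNabla, h.fundForm_inverse_comp, neg_neg]
  · rw [(connector cov ξ).map_neg, connector_cotJNabla, connector_cotJOmega, connector_cotJOmega,
      cotProjDeriv_cotJNabla, comp_apply]
    exact h.fundForm_apply_right _ _

theorem fundForm_cotJNabla (h : IsParaKahler I J g) (w w' : TangentSpace (cotModel I) ξ) :
    fundForm (cotModel I) (cotJNabla cov J) (cotMetric cov g) ξ w w' =
      fundForm I J g ξ.proj (cotProjDeriv ξ w) (cotProjDeriv ξ w') -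
        connector cov ξ w' ((fundForm I J g ξ.proj).inverse (connector cov ξ w)) := by
  change cotMetric cov g ξ (cotJNabla cov J ξ w) w' = _
  rw [cotMetric_apply, cotProjDeriv_cotJNabla, connector_cotJNabla, h.metric_inverse_comp, map_neg,
    ← sub_eq_add_neg]
  rfl

theorem fundForm_cotJOmega (h : IsParaKahler I J g) (w w' : TangentSpace (cotModel I) ξ) :
    fundForm (cotModel I) (cotJOmega cov (fundForm I J g)) (cotMetric cov g) ξ w w' =
      connector cov ξ w' (J ξ.proj (cotProjDeriv ξ w)) -
        connector cov ξ w (J ξ.proj (cotProjDeriv ξ w')) := by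
  change cotMetric cov g ξ (cotJOmega cov (fundForm I J g) ξ w) w' = _
  rw [cotMetric_apply, cotProjDeriv_cotJOmega, connector_cotJOmega, h.metric_inverse_fundForm,
    sub_eq_add_neg, add_comm]
  congr 1
  have hinverse := h.metric.inverse_apply (connector cov ξ w) (J ξ.proj (cotProjDeriv ξ w'))
  rw [h.metric_inverse, h.skew, h.sq_apply] at hinverse
  rw [← hinverse, neg_neg]

theorem fundForm_cotJProd (h : IsParaKahler I J g) (w w' : TangentSpace (cotModel I) ξ) :
    fundForm (cotModel I) (cotJProd cov J g) (cotMetric cov g) ξ w w' =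
      connector cov ξ w (cotProjDeriv ξ w') - connector cov ξ w' (cotProjDeriv ξ w) := by
  change cotMetric cov g ξ (cotJProd cov J g ξ w) w' = _
  rw [cotMetric_apply, cotProjDeriv_cotJProd, connector_cotJProd, ← h.metric_inverse,
    h.metric.inverse_apply, h.metric_inverse_comp, map_neg, ← sub_eq_add_neg]
  congr 2
  exact h.fundForm_inverse_eq fun _ ↦ rfl

end IsParaKahler

namespace IsPseudoRiemannian

theorem cotMetric_symm (hg : IsPseudoRiemannian I g) (w w' : TangentSpace (cotModel I) ξ) :
    cotMetric cov g ξ w w' = cotMetric cov g ξ w' w := by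
  rw [cotMetric_apply, cotMetric_apply, hg.symm _ (cotProjDeriv ξ w),
    ← hg.inverse_apply (connector cov ξ w), hg.symm _ _ ((g ξ.proj).inverse _),
    hg.inverse_apply]

theorem cotMetric_nondegenerate (hg : IsPseudoRiemannian I g) (w : TangentSpace (cotModel I) ξ)
    (hw : ∀ w', cotMetric cov g ξ w w' = 0) : w = 0 := by
  refine eq_zero_of_connector cov (hg.nondegenerate _ _ fun v ↦ ?_) ?_
  · obtain ⟨w', h₁, h₂⟩ := exists_cotProjDeriv_connector cov (ξ := ξ) v 0
    simpa [cotMetric_apply, h₁, h₂] using hw w'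
  · ext v
    obtain ⟨w', h₁, h₂⟩ := exists_cotProjDeriv_connector cov (ξ := ξ) 0 (g ξ.proj v)
    have hzero := hw w'
    rw [cotMetric_apply, h₁, h₂, map_zero, zero_add, hg.symm, hg.inverse_apply] at hzero
    exact hzero

end IsPseudoRiemannian

end FibreAlgebra

section LinearModel

open ContinuousLinearMap

variable {E : Type*} [NormedAddCommGroup E] [NormedSpace ℝ E]

/-- The endomorphism `(a, β) ↦ (A a, β ∘ A)`, the coefficients of `J^∇`. -/
def prodDual (A : E →L[ℝ] E) : E × (E →L[ℝ] ℝ) →L[ℝ] E × (E →L[ℝ] ℝ) :=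
  A.prodMap (precomp ℝ A)

/-- The endomorphism `(a, β) ↦ (c⁻¹ β, s c a)`, the coefficients of `J^ω` for `s = 1` and of
`J^∇ J^ω` for `s = -1`. -/
def swapDual (c : E →L[ℝ] E →L[ℝ] ℝ) (s : ℝ) : E × (E →L[ℝ] ℝ) →L[ℝ] E × (E →L[ℝ] ℝ) :=
  (c.inverse ∘L snd ℝ E (E →L[ℝ] ℝ)).prod ((s • c) ∘L fst ℝ E (E →L[ℝ] ℝ))

/-- The bilinear form `((a, β), (a', β')) ↦ c a a' - β' (c⁻¹ β)`, the coefficients of the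
fundamental form of `J^∇`. -/
def sumForm (c : E →L[ℝ] E →L[ℝ] ℝ) :
    E × (E →L[ℝ] ℝ) →L[ℝ] E × (E →L[ℝ] ℝ) →L[ℝ] ℝ :=
  c.bilinearComp (fst ℝ E (E →L[ℝ] ℝ)) (fst ℝ E (E →L[ℝ] ℝ)) -
    (apply ℝ ℝ).bilinearComp (c.inverse ∘L snd ℝ E (E →L[ℝ] ℝ)) (snd ℝ E (E →L[ℝ] ℝ))

/-- The bilinear form `((a, β), (a', β')) ↦ s (β a' - β' a)`, the coefficients of the fundamental
forms of `J^ω` for `s = -1` and of `J^∇ J^ω` for `s = 1`. -/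
def pairForm (s : ℝ) : E × (E →L[ℝ] ℝ) →L[ℝ] E × (E →L[ℝ] ℝ) →L[ℝ] ℝ :=
  s • ((ContinuousLinearMap.id ℝ (E →L[ℝ] ℝ)).bilinearComp (snd ℝ E (E →L[ℝ] ℝ))
      (fst ℝ E (E →L[ℝ] ℝ)) -
    (apply ℝ ℝ).bilinearComp (fst ℝ E (E →L[ℝ] ℝ)) (snd ℝ E (E →L[ℝ] ℝ)))

theorem prodDual_apply (A : E →L[ℝ] E) (q : E × (E →L[ℝ] ℝ)) :
    prodDual A q = (A q.1, q.2 ∘L A) := rfl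

theorem swapDual_apply (c : E →L[ℝ] E →L[ℝ] ℝ) (s : ℝ) (q : E × (E →L[ℝ] ℝ)) :
    swapDual c s q = (c.inverse q.2, s • c q.1) := rfl

theorem swapDual_neg_one_sq {c : E →L[ℝ] E →L[ℝ] ℝ} (hc : c.IsInvertible)
    (q : E × (E →L[ℝ] ℝ)) : swapDual c (-1) (swapDual c (-1) q) = -q := by
  rw [swapDual_apply, swapDual_apply, map_smul, hc.inverse_apply_self, hc.self_apply_inverse]
  ext <;> simp

theorem sumForm_apply (c : E →L[ℝ] E →L[ℝ] ℝ) (q q' : E × (E →L[ℝ] ℝ)) :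
    sumForm c q q' = c q.1 q'.1 - q'.2 (c.inverse q.2) := rfl

theorem sumForm_antisymm {c : E →L[ℝ] E →L[ℝ] ℝ} (hc : c.IsInvertible)
    (h : ∀ a b, c a b = -c b a) (q q' : E × (E →L[ℝ] ℝ)) : sumForm c q q' = -sumForm c q' q := by
  have hinverse (β β' : E →L[ℝ] ℝ) : β' (c.inverse β) = c (c.inverse β') (c.inverse β) := by
    rw [hc.self_apply_inverse]
  rw [sumForm_apply, sumForm_apply, hinverse q.2, hinverse q'.2, h q.1, h (c.inverse q'.2)]
  ring

theorem pairForm_apply (s : ℝ) (q q' : E × (E →L[ℝ] ℝ)) :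
    pairForm s q q' = s * (q.2 q'.1 - q'.2 q.1) := rfl

theorem pairForm_antisymm (s : ℝ) (q q' : E × (E →L[ℝ] ℝ)) :
    pairForm s q q' = -pairForm s q' q := by
  rw [pairForm_apply, pairForm_apply]
  ring

end LinearModel

section CotangentConstant

open Set ContinuousLinearMap

variable {E : Type*} [NormedAddCommGroup E] [NormedSpace ℝ E]
  {H : Type*} [TopologicalSpace H] {I : ModelWithCorners ℝ E H}
  {X : Type*} [TopologicalSpace X] [ChartedSpace H X] [IsManifold I ∞ X]
  {J : EndField I X} {g : BilinField I X}
  {cov : CovariantDerivative I E (TangentSpace I : X → Type _)}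
  {U : Set X} {χ φ : X → E} {c : E →L[ℝ] E →L[ℝ] ℝ}

namespace IsSpecialCoordinateOn

theorem form_mvfderiv (h : IsSpecialCoordinateOn J g cov U χ φ c) {x : X} (hx : x ∈ U)
    (v : TangentSpace I x) (e : E) :
    c (mvfderiv I χ x v) e = fundForm I J g x v (coordField I χ e x) := by
  rw [h.fundForm_eq x hx, h.mvfderiv_coordField hx]

theorem form_antisymm (h : IsSpecialCoordinateOn J g cov U χ φ c) (hJ : IsParaKahler I J g)
    {x : X} (hx : x ∈ U) (a b : E) : c a b = -c b a := by
  have hform := hJ.fundForm_antisymm (coordField I χ a x) (coordField I χ b x)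
  rwa [h.fundForm_eq x hx, h.fundForm_eq x hx, h.mvfderiv_coordField hx,
    h.mvfderiv_coordField hx] at hform

end IsSpecialCoordinateOn

variable [FiniteDimensional ℝ E] {ξ : CotangentBundle I X}

theorem IsConstantIn.cotJNabla [I.Boundaryless] [T2Space X] {Ψ : X → E} {J₀ : E →L[ℝ] E}
    (h : IsConstantIn J U Ψ J₀) (hJ : IsSmoothEndField I J) (htor : cov.torsion = 0)
    (hsymm : HasSymmetricDeriv cov J) :
    IsConstantIn (cotJNabla cov J) ((TotalSpace.proj : CotangentBundle I X → X) ⁻¹' U)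
      (cotCoord Ψ Ψ) (prodDual J₀) := by
  have hΨ := h.toIsCoordinateOn
  refine ⟨hΨ.cotCoord cov hΨ, fun ξ hξ w ↦ ?_⟩
  rw [hΨ.mvfderiv_cotCoord hΨ hξ, hΨ.mvfderiv_cotCoord hΨ hξ, prodDual_apply]
  refine Prod.ext ?_ (ContinuousLinearMap.ext fun e ↦ ?_)
  · rw [cotProjDeriv_cotJNabla]
    exact h.mvfderiv_apply _ hξ _
  · have hleft := hΨ.mvfderiv_momentum cov hξ (_root_.cotJNabla cov J ξ w) e
    have hright := hΨ.mvfderiv_momentum cov hξ w (J₀ e)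
    refine hleft.trans (Eq.trans ?_ hright.symm)
    rw [connector_cotJNabla, cotProjDeriv_cotJNabla, ← h.cov_coordField hJ htor hsymm hξ]
    refine congrArg (· + _) (congrArg (connector cov ξ w) (h.injective hξ ?_))
    refine (h.mvfderiv_apply _ hξ _).trans ?_
    rw [h.mvfderiv_coordField hξ, h.mvfderiv_coordField hξ]

namespace IsSpecialCoordinateOn

theorem mvfderiv_momentum_apply (h : IsSpecialCoordinateOn J g cov U χ φ c) (hξ : ξ.proj ∈ U)
    (w : TangentSpace (cotModel I) ξ) (e : E) :
    mvfderiv (cotModel I) (momentum I χ) ξ w e =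
      connector cov ξ w (coordField I χ e ξ.proj) := by
  rw [h.mvfderiv_momentum cov hξ, h.cov_coordField _ hξ, zero_apply, map_zero, add_zero]

theorem mvfderiv_momentum_mvfderiv (h : IsSpecialCoordinateOn J g cov U χ φ c) (hξ : ξ.proj ∈ U)
    (w : TangentSpace (cotModel I) ξ) (v : TangentSpace I ξ.proj) :
    mvfderiv (cotModel I) (momentum I χ) ξ w (mvfderiv I χ ξ.proj v) = connector cov ξ w v := by
  rw [h.mvfderiv_momentum_apply hξ, h.coordField_mvfderiv hξ]

theorem isCoordinateOn_conj (h : IsSpecialCoordinateOn J g cov U χ φ c)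
    (hJ : IsParaKahler I J g) : IsCoordinateOn I φ U := by
  refine ⟨h.isOpen, h.contMDiffOn_conj, fun x hx ↦ ?_⟩
  refine isInvertible_of_injective_endo (V := E) ?_
  refine (injective_iff_map_eq_zero (mvfderiv I φ x)).2 fun v hv ↦ ?_
  rw [h.mvfderiv_conj x hx] at hv
  rw [← hJ.sq_apply v, h.injective hx (hv.trans (map_zero _).symm), map_zero]

theorem isInvertible_form (h : IsSpecialCoordinateOn J g cov U χ φ c) (hJ : IsParaKahler I J g)
    {x : X} (hx : x ∈ U) : c.IsInvertible := by
  refine isInvertible_of_nondegenerate fun a ha ↦ ?_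
  rw [← h.mvfderiv_coordField hx a, hJ.fundForm_nondegenerate (coordField I χ a x) fun w ↦ ?_,
    map_zero]
  rw [h.fundForm_eq x hx, h.mvfderiv_coordField hx, ha]

theorem form_inverse_mvfderiv (h : IsSpecialCoordinateOn J g cov U χ φ c)
    (hJ : IsParaKahler I J g) (hξ : ξ.proj ∈ U) (w : TangentSpace (cotModel I) ξ) :
    c.inverse (mvfderiv (cotModel I) (momentum I χ) ξ w) =
      mvfderiv I χ ξ.proj ((fundForm I J g ξ.proj).inverse (connector cov ξ w)) := by
  have hc := h.isInvertible_form hJ hξ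
  refine Eq.trans ?_ (hc.inverse_apply_self _)
  congr 1
  ext e
  rw [h.form_mvfderiv hξ, hJ.fundForm_inverse_apply]
  exact h.mvfderiv_momentum_apply hξ w e

theorem isConstantIn_cotJOmega (h : IsSpecialCoordinateOn J g cov U χ φ c)
    (hJ : IsParaKahler I J g) :
    IsConstantIn (cotJOmega cov (fundForm I J g))
      ((TotalSpace.proj : CotangentBundle I X → X) ⁻¹' U) (cotCoord χ χ) (swapDual c 1) := by
  have hχ := h.toIsCoordinateOn
  refine ⟨hχ.cotCoord cov hχ, fun ξ hξ w ↦ ?_⟩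
  rw [hχ.mvfderiv_cotCoord hχ hξ, hχ.mvfderiv_cotCoord hχ hξ, swapDual_apply]
  refine Prod.ext ?_ (ContinuousLinearMap.ext fun e ↦ ?_)
  · rw [cotProjDeriv_cotJOmega]
    exact (h.form_inverse_mvfderiv hJ hξ w).symm
  · refine (h.mvfderiv_momentum_apply hξ _ e).trans ?_
    rw [connector_cotJOmega, one_smul, h.form_mvfderiv hξ]

theorem isConstantIn_cotJProd (h : IsSpecialCoordinateOn J g cov U χ φ c)
    (hJ : IsParaKahler I J g) :
    IsConstantIn (cotJProd cov J g)
      ((TotalSpace.proj : CotangentBundle I X → X) ⁻¹' U) (cotCoord φ χ) (swapDual c (-1)) := by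
  have hχ := h.toIsCoordinateOn
  have hφ := h.isCoordinateOn_conj hJ
  refine ⟨hφ.cotCoord cov hχ, fun ξ hξ w ↦ ?_⟩
  rw [hφ.mvfderiv_cotCoord hχ hξ, hφ.mvfderiv_cotCoord hχ hξ, swapDual_apply]
  refine Prod.ext ?_ (ContinuousLinearMap.ext fun e ↦ ?_)
  · rw [cotProjDeriv_cotJProd, h.mvfderiv_conj _ hξ, hJ.sq_apply]
    exact (h.form_inverse_mvfderiv hJ hξ w).symm
  · refine (h.mvfderiv_momentum_apply hξ _ e).trans ?_
    rw [connector_cotJProd, comp_apply, hJ.fundForm_apply_right, h.mvfderiv_conj _ hξ, smul_apply,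
      h.form_mvfderiv hξ, smul_eq_mul, neg_one_mul]

theorem fundForm_cotJNabla (h : IsSpecialCoordinateOn J g cov U χ φ c)
    (hJ : IsParaKahler I J g) (hξ : ξ.proj ∈ U) (w w' : TangentSpace (cotModel I) ξ) :
    fundForm (cotModel I) (cotJNabla cov J) (cotMetric cov g) ξ w w' =
      sumForm c (mvfderiv (cotModel I) (cotCoord χ χ) ξ w)
        (mvfderiv (cotModel I) (cotCoord χ χ) ξ w') := by
  have hχ := h.toIsCoordinateOn
  rw [hχ.mvfderiv_cotCoord hχ hξ, hχ.mvfderiv_cotCoord hχ hξ, sumForm_apply,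
    hJ.fundForm_cotJNabla, h.fundForm_eq _ hξ, h.form_inverse_mvfderiv hJ hξ,
    h.mvfderiv_momentum_mvfderiv hξ]

theorem fundForm_cotJOmega (h : IsSpecialCoordinateOn J g cov U χ φ c)
    (hJ : IsParaKahler I J g) (hξ : ξ.proj ∈ U) (w w' : TangentSpace (cotModel I) ξ) :
    fundForm (cotModel I) (cotJOmega cov (fundForm I J g)) (cotMetric cov g) ξ w w' =
      pairForm (-1) (mvfderiv (cotModel I) (cotCoord φ χ) ξ w)
        (mvfderiv (cotModel I) (cotCoord φ χ) ξ w') := by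
  have hχ := h.toIsCoordinateOn
  have hφ := h.isCoordinateOn_conj hJ
  rw [hφ.mvfderiv_cotCoord hχ hξ, hφ.mvfderiv_cotCoord hχ hξ, pairForm_apply,
    hJ.fundForm_cotJOmega, h.mvfderiv_conj _ hξ, h.mvfderiv_conj _ hξ,
    h.mvfderiv_momentum_mvfderiv hξ, h.mvfderiv_momentum_mvfderiv hξ]
  ring

theorem fundForm_cotJProd (h : IsSpecialCoordinateOn J g cov U χ φ c)
    (hJ : IsParaKahler I J g) (hξ : ξ.proj ∈ U) (w w' : TangentSpace (cotModel I) ξ) :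
    fundForm (cotModel I) (cotJProd cov J g) (cotMetric cov g) ξ w w' =
      pairForm 1 (mvfderiv (cotModel I) (cotCoord χ χ) ξ w)
        (mvfderiv (cotModel I) (cotCoord χ χ) ξ w') := by
  have hχ := h.toIsCoordinateOn
  rw [hχ.mvfderiv_cotCoord hχ hξ, hχ.mvfderiv_cotCoord hχ hξ, pairForm_apply,
    hJ.fundForm_cotJProd, h.mvfderiv_momentum_mvfderiv hξ, h.mvfderiv_momentum_mvfderiv hξ,
    one_mul]

end IsSpecialCoordinateOn

end CotangentConstant

section TotalSpaceTopology

variable {B F : Type*} {V : B → Type*} [TopologicalSpace B] [TopologicalSpace F]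
  [∀ b, TopologicalSpace (V b)] [TopologicalSpace (TotalSpace F V)] [FiberBundle F V]

theorem t2Space_totalSpace [T2Space B] [T2Space F] : T2Space (TotalSpace F V) := by
  refine ⟨fun x y hxy ↦ ?_⟩
  by_cases h : x.proj = y.proj
  · let e := trivializationAt F V x.proj
    have hx : x ∈ e.source := FiberBundle.mem_trivializationAt_proj_source
    have hy : y ∈ e.source := by
      rw [e.mem_source, ← h]
      exact FiberBundle.mem_baseSet_trivializationAt' _
    obtain ⟨u, v, hu, hv, hxu, hyv, huv⟩ := t2_separation (e.injOn.ne hx hy hxy)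
    refine ⟨_, _, e.continuousOn_toFun.isOpen_inter_preimage e.open_source hu,
      e.continuousOn_toFun.isOpen_inter_preimage e.open_source hv, ⟨hx, hxu⟩, ⟨hy, hyv⟩, ?_⟩
    exact (huv.preimage e).mono Set.inter_subset_right Set.inter_subset_right
  · exact separated_by_continuous (FiberBundle.continuous_proj F V) h

theorem secondCountableTopology_totalSpace [SecondCountableTopology B]
    [SecondCountableTopology F] : SecondCountableTopology (TotalSpace F V) := by
  obtain ⟨s, hs, hcover⟩ := TopologicalSpace.countable_cover_nhds
    fun b : B ↦ (trivializationAt F V b).open_baseSet.mem_nhds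
      (FiberBundle.mem_baseSet_trivializationAt' b)
  have : Countable s := hs
  have hsc (b : s) : SecondCountableTopology (trivializationAt F V (b : B)).source :=
    (trivializationAt F V
      (b : B)).toOpenPartialHomeomorph.toHomeomorphSourceTarget.isInducing.secondCountableTopology
  refine TopologicalSpace.secondCountableTopology_of_countable_cover
    (U := fun b : s ↦ (trivializationAt F V (b : B)).source)
    (fun b ↦ (trivializationAt F V (b : B)).open_source) ?_
  refine Set.eq_univ_of_forall fun x ↦ ?_
  obtain ⟨b, hb, hx⟩ := Set.mem_iUnion₂.1 (hcover.symm ▸ Set.mem_univ x.proj)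
  exact Set.mem_iUnion.2 ⟨⟨b, hb⟩, (Trivialization.mem_source _).2 hx⟩

end TotalSpaceTopology

section ParaHyperKahler

variable {E : Type*} [NormedAddCommGroup E] [NormedSpace ℝ E] [FiniteDimensional ℝ E]
  {H : Type*} [TopologicalSpace H] {I : ModelWithCorners ℝ E H}
  {X : Type*} [TopologicalSpace X] [ChartedSpace H X] [IsManifold I ∞ X]
  {J : EndField I X} {g : BilinField I X}
  {cov : CovariantDerivative I E (TangentSpace I : X → Type _)}

theorem IsAlmostParaComplex.exists_cotangent_tangent_ne_zero (hJ : IsAlmostParaComplex I J)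
    (cov : CovariantDerivative I E (TangentSpace I : X → Type _)) :
    ∃ (ξ : CotangentBundle I X) (w : TangentSpace (cotModel I) ξ), w ≠ 0 := by
  by_contra! hw
  refine hJ.ne_id (funext fun x ↦ ContinuousLinearMap.ext fun v ↦ ?_)
  have hzero (v : TangentSpace I x) : v = 0 := by
    obtain ⟨w, hwv, -⟩ := exists_cotProjDeriv_connector cov (ξ := ⟨x, 0⟩) v 0
    rw [← hwv, hw _ w, (cotProjDeriv _).map_zero]
  rw [hzero (J x v), hzero (ContinuousLinearMap.id ℝ _ v)]

namespace IsSpecialParaKahler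

variable [I.Boundaryless] [T2Space X]

theorem isLocallyConstantField_cotJNabla (h : IsSpecialParaKahler J g cov) :
    IsLocallyConstantField (cotJNabla cov J) := by
  intro ξ
  obtain ⟨U, χ, φ, c, hξ, hχ⟩ := h.exists_isSpecialCoordinateOn ξ.proj
  obtain ⟨V, Ψ, J₀, hξ', hΨ⟩ := hχ.toIsCoordinateOn.exists_isConstantIn_of_involutive
    hχ.contMDiffOn_conj hχ.mvfderiv_conj (fun _ v ↦ h.paraKahler.sq_apply v) hξ
  exact ⟨_, _, _, hξ', hΨ.cotJNabla h.paraKahler.paraComplex.smooth h.torsionFree h.symmetric⟩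

theorem isLocallyConstantField_cotJOmega (h : IsSpecialParaKahler J g cov) :
    IsLocallyConstantField (cotJOmega cov (fundForm I J g)) := by
  intro ξ
  obtain ⟨U, χ, φ, c, hξ, hχ⟩ := h.exists_isSpecialCoordinateOn ξ.proj
  exact ⟨_, _, _, hξ, hχ.isConstantIn_cotJOmega h.paraKahler⟩

theorem isLocallyConstantField_cotJProd (h : IsSpecialParaKahler J g cov) :
    IsLocallyConstantField (cotJProd cov J g) := by
  intro ξ
  obtain ⟨U, χ, φ, c, hξ, hχ⟩ := h.exists_isSpecialCoordinateOn ξ.proj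
  exact ⟨_, _, _, hξ, hχ.isConstantIn_cotJProd h.paraKahler⟩

theorem isParaComplex_cotJNabla (h : IsSpecialParaKahler J g cov) :
    IsParaComplex (cotModel I) (cotJNabla cov J) where
  toIsAlmostParaComplex := isAlmostParaComplex_of_anticomm
    (B := cotJOmega cov (fundForm I J g))
    h.isLocallyConstantField_cotJNabla.isSmoothEndField
    (fun _ ↦ cotJNabla_cotJNabla h.paraKahler.sq_apply)
    (fun _ ↦ cotJOmega_cotJOmega (h.paraKahler.isInvertible_fundForm _))
    (fun _ ↦ h.paraKahler.cotJNabla_cotJOmega)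
    (h.paraKahler.paraComplex.exists_cotangent_tangent_ne_zero cov)
  integrable_plus := h.isLocallyConstantField_cotJNabla.isIntegrableDistribution_eigenPlus
  integrable_minus := h.isLocallyConstantField_cotJNabla.isIntegrableDistribution_eigenMinus

theorem isParaComplex_cotJOmega (h : IsSpecialParaKahler J g cov) :
    IsParaComplex (cotModel I) (cotJOmega cov (fundForm I J g)) where
  toIsAlmostParaComplex := isAlmostParaComplex_of_anticomm (B := cotJNabla cov J)
    h.isLocallyConstantField_cotJOmega.isSmoothEndField
    (fun _ ↦ cotJOmega_cotJOmega (h.paraKahler.isInvertible_fundForm _))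
    (fun _ ↦ cotJNabla_cotJNabla h.paraKahler.sq_apply)
    (fun _ w ↦ neg_eq_iff_eq_neg.1 (h.paraKahler.cotJNabla_cotJOmega w).symm)
    (h.paraKahler.paraComplex.exists_cotangent_tangent_ne_zero cov)
  integrable_plus := h.isLocallyConstantField_cotJOmega.isIntegrableDistribution_eigenPlus
  integrable_minus := h.isLocallyConstantField_cotJOmega.isIntegrableDistribution_eigenMinus

theorem isComplexStructure_cotJProd (h : IsSpecialParaKahler J g cov) :
    IsComplexStructure (cotModel I) (cotJProd cov J g) where
  smooth := h.isLocallyConstantField_cotJProd.isSmoothEndField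
  sq_eq_neg ξ w := by
    change cotJNabla cov J ξ (cotJOmega cov _ ξ (cotJNabla cov J ξ (cotJOmega cov _ ξ w))) = -w
    rw [h.paraKahler.cotJNabla_cotJOmega w, ContinuousLinearMap.map_neg,
      ContinuousLinearMap.map_neg, cotJOmega_cotJOmega (h.paraKahler.isInvertible_fundForm _),
      cotJNabla_cotJNabla h.paraKahler.sq_apply]
  integrable ξ := by
    obtain ⟨U, χ, φ, c, hξ, hχ⟩ := h.exists_isSpecialCoordinateOn ξ.proj
    obtain ⟨ψ, hψ, hξψ, hd⟩ :=
      (hχ.isConstantIn_cotJProd h.paraKahler).exists_chart_apply hξ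
    exact ⟨ψ, hψ, hξψ, swapDual c (-1),
      swapDual_neg_one_sq (hχ.isInvertible_form h.paraKahler hξ), hd⟩

theorem isSmoothBilinField_cotMetric (h : IsSpecialParaKahler J g cov) :
    IsSmoothBilinField (cotModel I) (cotMetric cov g) := by
  have hform : IsSmoothBilinField (cotModel I)
      (fundForm (cotModel I) (cotJNabla cov J) (cotMetric cov g)) := by
    intro ξ
    obtain ⟨U, χ, φ, c, hξ, hχ⟩ := h.exists_isSpecialCoordinateOn ξ.proj
    have hcot := hχ.toIsCoordinateOn.cotCoord cov hχ.toIsCoordinateOn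
    refine contMDiffAt_bilinField_of_mvfderiv (hcot.contMDiffAt hξ) (sumForm c) ?_
    filter_upwards [hcot.isOpen.mem_nhds hξ] with η hη
    exact hχ.fundForm_cotJNabla h.paraKahler hη
  have hcomp := hform.comp_endField h.isParaComplex_cotJNabla.smooth
  convert hcomp using 2 with ξ
  ext w w'
  change _ = cotMetric cov g ξ (cotJNabla cov J ξ (cotJNabla cov J ξ w)) w'
  rw [cotJNabla_cotJNabla h.paraKahler.sq_apply]

theorem isPseudoRiemannian_cotMetric (h : IsSpecialParaKahler J g cov) :
    IsPseudoRiemannian (cotModel I) (cotMetric cov g) where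
  smooth := h.isSmoothBilinField_cotMetric
  symm _ := h.paraKahler.metric.cotMetric_symm
  nondegenerate _ := h.paraKahler.metric.cotMetric_nondegenerate

theorem isClosedTwoForm_cotJNabla (h : IsSpecialParaKahler J g cov) :
    IsClosedTwoForm (cotModel I) (fundForm (cotModel I) (cotJNabla cov J) (cotMetric cov g)) := by
  refine isClosedTwoForm_of_mvfderiv (V := E × (E →L[ℝ] ℝ)) fun ξ ↦ ?_
  obtain ⟨U, χ, φ, c, hξ, hχ⟩ := h.exists_isSpecialCoordinateOn ξ.proj
  have hcot := hχ.toIsCoordinateOn.cotCoord cov hχ.toIsCoordinateOn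
  refine ⟨_, sumForm c, hcot.contMDiffAt hξ,
    sumForm_antisymm (hχ.isInvertible_form h.paraKahler hξ) (hχ.form_antisymm h.paraKahler hξ), ?_⟩
  filter_upwards [hcot.isOpen.mem_nhds hξ] with η hη
  exact hχ.fundForm_cotJNabla h.paraKahler hη

theorem isClosedTwoForm_cotJOmega (h : IsSpecialParaKahler J g cov) :
    IsClosedTwoForm (cotModel I)
      (fundForm (cotModel I) (cotJOmega cov (fundForm I J g)) (cotMetric cov g)) := by
  refine isClosedTwoForm_of_mvfderiv (V := E × (E →L[ℝ] ℝ)) fun ξ ↦ ?_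
  obtain ⟨U, χ, φ, c, hξ, hχ⟩ := h.exists_isSpecialCoordinateOn ξ.proj
  have hcot := (hχ.isCoordinateOn_conj h.paraKahler).cotCoord cov hχ.toIsCoordinateOn
  refine ⟨_, pairForm (-1), hcot.contMDiffAt hξ, pairForm_antisymm (-1), ?_⟩
  filter_upwards [hcot.isOpen.mem_nhds hξ] with η hη
  exact hχ.fundForm_cotJOmega h.paraKahler hη

theorem isClosedTwoForm_cotJProd (h : IsSpecialParaKahler J g cov) :
    IsClosedTwoForm (cotModel I) (fundForm (cotModel I) (cotJProd cov J g) (cotMetric cov g)) := by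
  refine isClosedTwoForm_of_mvfderiv (V := E × (E →L[ℝ] ℝ)) fun ξ ↦ ?_
  obtain ⟨U, χ, φ, c, hξ, hχ⟩ := h.exists_isSpecialCoordinateOn ξ.proj
  have hcot := hχ.toIsCoordinateOn.cotCoord cov hχ.toIsCoordinateOn
  refine ⟨_, pairForm 1, hcot.contMDiffAt hξ, pairForm_antisymm 1, ?_⟩
  filter_upwards [hcot.isOpen.mem_nhds hξ] with η hη
  exact hχ.fundForm_cotJProd h.paraKahler hη

theorem isParaHypercomplex (h : IsSpecialParaKahler J g cov) :
    IsParaHypercomplex (cotModel I) (cotJNabla cov J) (cotJOmega cov (fundForm I J g))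
      (cotJProd cov J g) where
  eq_comp _ _ := rfl
  anticomm₁₂ _ := h.paraKahler.cotJNabla_cotJOmega
  anticomm₁₃ ξ w := by
    change cotJNabla cov J ξ (cotJNabla cov J ξ (cotJOmega cov _ ξ w)) =
      -cotJNabla cov J ξ (cotJOmega cov _ ξ (cotJNabla cov J ξ w))
    rw [h.paraKahler.cotJNabla_cotJOmega w, ContinuousLinearMap.map_neg]
  anticomm₂₃ ξ w := by
    change cotJOmega cov _ ξ (cotJNabla cov J ξ (cotJOmega cov _ ξ w)) =
      -cotJNabla cov J ξ (cotJOmega cov _ ξ (cotJOmega cov _ ξ w))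
    rw [h.paraKahler.cotJNabla_cotJOmega (cotJOmega cov _ ξ w), neg_neg]
  types := Or.inl ⟨h.isParaComplex_cotJNabla, h.isParaComplex_cotJOmega,
    h.isComplexStructure_cotJProd⟩

theorem isParaHyperKahler (h : IsSpecialParaKahler J g cov) :
    IsParaHyperKahler (cotModel I) (cotJNabla cov J) (cotJOmega cov (fundForm I J g))
      (cotJProd cov J g) (cotMetric cov g) where
  hypercomplex := h.isParaHypercomplex
  metric := h.isPseudoRiemannian_cotMetric
  skew₁ := isSkewFor_of_fundForm_antisymm (fun _ ↦ h.paraKahler.metric.cotMetric_symm)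
    fun ξ w w' ↦ by
      obtain ⟨U, χ, φ, c, hξ, hχ⟩ := h.exists_isSpecialCoordinateOn ξ.proj
      rw [hχ.fundForm_cotJNabla h.paraKahler hξ, hχ.fundForm_cotJNabla h.paraKahler hξ]
      exact sumForm_antisymm (hχ.isInvertible_form h.paraKahler hξ)
        (hχ.form_antisymm h.paraKahler hξ) _ _
  skew₂ := isSkewFor_of_fundForm_antisymm (fun _ ↦ h.paraKahler.metric.cotMetric_symm)
    fun ξ w w' ↦ by
      rw [h.paraKahler.fundForm_cotJOmega, h.paraKahler.fundForm_cotJOmega, neg_sub]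
  skew₃ := isSkewFor_of_fundForm_antisymm (fun _ ↦ h.paraKahler.metric.cotMetric_symm)
    fun ξ w w' ↦ by
      rw [h.paraKahler.fundForm_cotJProd, h.paraKahler.fundForm_cotJProd, neg_sub]
  closed₁ := h.isClosedTwoForm_cotJNabla
  closed₂ := h.isClosedTwoForm_cotJOmega
  closed₃ := h.isClosedTwoForm_cotJProd

end IsSpecialParaKahler

end ParaHyperKahler

end

theorem theorem2_general {E : Type*} [NormedAddCommGroup E] [NormedSpace ℝ E]
    [FiniteDimensional ℝ E] {H : Type*} [TopologicalSpace H] {I : ModelWithCorners ℝ E H}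
    [I.Boundaryless] {M : Type*} [TopologicalSpace M] [T2Space M] [ChartedSpace H M]
    [IsManifold I ∞ M] {J : EndField I M} {g : BilinField I M}
    {cov : CovariantDerivative I E (TangentSpace I : M → Type _)}
    (hM : IsSpecialParaKahler J g cov) :
    T2Space (CotangentBundle I M) ∧
    IsParaHyperKahler (cotModel I) (cotJNabla cov J) (cotJOmega cov (fundForm I J g))
      (cotJProd cov J g) (cotMetric cov g) ∧
    IsParaComplex (cotModel I) (cotJNabla cov J) ∧
    IsParaComplex (cotModel I) (cotJOmega cov (fundForm I J g)) ∧
    IsComplexStructure (cotModel I) (cotJProd cov J g) :=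
  ⟨t2Space_totalSpace, hM.isParaHyperKahler, hM.isParaComplex_cotJNabla,
    hM.isParaComplex_cotJOmega, hM.isComplexStructure_cotJProd⟩

theorem theorem2 {E : Type*} [NormedAddCommGroup E] [NormedSpace ℝ E] [FiniteDimensional ℝ E]
    {M : Type*} [TopologicalSpace M] [T2Space M] [SecondCountableTopology M]
    [ChartedSpace E M] [IsManifold 𝓘(ℝ, E) ∞ M]
    (J : EndField 𝓘(ℝ, E) M) (g : BilinField 𝓘(ℝ, E) M)
    (cov : CovariantDerivative 𝓘(ℝ, E) E (TangentSpace 𝓘(ℝ, E) : M → Type _))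
    (hM : IsSpecialParaKahler J g cov)
    (J₁ J₂ J₃ : EndField (cotModel 𝓘(ℝ, E)) (CotangentBundle 𝓘(ℝ, E) M))
    (gN : BilinField (cotModel 𝓘(ℝ, E)) (CotangentBundle 𝓘(ℝ, E) M))
    (hJ₁ : J₁ = cotJNabla cov J)
    (hJ₂ : J₂ = cotJOmega cov (fundForm 𝓘(ℝ, E) J g))
    (hJ₃ : J₃ = fun ξ ↦ J₁ ξ ∘L J₂ ξ)
    (hgN : gN = cotMetric cov g) :
    T2Space (CotangentBundle 𝓘(ℝ, E) M) ∧
    SecondCountableTopology (CotangentBundle 𝓘(ℝ, E) M) ∧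
    IsParaHyperKahler (cotModel 𝓘(ℝ, E)) J₁ J₂ J₃ gN ∧
    IsParaComplex (cotModel 𝓘(ℝ, E)) J₁ ∧
    IsParaComplex (cotModel 𝓘(ℝ, E)) J₂ ∧
    IsComplexStructure (cotModel 𝓘(ℝ, E)) J₃ := by
  subst hJ₁ hJ₂ hJ₃ hgN
  exact (theorem2_general hM).imp_right (⟨secondCountableTopology_totalSpace, ·⟩)
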